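/- Let $T>0$. For a Hamiltonian system $Jz'=\nabla\mathcal H(z)$, with $J=\begin{pmatrix}0&-I_N\\ I_N&0\end{pmatrix}$, and a $T$-periodic solution $z(t)$ let $P_z$ be the monodromy of $z$, i.e. the Poincaré operator at time $T$ of the linear system $Jw'=\nabla^2\mathcal H(z(t))w$. Let $\mathrm d^2\mathcal A(z)$ be the bilinear form $$\mathrm d^2\mathcal A(z)[w,u]=\ell_T(w,u)-\int_0^T\langle\nabla^2\mathcal H(z(t))w(t),u(t)\rangle\,\mathrm dt,\qquad w,u\in H^{1/2}_T,$$ where $H^{1/2}_T$ is the space of $w\in L^2(\mathbb R/T\mathbb Z,\mathbb R^{2N})$ with $\sum_{k\in\mathbb Z}|k||\hat w_k|^2<\infty$ and $\ell_T$ is the continuous extension to $H^{1/2}_T$ of $(w,u)\mapsto\int_0^T\langle Jw'(t),u(t)\rangle\,\mathrm dt$. **Proposition 4.1.** (a) Let $\Omega\subset\mathbb R^{2N}$ be open, let $\mathcal H:\Omega\to\mathbb R$ be of class $C^2$, and let $\mathfrak M\subset\Omega$ be a compact embedded $C^1$ submanifold (without boundary) consisting of initial conditions of non-constant $T$-periodic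 solutions of $Jz'=\nabla\mathcal H(z)$ in $\Omega$; identify $z\in\mathfrak M$ with the solution $z(t)$ such that $z(0)=z$. Then the following conditions are equivalent: (i) for every $z\in\mathfrak M$, $\dim\ker(I-P_z)=\dim\mathfrak M$; (ii) for every $z\in\mathfrak M$, the space of $T$-periodic solutions of $Jw'=\nabla^2\mathcal H(z(t))w$ has dimension $\dim\mathfrak M$; (iii) for every $z\in\mathfrak M$, $\dim\ker(\mathrm d^2\mathcal A(z))=\dim\mathfrak M$. (b) Let $a,b\in(0,+\infty]$, let $f:[0,a)\to[0,b)$ be continuous and of class $C^1$ on $(0,a)$, with $f(0)=0$, $f'>0$ on $(0,a)$ and $\lim_{s\to a^-}f(s)=b$, put $\varphi(v)=f(|v|)\frac{v}{|v|}$, $\varphi(0)=0$, and let $V:(0,+\infty)\to\mathbb R$ be of class $C^2$. Consider the planar system $$\dot x=\varphi^{-1}(p),\qquad \dot p=V'(|x|)\frac{x}{|x|},\qquad x\in\mathbb R^2\setminus\{0\},\ |p|<b,$$ which is Hamiltonian with $\mathcal H_0(x,p)=\int_0^{|p|}f^{-1}(\xi)\,\mathrm d\xi-V(|x|)$ and has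 the further first integral $\mathcal L(x,p)=x_1p_2-x_2p_1$. Let $x^*$ be a $T$-periodic solution of $\frac{\mathrm d}{\mathrm dt}\varphi(\dot x)=V'(|x|)\frac{x}{|x|}$ which is neither circular ($|x^*|$ is not constant) nor rectilinear ($x^*/|x^*|$ is not constant), and let $$\mathcal M_2=\{e^{i\phi}x^*(\cdot-\theta):\phi,\theta\in\mathbb R\},\qquad \mathfrak M=\Pi(\mathcal M_2),\qquad \Pi(x)=(x(0),\varphi(\dot x(0))).$$ Then $\mathfrak M$ is a compact two-dimensional embedded $C^1$ submanifold of $\{(x,p)\in\mathbb R^4: x\ne0,\ 0<|p|<b\}$ consisting of initial conditions of non-constant $T$-periodic solutions. Moreover, for every choice of action-angle coordinates as described below, conditions (i), (ii), (iii) for $\mathcal H=\mathcal H_0$ and this $\mathfrak M$ (of dimension $2$) are equivalent to each other and to (iv) $\det\nabla^2\mathcal K_0(I^*)\neq0$. Here $(H^*,L^*)$ is the value of $(\mathcal H_0,\mathcal L)$ at $\Pi(x^*)$, $\mathcal T^*$ is the connected component containing $\Pi(x^*)$ of the level set $\{\mathcal H_0=H^*,\ \mathcal L=L^*\}$, and action-angle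 coordinates consist of an open set $D\subset\mathbb R^2$, a $C^1$ diffeomorphism $\eta$ of $D$ onto an open neighbourhood of $(H^*,L^*)$, and a symplectic $C^1$ diffeomorphism $\Psi:D\times\mathbb T^2\to U$, $(I,\phi)\mapsto(x,p)$, onto an open neighbourhood $U$ of $\mathcal T^*$ in $\{x\neq0,\ |p|<b\}$, such that $\Psi(\{I\}\times\mathbb T^2)=\{\mathcal H_0=\eta_1(I),\ \mathcal L=\eta_2(I)\}\cap U$ for every $I\in D$, and such that $\Psi$ transforms the system into $\dot I=0$, $\dot\phi=\nabla\mathcal K_0(I)$ for a $C^2$ function $\mathcal K_0:D\to\mathbb R$; finally $I^*=\eta^{-1}(H^*,L^*)$. -/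

import Mathlib

open MeasureTheory Set Filter Topology

noncomputable section

namespace PeriodicNondeg

/-! ### Hamiltonian systems `J z' = ∇H(z)` in `ℝ^{2N}` -/

/-- The phase space `ℝ^{2N} = ℝ^N × ℝ^N` with its Euclidean structure: the left summand of the
index type carries the position `x`, the right one the momentum `p`. -/
abbrev PhaseSpace (N : ℕ) : Type := EuclideanSpace ℝ (Fin N ⊕ Fin N)

/-- The standard symplectic matrix `J = (0, -I; I, 0)` acting on `ℝ^{2N}`. -/
def sympJ (N : ℕ) : PhaseSpace N →L[ℝ] PhaseSpace N :=
  Matrix.toEuclideanCLM (𝕜 := ℝ) (Matrix.J (Fin N) ℝ)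

theorem sympJ_inl {N : ℕ} (v : PhaseSpace N) (i : Fin N) :
    sympJ N v (Sum.inl i) = -v (Sum.inr i) := by
  change ((Matrix.J (Fin N) ℝ).mulVec v.ofLp) (Sum.inl i) = _
  simp [Matrix.J, Matrix.fromBlocks_mulVec, Matrix.neg_mulVec]

theorem sympJ_inr {N : ℕ} (v : PhaseSpace N) (i : Fin N) :
    sympJ N v (Sum.inr i) = v (Sum.inl i) := by
  change ((Matrix.J (Fin N) ℝ).mulVec v.ofLp) (Sum.inr i) = _
  simp [Matrix.J, Matrix.fromBlocks_mulVec]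

/-- The Hessian `∇²H(z)`, as an endomorphism: the derivative of the gradient. -/
def hess {F : Type*} [NormedAddCommGroup F] [InnerProductSpace ℝ F] [CompleteSpace F]
    (H : F → ℝ) (z : F) : F →L[ℝ] F :=
  fderiv ℝ (gradient H) z

/-- `z : ℝ → Ω` is a `T`-periodic solution of `J z' = ∇H(z)`. -/
structure IsPeriodicSolution {N : ℕ} (H : PhaseSpace N → ℝ) (Ω : Set (PhaseSpace N)) (T : ℝ)
    (z : ℝ → PhaseSpace N) : Prop where
  mem : ∀ t, z t ∈ Ω
  solves : ∀ t, ∃ v, HasDerivAt z v t ∧ sympJ N v = gradient H (z t)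
  periodic : Function.Periodic z T

/-- `M` is an embedded `C¹` submanifold (without boundary) of dimension `k`: locally it is the
zero set of a `C¹` map to `ℝ^m`, `k + m = dim E`, of which `0` is a regular value. -/
def IsEmbeddedSubmanifold {E : Type*} [NormedAddCommGroup E] [NormedSpace ℝ E]
    (k : ℕ) (M : Set E) : Prop :=
  ∃ m : ℕ, k + m = Module.finrank ℝ E ∧
    ∀ z ∈ M, ∃ (U : Set E) (g : E → EuclideanSpace ℝ (Fin m)), IsOpen U ∧ z ∈ U ∧
      ContDiffOn ℝ 1 g U ∧ (∀ y ∈ U, g y = 0 → Function.Surjective (fderiv ℝ g y)) ∧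
      M ∩ U = {y ∈ U | g y = 0}

/-- `M ⊆ Ω` is a compact `k`-dimensional manifold made up by initial conditions of non-constant
`T`-periodic solutions of `J z' = ∇H(z)` in `Ω`. -/
structure IsPeriodicManifold {N : ℕ} (H : PhaseSpace N → ℝ) (Ω : Set (PhaseSpace N)) (T : ℝ)
    (k : ℕ) (M : Set (PhaseSpace N)) : Prop where
  subset : M ⊆ Ω
  isCompact : IsCompact M
  isManifold : IsEmbeddedSubmanifold k M
  exists_solution : ∀ z₀ ∈ M, ∃ z : ℝ → PhaseSpace N,
    IsPeriodicSolution H Ω T z ∧ z 0 = z₀ ∧ ∃ t, z t ≠ z 0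

/-! ### The linearized system `J w' = S(t) w` -/

/-- `P` is the Poincaré operator at time `T` (the monodromy) of the linear system `J w' = S(t) w`:
the value at time `T` of its fundamental solution `W` with `W(0) = I`. -/
def IsMonodromy {N : ℕ} (S : ℝ → PhaseSpace N →L[ℝ] PhaseSpace N) (T : ℝ)
    (P : PhaseSpace N →L[ℝ] PhaseSpace N) : Prop :=
  ∃ W : ℝ → PhaseSpace N →L[ℝ] PhaseSpace N, W 0 = ContinuousLinearMap.id ℝ (PhaseSpace N) ∧
    (∀ t, ∃ W', HasDerivAt W W' t ∧ (sympJ N).comp W' = (S t).comp (W t)) ∧ W T = P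

/-- The space of `T`-periodic solutions of the linear system `J w' = S(t) w`. -/
def periodicSolutions {N : ℕ} (S : ℝ → PhaseSpace N →L[ℝ] PhaseSpace N) (T : ℝ) :
    Submodule ℝ (ℝ → PhaseSpace N) where
  carrier := {w | (∀ t, ∃ v, HasDerivAt w v t ∧ sympJ N v = S t (w t)) ∧ Function.Periodic w T}
  zero_mem' := ⟨fun t => ⟨0, hasDerivAt_const t 0, by simp⟩, fun _ => rfl⟩
  add_mem' := by
    rintro w u ⟨hw, hwT⟩ ⟨hu, huT⟩
    refine ⟨fun t => ?_, hwT.add huT⟩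
    obtain ⟨v, hv, e⟩ := hw t
    obtain ⟨v', hv', e'⟩ := hu t
    exact ⟨v + v', hv.add hv', by simp [e, e']⟩
  smul_mem' := by
    rintro c w ⟨hw, hwT⟩
    refine ⟨fun t => ?_, hwT.smul c⟩
    obtain ⟨v, hv, e⟩ := hw t
    exact ⟨c • v, hv.const_smul c, by simp [e]⟩

/-! ### The fractional Sobolev space `H^{1/2}_T` and the second differential of the action -/

/-- `L²(ℝ/Tℤ, ℝ^{2N})` (with respect to the Haar measure of total mass `1`, i.e. `dt / T`). -/
abbrev LoopL2 (N : ℕ) (T : ℝ) [Fact (0 < T)] : Type :=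
  Lp (PhaseSpace N) 2 (AddCircle.haarAddCircle (T := T))

/-- The complex Fourier coefficient `ẑ_k ∈ ℂ^{2N}`, i.e.
`ẑ_k = T⁻¹ ∫_0^T z(t) exp(-2πikt/T) dt` in each component. -/
def coeff {N : ℕ} {T : ℝ} [Fact (0 < T)] (z : LoopL2 N T) (k : ℤ) : Fin N ⊕ Fin N → ℂ :=
  fun i => fourierCoeff (fun t : AddCircle T => ((z t i : ℝ) : ℂ)) k

theorem integrable_comp {N : ℕ} {T : ℝ} [Fact (0 < T)] (z : LoopL2 N T) (i : Fin N ⊕ Fin N) :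
    Integrable (fun t : AddCircle T => ((z t i : ℝ) : ℂ)) AddCircle.haarAddCircle := by
  have h : Integrable (fun t : AddCircle T => z t) AddCircle.haarAddCircle :=
    (Lp.memLp z).integrable (by norm_num)
  exact ((EuclideanSpace.proj i : PhaseSpace N →L[ℝ] ℝ).integrable_comp h).ofReal

theorem coeff_zero {N : ℕ} {T : ℝ} [Fact (0 < T)] (k : ℤ) (i : Fin N ⊕ Fin N) :
    coeff (0 : LoopL2 N T) k i = 0 := by
  have h : (fun t : AddCircle T => (((0 : LoopL2 N T) t i : ℝ) : ℂ))
      =ᵐ[AddCircle.haarAddCircle] fun _ => 0 := by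
    filter_upwards [Lp.coeFn_zero (PhaseSpace N) 2 (AddCircle.haarAddCircle (T := T))] with t ht
    rw [ht]
    simp
  simp only [coeff, fourierCoeff_congr_ae h]
  simp [fourierCoeff]

theorem coeff_add {N : ℕ} {T : ℝ} [Fact (0 < T)] (z w : LoopL2 N T) (k : ℤ)
    (i : Fin N ⊕ Fin N) : coeff (z + w) k i = coeff z k i + coeff w k i := by
  have h : (fun t : AddCircle T => (((z + w : LoopL2 N T) t i : ℝ) : ℂ))
      =ᵐ[AddCircle.haarAddCircle] (fun t => ((z t i : ℝ) : ℂ)) + fun t => ((w t i : ℝ) : ℂ) := by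
    filter_upwards [Lp.coeFn_add z w] with t ht
    rw [ht]
    simp
  simp only [coeff, fourierCoeff_congr_ae h]
  rw [fourierCoeff.add (integrable_comp z i) (integrable_comp w i)]
  rfl

theorem coeff_smul {N : ℕ} {T : ℝ} [Fact (0 < T)] (c : ℝ) (z : LoopL2 N T) (k : ℤ)
    (i : Fin N ⊕ Fin N) : coeff (c • z) k i = c * coeff z k i := by
  have h : (fun t : AddCircle T => (((c • z : LoopL2 N T) t i : ℝ) : ℂ))
      =ᵐ[AddCircle.haarAddCircle] fun t => (c : ℂ) * ((z t i : ℝ) : ℂ) := by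
    filter_upwards [Lp.coeFn_smul c z] with t ht
    rw [ht]
    simp
  simp only [coeff, fourierCoeff_congr_ae h]
  rw [fourierCoeff.const_mul]

/-- The fractional Sobolev space `H^{1/2}_T`: those `z ∈ L²` with `∑ |k| |ẑ_k|² < ∞`. -/
def HHalf (N : ℕ) (T : ℝ) [Fact (0 < T)] : Submodule ℝ (LoopL2 N T) where
  carrier := {z | Summable fun k : ℤ => |(k : ℝ)| * ∑ i, ‖coeff z k i‖ ^ 2}
  zero_mem' := by simp [coeff_zero, summable_zero]
  add_mem' := by
    intro z w hz hw
    refine Summable.of_nonneg_of_le (fun k => by positivity) (fun k => ?_)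
      ((hz.add hw).mul_left 2)
    rw [← mul_add, ← Finset.sum_add_distrib, mul_left_comm, Finset.mul_sum Finset.univ _ (2 : ℝ)]
    refine mul_le_mul_of_nonneg_left (Finset.sum_le_sum fun i _ => ?_)
      (abs_nonneg (k : ℝ))
    rw [coeff_add]
    nlinarith [norm_add_le (coeff z k i) (coeff w k i), norm_nonneg (coeff z k i + coeff w k i),
      sq_nonneg (‖coeff z k i‖ - ‖coeff w k i‖), norm_nonneg (coeff z k i),
      norm_nonneg (coeff w k i)]
  smul_mem' := by
    intro c z hz
    refine (hz.mul_left (c ^ 2)).congr fun k => ?_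
    simp only [coeff_smul, norm_mul, mul_pow, Complex.norm_real, Real.norm_eq_abs, sq_abs,
      ← Finset.mul_sum]
    ring

/-- The bilinear form `ℓ_T` on `H^{1/2}_T`: the continuous extension of
`(z, w) ↦ ∫_0^T ⟨J z'(t), w(t)⟩ dt`, written in Fourier coefficients. The series converges
absolutely on `H^{1/2}_T` by the Cauchy–Schwarz inequality (`loopForm_bound`), and
`loopForm_eq_integral` shows that it is the integral when `z` and `w` are `C¹`. -/
def loopForm {N : ℕ} {T : ℝ} [Fact (0 < T)] (z w : HHalf N T) : ℝ :=
  ∑' k : ℤ, (2 * Real.pi * Complex.I * k *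
    ((Matrix.J (Fin N) ℂ).mulVec (coeff z.1 k) ⬝ᵥ star (coeff w.1 k))).re

theorem mulVec_J_inl {N : ℕ} (v : Fin N ⊕ Fin N → ℂ) (i : Fin N) :
    (Matrix.J (Fin N) ℂ).mulVec v (Sum.inl i) = -v (Sum.inr i) := by
  simp [Matrix.J, Matrix.fromBlocks_mulVec, Matrix.neg_mulVec]

theorem mulVec_J_inr {N : ℕ} (v : Fin N ⊕ Fin N → ℂ) (i : Fin N) :
    (Matrix.J (Fin N) ℂ).mulVec v (Sum.inr i) = v (Sum.inl i) := by
  simp [Matrix.J, Matrix.fromBlocks_mulVec]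

theorem loopForm_bound {N : ℕ} {T : ℝ} [Fact (0 < T)] (z w : HHalf N T) :
    (Summable fun k : ℤ => ‖2 * Real.pi * Complex.I * k *
      ((Matrix.J (Fin N) ℂ).mulVec (coeff z.1 k) ⬝ᵥ star (coeff w.1 k))‖) ∧
    |loopForm z w| ≤ Real.pi * (∑' k : ℤ, |(k : ℝ)| * ∑ i, ‖coeff z.1 k i‖ ^ 2 +
      ∑' k : ℤ, |(k : ℝ)| * ∑ i, ‖coeff w.1 k i‖ ^ 2) := by
  have hz : Summable fun k : ℤ => |(k : ℝ)| * ∑ i, ‖coeff z.1 k i‖ ^ 2 := z.2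
  have hw : Summable fun k : ℤ => |(k : ℝ)| * ∑ i, ‖coeff w.1 k i‖ ^ 2 := w.2
  have key : ∀ k : ℤ, ‖2 * Real.pi * Complex.I * k *
      ((Matrix.J (Fin N) ℂ).mulVec (coeff z.1 k) ⬝ᵥ star (coeff w.1 k))‖ ≤
      Real.pi * (|(k : ℝ)| * ∑ i, ‖coeff z.1 k i‖ ^ 2 + |(k : ℝ)| * ∑ i, ‖coeff w.1 k i‖ ^ 2) := by
    intro k
    have h1 : ‖(Matrix.J (Fin N) ℂ).mulVec (coeff z.1 k) ⬝ᵥ star (coeff w.1 k)‖ ≤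
        (∑ i, ‖coeff z.1 k i‖ ^ 2 + ∑ i, ‖coeff w.1 k i‖ ^ 2) / 2 := by
      simp only [dotProduct, Fintype.sum_sum_type, mulVec_J_inl, mulVec_J_inr, Pi.star_apply]
      have a1 : ‖∑ i, -coeff z.1 k (Sum.inr i) * star (coeff w.1 k (Sum.inl i))‖ ≤
          ∑ i, (‖coeff z.1 k (Sum.inr i)‖ ^ 2 + ‖coeff w.1 k (Sum.inl i)‖ ^ 2) / 2 := by
        refine (norm_sum_le _ _).trans (Finset.sum_le_sum fun i _ => ?_)
        rw [norm_mul, norm_neg, norm_star]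
        nlinarith [sq_nonneg (‖coeff z.1 k (Sum.inr i)‖ - ‖coeff w.1 k (Sum.inl i)‖)]
      have a2 : ‖∑ i, coeff z.1 k (Sum.inl i) * star (coeff w.1 k (Sum.inr i))‖ ≤
          ∑ i, (‖coeff z.1 k (Sum.inl i)‖ ^ 2 + ‖coeff w.1 k (Sum.inr i)‖ ^ 2) / 2 := by
        refine (norm_sum_le _ _).trans (Finset.sum_le_sum fun i _ => ?_)
        rw [norm_mul, norm_star]
        nlinarith [sq_nonneg (‖coeff z.1 k (Sum.inl i)‖ - ‖coeff w.1 k (Sum.inr i)‖)]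
      refine (norm_add_le _ _).trans ((add_le_add a1 a2).trans (le_of_eq ?_))
      simp only [← Finset.sum_div, Finset.sum_add_distrib]
      ring
    have h2 : ‖2 * (Real.pi : ℂ) * Complex.I * k‖ = 2 * Real.pi * |(k : ℝ)| := by
      simp [abs_of_pos Real.pi_pos]
    rw [norm_mul, h2]
    calc _ ≤ 2 * Real.pi * |(k : ℝ)| *
          ((∑ i, ‖coeff z.1 k i‖ ^ 2 + ∑ i, ‖coeff w.1 k i‖ ^ 2) / 2) := by gcongr
      _ = _ := by ring
  have hs := (hz.add hw).mul_left Real.pi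
  have hn := Summable.of_nonneg_of_le (fun k => norm_nonneg _) key hs
  refine ⟨hn, ?_⟩
  rw [← hz.tsum_add hw, ← tsum_mul_left, ← Real.norm_eq_abs]
  exact tsum_of_norm_bounded hs.hasSum fun k =>
    (Complex.abs_re_le_norm _).trans (key k)

/-- On `C¹` loops the form `ℓ_T` is the integral `∫_0^T ⟨J z'(t), w(t)⟩ dt`. -/
theorem loopForm_eq_integral {N : ℕ} {T : ℝ} [Fact (0 < T)] (z w : HHalf N T)
    (zf wf : ℝ → PhaseSpace N) (hzf : ContDiff ℝ 1 zf) (hwf : ContDiff ℝ 1 wf)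
    (pz : Function.Periodic zf T) (pw : Function.Periodic wf T)
    (hz : ∀ᵐ t ∂AddCircle.haarAddCircle (T := T), z.1 t = pz.lift t)
    (hw : ∀ᵐ t ∂AddCircle.haarAddCircle (T := T), w.1 t = pw.lift t) :
    loopForm z w = ∫ t in (0 : ℝ)..T, inner ℝ (sympJ N (deriv zf t)) (wf t) := by
  have hT : 0 < T := Fact.out
  have cdz : Continuous (deriv zf) := hzf.continuous_deriv (by norm_num)
  have pdz : Function.Periodic (deriv zf) T := fun t => by
    have h : (fun s => zf (s + T)) = zf := funext pz
    rw [← deriv_comp_add_const, h]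
  -- complex valued components on the circle, and their lifts
  have lift_cont : ∀ (g : ℝ → ℂ) (hg : Continuous g) (pg : Function.Periodic g T),
      Continuous (pg.lift : AddCircle T → ℂ) := fun g hg pg =>
    continuous_quot_lift _ hg
  have coeff_lift : ∀ (g : ℝ → ℂ) (pg : Function.Periodic g T) (k : ℤ),
      fourierCoeff (pg.lift : AddCircle T → ℂ) k = fourierCoeffOn hT g k := by
    intro g pg k
    rw [fourierCoeff_eq_intervalIntegral _ _ 0, fourierCoeffOn_eq_integral]
    simp [zero_add, sub_zero, Function.Periodic.lift_coe]
  -- Parseval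
  have pars : ∀ (g h : ℝ → ℂ) (hg : Continuous g) (hh : Continuous h)
      (pg : Function.Periodic g T) (ph : Function.Periodic h T),
      HasSum (fun k : ℤ => (starRingEnd ℂ) (fourierCoeffOn hT h k) * fourierCoeffOn hT g k)
        ((T : ℂ)⁻¹ * ∫ t in (0 : ℝ)..T, (starRingEnd ℂ) (h t) * g t) := by
    intro g h hg hh pg ph
    let G : C(AddCircle T, ℂ) := ⟨pg.lift, lift_cont g hg pg⟩
    let K : C(AddCircle T, ℂ) := ⟨ph.lift, lift_cont h hh ph⟩
    let Gl := ContinuousMap.toLp (E := ℂ) 2 (AddCircle.haarAddCircle (T := T)) ℂ G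
    let Kl := ContinuousMap.toLp (E := ℂ) 2 (AddCircle.haarAddCircle (T := T)) ℂ K
    have H := (fourierBasis (T := T)).hasSum_inner_mul_inner Kl Gl
    have e1 : ∀ k, inner ℂ (fourierBasis (T := T) k) Gl = fourierCoeffOn hT g k := by
      intro k
      rw [← HilbertBasis.repr_apply_apply, fourierBasis_repr, fourierCoeff_toLp]
      exact coeff_lift g pg k
    have e2 : ∀ k, inner ℂ Kl (fourierBasis (T := T) k)
        = (starRingEnd ℂ) (fourierCoeffOn hT h k) := by
      intro k
      rw [← inner_conj_symm, ← HilbertBasis.repr_apply_apply, fourierBasis_repr,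
        fourierCoeff_toLp]
      exact congrArg _ (coeff_lift h ph k)
    have e3 : inner ℂ Kl Gl = (T : ℂ)⁻¹ * ∫ t in (0 : ℝ)..T, (starRingEnd ℂ) (h t) * g t := by
      rw [ContinuousMap.inner_toLp, AddCircle.integral_haarAddCircle,
        ← AddCircle.intervalIntegral_preimage T 0]
      simp [G, K, Function.Periodic.lift_coe, mul_comm]
    simpa only [e1, e2, e3] using H
  -- Fourier coefficients of a derivative
  have dcoef : ∀ (g g' : ℝ → ℂ) (hg : ∀ t, HasDerivAt g (g' t) t) (hg' : Continuous g')
      (pg : Function.Periodic g T) (k : ℤ),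
      T * fourierCoeffOn hT g' k = 2 * Real.pi * Complex.I * k * fourierCoeffOn hT g k := by
    intro g g' hg hg' pg k
    have hp : g T = g 0 := by simpa using pg 0
    have hTc : (T : ℂ) ≠ 0 := by exact_mod_cast hT.ne'
    by_cases hk : k = 0
    · subst hk
      rw [fourierCoeffOn_eq_integral]
      have : ∫ t in (0 : ℝ)..T, g' t = 0 := by
        rw [intervalIntegral.integral_eq_sub_of_hasDerivAt (fun t _ => hg t)
          (hg'.intervalIntegrable _ _), hp, sub_self]
      simp [this]
    · have hkc : (k : ℂ) ≠ 0 := by exact_mod_cast hk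
      rw [fourierCoeffOn_of_hasDerivAt hT hk (fun t _ => hg t) (hg'.intervalIntegrable _ _), hp]
      have hpi : (Real.pi : ℂ) ≠ 0 := by exact_mod_cast Real.pi_ne_zero
      field_simp
      push_cast
      ring
  have compc : ∀ (g : ℝ → PhaseSpace N) (hg : Continuous g) (i : Fin N ⊕ Fin N),
      Continuous fun t => ((g t i : ℝ) : ℂ) := fun g hg i => by fun_prop
  have compp : ∀ (g : ℝ → PhaseSpace N) (hg : Function.Periodic g T) (i : Fin N ⊕ Fin N),
      Function.Periodic (fun t => ((g t i : ℝ) : ℂ)) T := fun g hg i t => by simp [hg t]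
  have cf : ∀ (u : LoopL2 N T) (uf : ℝ → PhaseSpace N) (pu : Function.Periodic uf T)
      (hu : ∀ᵐ t ∂AddCircle.haarAddCircle (T := T), u t = pu.lift t) (k : ℤ) (i : Fin N ⊕ Fin N),
      coeff u k i = fourierCoeffOn hT (fun t => ((uf t i : ℝ) : ℂ)) k := by
    intro u uf pu hu k i
    rw [← coeff_lift _ (compp uf pu i) k, coeff]
    refine congrFun (fourierCoeff_congr_ae ?_) k
    filter_upwards [hu] with t ht
    rw [ht]
    induction t using QuotientAddGroup.induction_on with
    | H s => rfl
  have dz : ∀ (i : Fin N ⊕ Fin N) (t : ℝ),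
      HasDerivAt (fun t => ((zf t i : ℝ) : ℂ)) ((deriv zf t i : ℝ) : ℂ) t := by
    intro i t
    have h0 : HasDerivAt zf (deriv zf t) t :=
      (hzf.differentiable (by norm_num) t).hasDerivAt
    exact ((EuclideanSpace.proj i : PhaseSpace N →L[ℝ] ℝ).hasFDerivAt.comp_hasDerivAt t
      h0).ofReal_comp
  have dk : ∀ (k : ℤ) (i : Fin N ⊕ Fin N), 2 * Real.pi * Complex.I * k * coeff z.1 k i
      = T * fourierCoeffOn hT (fun t => ((deriv zf t i : ℝ) : ℂ)) k := by
    intro k i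
    rw [dcoef _ _ (dz i) (compc _ cdz i) (compp _ pz i) k, cf z.1 zf pz hz k i]
  have hTc : (T : ℂ) ≠ 0 := by exact_mod_cast hT.ne'
  have pairs : ∀ i j : Fin N ⊕ Fin N,
      HasSum (fun k : ℤ => 2 * Real.pi * Complex.I * k * coeff z.1 k i * star (coeff w.1 k j))
        (((∫ t in (0 : ℝ)..T, deriv zf t i * wf t j : ℝ)) : ℂ) := by
    intro i j
    have H := (pars _ _ (compc _ cdz i) (compc _ hwf.continuous j) (compp _ pdz i)
      (compp _ pw j)).mul_left (T : ℂ)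
    rw [← mul_assoc, mul_inv_cancel₀ hTc, one_mul] at H
    have e1 : (((∫ t in (0 : ℝ)..T, deriv zf t i * wf t j : ℝ)) : ℂ) =
        ∫ t in (0 : ℝ)..T, (starRingEnd ℂ) ((wf t j : ℝ) : ℂ) * ((deriv zf t i : ℝ) : ℂ) := by
      rw [← intervalIntegral.integral_ofReal]
      refine intervalIntegral.integral_congr fun t _ => ?_
      simp [mul_comm]
    rw [e1]
    refine Eq.subst (motive := fun F => HasSum F _) (funext fun k => Eq.symm ?_) H
    rw [dk, cf w.1 wf pw hw k j]
    simp only [starRingEnd_apply]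
    ring
  have tot : HasSum (fun k : ℤ => 2 * Real.pi * Complex.I * k *
      ((Matrix.J (Fin N) ℂ).mulVec (coeff z.1 k) ⬝ᵥ star (coeff w.1 k)))
      ((∑ i : Fin N, (-(((∫ t in (0 : ℝ)..T, deriv zf t (Sum.inr i) * wf t (Sum.inl i) : ℝ)) : ℂ)
        + (((∫ t in (0 : ℝ)..T, deriv zf t (Sum.inl i) * wf t (Sum.inr i) : ℝ)) : ℂ)))) := by
    have H := hasSum_sum (s := Finset.univ) fun (i : Fin N) _ =>
      (pairs (Sum.inr i) (Sum.inl i)).neg.add (pairs (Sum.inl i) (Sum.inr i))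
    refine Eq.subst (motive := fun F => HasSum F _) (funext fun k => Eq.symm ?_) H
    simp only [dotProduct, Fintype.sum_sum_type, mulVec_J_inl, mulVec_J_inr, Pi.star_apply,
      ← Finset.sum_add_distrib, Finset.mul_sum]
    refine Finset.sum_congr rfl fun i _ => ?_
    ring
  have re := Complex.hasSum_re tot
  rw [loopForm, re.tsum_eq]
  have ptw : ∀ t, inner ℝ (sympJ N (deriv zf t)) (wf t) =
      ∑ i : Fin N, (-(deriv zf t (Sum.inr i) * wf t (Sum.inl i))
        + deriv zf t (Sum.inl i) * wf t (Sum.inr i)) := by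
    intro t
    rw [PiLp.inner_apply, Fintype.sum_sum_type, ← Finset.sum_add_distrib]
    refine Finset.sum_congr rfl fun i _ => ?_
    simp [sympJ_inl, sympJ_inr]
    ring
  have cr : ∀ (g : ℝ → PhaseSpace N) (hg : Continuous g) (i : Fin N ⊕ Fin N),
      Continuous fun t => g t i := fun g hg i => by fun_prop
  simp only [ptw]
  rw [intervalIntegral.integral_finsetSum]
  swap
  · exact fun i _ => Continuous.intervalIntegrable
      ((((cr _ cdz _).mul (cr _ hwf.continuous _)).neg).add
        ((cr _ cdz _).mul (cr _ hwf.continuous _))) _ _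
  simp only [Complex.re_sum, Complex.add_re, Complex.neg_re, Complex.ofReal_re]
  refine Finset.sum_congr rfl fun i _ => ?_
  rw [intervalIntegral.integral_add, intervalIntegral.integral_neg]
  · exact Continuous.intervalIntegrable (((cr _ cdz _).mul (cr _ hwf.continuous _)).neg) _ _
  · exact Continuous.intervalIntegrable ((cr _ cdz _).mul (cr _ hwf.continuous _)) _ _

/-- The second differential `d²A(z)[w, u] = ℓ_T(w, u) - ∫_0^T ⟨∇²H(z(t)) w(t), u(t)⟩ dt` of the
Hamiltonian action functional, for `w, u ∈ H^{1/2}_T`. -/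
def d2Action {N : ℕ} {T : ℝ} [Fact (0 < T)] (H : PhaseSpace N → ℝ) (z : ℝ → PhaseSpace N)
    (w u : HHalf N T) : ℝ :=
  loopForm w u - ∫ t in (0 : ℝ)..T,
    inner ℝ (hess H (z t) (w.1 (t : AddCircle T))) (u.1 (t : AddCircle T))

/-- The kernel `{w | B[w, u] = 0 for all u}` of the form `B` is a linear subspace, of
dimension `k`. -/
def KernelHasDim {V : Type*} [AddCommGroup V] [Module ℝ V] (B : V → V → ℝ) (k : ℕ) : Prop :=
  ∃ K : Submodule ℝ V, (∀ w, w ∈ K ↔ ∀ u, B w u = 0) ∧ Module.rank ℝ K = k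

/-! ### The three non-degeneracy conditions for a fixed period `T` -/

/-- For every `z ∈ M`, `dim ker (I - P_z) = k`, with `P_z` the monodromy of `z`. -/
def MonodromyCondition {N : ℕ} (H : PhaseSpace N → ℝ) (Ω : Set (PhaseSpace N)) (T : ℝ)
    (k : ℕ) (M : Set (PhaseSpace N)) : Prop :=
  ∀ z, IsPeriodicSolution H Ω T z → z 0 ∈ M →
    ∃ P : PhaseSpace N →L[ℝ] PhaseSpace N, IsMonodromy (fun t => hess H (z t)) T P ∧
      Module.finrank ℝ (LinearMap.ker
        (ContinuousLinearMap.id ℝ (PhaseSpace N) - P : PhaseSpace N →L[ℝ] PhaseSpace N).toLinearMap)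
        = k

/-- For every `z ∈ M`, the space of `T`-periodic solutions of `J w' = ∇²H(z(t)) w` has
dimension `k`. -/
def LinearizedCondition {N : ℕ} (H : PhaseSpace N → ℝ) (Ω : Set (PhaseSpace N)) (T : ℝ)
    (k : ℕ) (M : Set (PhaseSpace N)) : Prop :=
  ∀ z, IsPeriodicSolution H Ω T z → z 0 ∈ M →
    Module.rank ℝ (periodicSolutions (fun t => hess H (z t)) T) = k

/-- For every `z ∈ M`, `dim ker d²A(z) = k`. -/
def ActionCondition {N : ℕ} (H : PhaseSpace N → ℝ) (Ω : Set (PhaseSpace N)) (T : ℝ)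
    [Fact (0 < T)] (k : ℕ) (M : Set (PhaseSpace N)) : Prop :=
  ∀ z, IsPeriodicSolution H Ω T z → z 0 ∈ M →
    KernelHasDim (d2Action (T := T) H z) k

/-! ### The planar central force problem -/

/-- The Euclidean plane. -/
abbrev Plane : Type := EuclideanSpace ℝ (Fin 2)

/-- The assumptions on the radial profile `f : [0, a) → [0, b)`, `a, b ∈ (0, ∞]`, of the map
`φ(v) = f(|v|) v / |v|`. They imply that `φ` is a homeomorphism of `B_a(0)` onto `B_b(0)`. -/
structure IsRadialProfile (a b : EReal) (f : ℝ → ℝ) : Prop where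
  a_pos : 0 < a
  b_pos : 0 < b
  mapsTo : ∀ s : ℝ, 0 ≤ s → (s : EReal) < a → 0 ≤ f s ∧ (f s : EReal) < b
  map_zero : f 0 = 0
  continuousOn : ContinuousOn f {s : ℝ | 0 ≤ s ∧ (s : EReal) < a}
  contDiffOn : ContDiffOn ℝ 1 f {s : ℝ | 0 < s ∧ (s : EReal) < a}
  deriv_pos : ∀ s : ℝ, 0 < s → (s : EReal) < a → 0 < deriv f s
  tendsto : Tendsto (fun s : ℝ => (f s : EReal)) (comap ((↑) : ℝ → EReal) (𝓝[<] a)) (𝓝 b)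

/-- `φ(v) = f(|v|) v / |v|`, `φ(0) = 0`. -/
def phiMap (f : ℝ → ℝ) (v : Plane) : Plane := (f ‖v‖ / ‖v‖) • v

/-- `G(s) = ∫_0^s f⁻¹(ξ) dξ`, with `f⁻¹ : [0, b) → [0, a)` the inverse of `f`. -/
def kineticG (a : EReal) (f : ℝ → ℝ) (s : ℝ) : ℝ :=
  ∫ ξ in (0 : ℝ)..s, Function.invFunOn f {r : ℝ | 0 ≤ r ∧ (r : EReal) < a} ξ

/-- The point `(x, p) ∈ ℝ⁴`. -/
def pair (x p : Plane) : PhaseSpace 2 := WithLp.toLp 2 (Sum.elim x p)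

/-- The position `x` of `z = (x, p)`. -/
def pos (z : PhaseSpace 2) : Plane := WithLp.toLp 2 fun i => z (Sum.inl i)

/-- The momentum `p` of `z = (x, p)`. -/
def mom (z : PhaseSpace 2) : Plane := WithLp.toLp 2 fun i => z (Sum.inr i)

/-- The Hamiltonian `H₀(x, p) = G(|p|) - V(|x|)`. -/
def centralHam (a : EReal) (f V : ℝ → ℝ) (z : PhaseSpace 2) : ℝ :=
  kineticG a f ‖mom z‖ - V ‖pos z‖

/-- The scalar angular momentum `x₁ p₂ - x₂ p₁`. -/
def angMom (z : PhaseSpace 2) : ℝ := pos z 0 * mom z 1 - pos z 1 * mom z 0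

/-- The phase space `{(x, p) : x ≠ 0, |p| < b}` of the planar central force problem. -/
def centralPhase (b : EReal) : Set (PhaseSpace 2) :=
  {z | pos z ≠ 0 ∧ (‖mom z‖ : EReal) < b}

/-- The part `p ≠ 0` of the phase space, on which `H₀` is of class `C²`. -/
def centralRegular (b : EReal) : Set (PhaseSpace 2) :=
  {z | z ∈ centralPhase b ∧ mom z ≠ 0}

/-- `x : ℝ → ℝ² \ {0}` solves `d/dt φ(x') = V'(|x|) x / |x|`. -/
def IsCentralSolution (a : EReal) (f V : ℝ → ℝ) (x : ℝ → Plane) : Prop :=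
  ∀ t, x t ≠ 0 ∧ DifferentiableAt ℝ x t ∧ (‖deriv x t‖ : EReal) < a ∧
    HasDerivAt (fun s => phiMap f (deriv x s)) ((deriv V ‖x t‖ / ‖x t‖) • x t) t

/-- `|x(t)| = R` for all `t`. -/
def IsCircular (x : ℝ → Plane) : Prop := ∃ R : ℝ, ∀ t, ‖x t‖ = R

/-- `x(t) / |x(t)| = c` for all `t`. -/
def IsRectilinear (x : ℝ → Plane) : Prop := ∃ c : Plane, ∀ t, ‖x t‖⁻¹ • x t = c

/-- The rotation `e^{iϕ}` of the plane. -/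
def rot (ϕ : ℝ) (x : Plane) : Plane :=
  !₂[Real.cos ϕ * x 0 - Real.sin ϕ * x 1, Real.sin ϕ * x 0 + Real.cos ϕ * x 1]

/-- `M₂ = {e^{iϕ} x(· - θ) : ϕ, θ ∈ ℝ}`. -/
def rotTranslates (x : ℝ → Plane) : Set (ℝ → Plane) :=
  {y | ∃ ϕ θ : ℝ, y = fun t => rot ϕ (x (t - θ))}

/-- `Π(x) = (x(0), φ(x'(0)))`. -/
def initialData (f : ℝ → ℝ) (x : ℝ → Plane) : PhaseSpace 2 :=
  pair (x 0) (phiMap f (deriv x 0))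

/-! ### Action-angle coordinates -/

/-- Action-angle coordinates `(I, φ) ∈ D × 𝕋²`, `𝕋 = ℝ/2πℤ`, for the integrable system with
Hamiltonian `H` and second first integral `L` on the phase space `W ⊆ ℝ⁴`, near the connected
component through `z₀` of the common level set of `H` and `L`. The diffeomorphism
`Ψ : D × 𝕋² → U` is represented by its lift to `D × ℝ²`, and `K` is the Hamiltonian in the new
coordinates. -/
structure ActionAngle (H L : PhaseSpace 2 → ℝ) (W : Set (PhaseSpace 2)) (z₀ : PhaseSpace 2) where
  D : Set Plane
  D' : Set Plane
  U : Set (PhaseSpace 2)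
  η : Plane → Plane
  Ψ : Plane × Plane → PhaseSpace 2
  K : Plane → ℝ
  isOpen_D : IsOpen D
  isOpen_D' : IsOpen D'
  isOpen_U : IsOpen U
  U_subset : U ⊆ W
  mem_D' : !₂[H z₀, L z₀] ∈ D'
  /-- `U` is a neighbourhood of the connected component of the level set. -/
  component_subset : connectedComponentIn {z ∈ W | H z = H z₀ ∧ L z = L z₀} z₀ ⊆ U
  /-- `η` is a diffeomorphism of `D` onto `D'`. -/
  η_bijOn : BijOn η D D'
  η_contDiffOn : ContDiffOn ℝ 1 η D
  η_immersion : ∀ I ∈ D, Function.Bijective (fderiv ℝ η I)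
  /-- `Ψ` is a diffeomorphism of `D × 𝕋²` onto `U`. -/
  Ψ_contDiffOn : ContDiffOn ℝ 1 Ψ (D ×ˢ univ)
  Ψ_image : Ψ '' (D ×ˢ univ) = U
  Ψ_eq_iff : ∀ I ∈ D, ∀ I' ∈ D, ∀ ϕ ϕ' : Plane, Ψ (I, ϕ) = Ψ (I', ϕ') ↔
    I = I' ∧ ∃ m : Fin 2 → ℤ, ∀ i, ϕ i = ϕ' i + 2 * Real.pi * m i
  Ψ_immersion : ∀ I ∈ D, ∀ ϕ, Function.Bijective (fderiv ℝ Ψ (I, ϕ))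
  /-- `Ψ` is symplectic: it pulls `dx ∧ dp` back to `dφ ∧ dI`. -/
  symplectic : ∀ I ∈ D, ∀ ϕ X Y X' Y' : Plane,
    inner ℝ (sympJ 2 (fderiv ℝ Ψ (I, ϕ) (X, Y))) (fderiv ℝ Ψ (I, ϕ) (X', Y')) =
      inner ℝ Y X' - inner ℝ X Y'
  /-- The tori `I = const` are the common level sets of `H` and `L` in `U`. -/
  level : ∀ I ∈ D, Ψ '' ({I} ×ˢ univ) = {z | H z = η I 0 ∧ L z = η I 1} ∩ U
  K_contDiffOn : ContDiffOn ℝ 2 K D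
  /-- In the new coordinates the system `J z' = ∇H(z)` reads `I' = 0`, `φ' = ∇K(I)`. -/
  canonical : ∀ I ∈ D, ∀ ϕ : Plane, ∀ t : ℝ, ∃ v,
    HasDerivAt (fun s : ℝ => Ψ (I, ϕ + s • gradient K I)) v t ∧
      sympJ 2 v = gradient H (Ψ (I, ϕ + t • gradient K I))

end PeriodicNondeg

end

open PeriodicNondeg

/-! Conditions (i) and (ii) agree by Floquet theory. Along a periodic orbit the coefficient of the
linearized system is continuous and periodic, hence bounded, so a fundamental solution exists and
solutions are determined by one value. A solution is periodic exactly when its value at time `0` is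
fixed by the monodromy, and evaluation at `0` identifies the periodic solutions with the kernel of
`I - P`.

Conditions (ii) and (iii) agree by regularity. Testing a kernel element `w` of the second
differential against trigonometric loops turns the kernel condition into the Fourier form of the
linearized equation. Square summability of the right-hand side makes the coefficients of `w`
absolutely summable; hence `w` is continuous, and integrating the equation once shows that it is a
classical solution (`exists_classical_solution`, `d2Action_kernel_iff`).

In the planar problem the angular momentum of a non-rectilinear solution is a nonzero constant, so
the momentum never vanishes and the orbit stays where the Hamiltonian is `C²`. The Hamiltonian field
and the rotation generator are independent along a non-circular orbit: if they were parallel at one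
point, a uniform rotation would be a solution through that point, and uniqueness would make the
orbit circular. So the energy-momentum map is a submersion along the torus of rotated and translated
data, while the torus parametrization is an immersion of complementary dimension into a level set.
Together they give an embedded surface (`eventually_mem_range_of_level`,
`IsRegularOrbit.isEmbeddedSubmanifold`).

In action-angle coordinates orbits are `Ψ(I, ϕ + t ∇K(I))`. Differentiating with respect to the
initial coordinates yields all solutions of the linearized system, namely `DΨ(X, Y + t ∇²K(I) X)`.
Since `DΨ` is the same at both ends of a period, such a solution is periodic exactly when `∇²K(I) X
= 0`, with `Y` free. The space of periodic solutions therefore has dimension `2 + dim ker ∇²K(I)`,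
which is `2` exactly when the determinant is nonzero (`ActionAngle.rank_periodicSolutions`). The
torus is connected, so it lies in the chart and has a single action value. -/

open PeriodicNondeg

/-! ### Linear differential equations with bounded continuous coefficients -/

section LinearODE

variable {F : Type*} [NormedAddCommGroup F] [NormedSpace ℝ F]

/-- The terms of the Dyson series of the linear equation `w' = A(t) w`, `w(0) = x₀`. -/
noncomputable def dysonTerm (A : ℝ → F →L[ℝ] F) (x₀ : F) : ℕ → ℝ → F
  | 0 => fun _ => x₀
  | n + 1 => fun t => ∫ s in (0 : ℝ)..t, A s (dysonTerm A x₀ n s)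

theorem continuous_dysonTerm {A : ℝ → F →L[ℝ] F} (hA : Continuous A) (x₀ : F) (n : ℕ) :
    Continuous (dysonTerm A x₀ n) := by
  induction n with
  | zero => exact continuous_const
  | succ n ih =>
    exact intervalIntegral.continuous_primitive
      (fun a b => (hA.clm_apply ih).intervalIntegrable a b) 0

theorem hasDerivAt_dysonTerm_succ [CompleteSpace F] {A : ℝ → F →L[ℝ] F}
    (hA : Continuous A) (x₀ : F) (n : ℕ)
    (t : ℝ) : HasDerivAt (dysonTerm A x₀ (n + 1)) (A t (dysonTerm A x₀ n t)) t :=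
  intervalIntegral.integral_hasDerivAt_right
    ((hA.clm_apply (continuous_dysonTerm hA x₀ n)).intervalIntegrable _ _)
    ((hA.clm_apply (continuous_dysonTerm hA x₀ n)).stronglyMeasurableAtFilter _ _)
    (hA.clm_apply (continuous_dysonTerm hA x₀ n)).continuousAt

/-- Each integration raises the power of `|t|` by one and divides by the new exponent, which builds
the factorial. Integrating over the unoriented interval treats both signs of `t` at once. -/
theorem norm_dysonTerm_le {A : ℝ → F →L[ℝ] F} (hA : Continuous A) {C : ℝ}
    (hC : ∀ t, ‖A t‖ ≤ C) (x₀ : F) (n : ℕ) (t : ℝ) :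
    ‖dysonTerm A x₀ n t‖ ≤ ‖x₀‖ * ((C * |t|) ^ n / n.factorial) := by
  have hC0 : 0 ≤ C := (norm_nonneg _).trans (hC 0)
  induction n generalizing t with
  | zero => simp [dysonTerm]
  | succ n ih =>
    have hb : ∀ s, ‖A s (dysonTerm A x₀ n s)‖ ≤
        ‖x₀‖ * (C ^ (n + 1) / n.factorial) * |s - 0| ^ n := by
      intro s
      calc ‖A s (dysonTerm A x₀ n s)‖ ≤ ‖A s‖ * ‖dysonTerm A x₀ n s‖ := (A s).le_opNorm _
        _ ≤ C * (‖x₀‖ * ((C * |s|) ^ n / n.factorial)) := by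
          gcongr
          · exact hC s
          · exact ih s
        _ = _ := by rw [sub_zero, mul_pow]; ring
    have h1 : ‖dysonTerm A x₀ (n + 1) t‖ ≤
        ∫ s in uIoc 0 t, ‖A s (dysonTerm A x₀ n s)‖ :=
      intervalIntegral.norm_integral_le_integral_norm_uIoc
    have h2 : ∫ s in uIoc 0 t, ‖A s (dysonTerm A x₀ n s)‖ ≤
        ∫ s in uIoc 0 t, ‖x₀‖ * (C ^ (n + 1) / n.factorial) * |s - 0| ^ n := by
      refine setIntegral_mono ?_ ?_ hb
      · exact intervalIntegrable_iff.1 ((hA.clm_apply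
          (continuous_dysonTerm hA x₀ n)).norm.intervalIntegrable _ _)
      · exact intervalIntegrable_iff.1 (Continuous.intervalIntegrable (by fun_prop) _ _)
    refine h1.trans (h2.trans (le_of_eq ?_))
    rw [integral_const_mul, integral_pow_abs_sub_uIoc, sub_zero, mul_pow, Nat.factorial_succ]
    push_cast
    field_simp

/-- The Dyson series is differentiated term by term: on a bounded interval the derivatives are
dominated by an exponential series. -/
theorem exists_hasDerivAt_linear [CompleteSpace F] {A : ℝ → F →L[ℝ] F} (hA : Continuous A) {C : ℝ}
    (hC : ∀ t, ‖A t‖ ≤ C) (x₀ : F) :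
    ∃ w : ℝ → F, w 0 = x₀ ∧ ∀ t, HasDerivAt w (A t (w t)) t := by
  have hC0 : 0 ≤ C := (norm_nonneg _).trans (hC 0)
  have hsum : ∀ t, Summable fun n => dysonTerm A x₀ n t := fun t =>
    Summable.of_norm_bounded ((Real.summable_pow_div_factorial _).mul_left _)
      fun n => norm_dysonTerm_le hA hC x₀ n t
  have hz : ∀ n, dysonTerm A x₀ (n + 1) 0 = 0 := fun n => by simp [dysonTerm]
  -- The constant term is split off because the derivative of term `n + 1` is `A` applied to term
  -- `n`: the derivatives of the tail sum up to `A` applied to the whole series.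
  refine ⟨fun t => x₀ + ∑' n, dysonTerm A x₀ (n + 1) t, by simp [hz], fun t => ?_⟩
  have key := hasDerivAt_tsum_of_isPreconnected (𝕜 := ℝ)
    (u := fun n => C * (‖x₀‖ * ((C * (|t| + 1)) ^ n / n.factorial)))
    (g := fun n => dysonTerm A x₀ (n + 1)) (g' := fun n s => A s (dysonTerm A x₀ n s))
    (t := Ioo (-(|t| + 1)) (|t| + 1)) (y₀ := t) (y := t)
    (((Real.summable_pow_div_factorial _).mul_left _).mul_left _) isOpen_Ioo
    isPreconnected_Ioo (fun n y _ => hasDerivAt_dysonTerm_succ hA x₀ n y) ?_ ?_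
    ((summable_nat_add_iff 1).2 (hsum t)) ?_
  · have e : ∑' n, A t (dysonTerm A x₀ n t) = A t (x₀ + ∑' n, dysonTerm A x₀ (n + 1) t) := by
      rw [← (A t).map_tsum (hsum t), (hsum t).tsum_eq_zero_add]
      rfl
    rw [← e]
    exact key.const_add x₀
  · intro n y hy
    have hy' : |y| ≤ |t| + 1 := (abs_lt.2 hy).le
    calc ‖A y (dysonTerm A x₀ n y)‖ ≤ ‖A y‖ * ‖dysonTerm A x₀ n y‖ := (A y).le_opNorm _
      _ ≤ C * (‖x₀‖ * ((C * |y|) ^ n / n.factorial)) := by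
        gcongr
        · exact hC y
        · exact norm_dysonTerm_le hA hC x₀ n y
      _ ≤ _ := by gcongr
  · constructor <;> [linarith [neg_abs_le t]; linarith [le_abs_self t]]
  · constructor <;> [linarith [neg_abs_le t]; linarith [le_abs_self t]]

theorem linear_ode_unique {A : ℝ → F →L[ℝ] F} {C : ℝ} (hC : ∀ t, ‖A t‖ ≤ C) {w u : ℝ → F}
    (hw : ∀ t, HasDerivAt w (A t (w t)) t) (hu : ∀ t, HasDerivAt u (A t (u t)) t) {t₀ : ℝ}
    (h : w t₀ = u t₀) : w = u := by
  refine ODE_solution_unique_univ (v := fun t x => A t x) (s := fun _ => univ)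
    (K := C.toNNReal) (fun t => ?_) (fun t => ⟨hw t, trivial⟩) (fun t => ⟨hu t, trivial⟩) h
  refine (((A t).lipschitz).weaken ?_).lipschitzOnWith
  rw [← NNReal.coe_le_coe, coe_nnnorm]
  exact (hC t).trans (Real.le_coe_toNNReal C)

end LinearODE

/-! ### The linear system solved for the derivative -/

theorem sympJ_sympJ {N : ℕ} (v : PhaseSpace N) : sympJ N (sympJ N v) = -v := by
  ext i
  rcases i with i | i <;> simp [sympJ_inl, sympJ_inr]

theorem sympJ_eq_iff {N : ℕ} {v u : PhaseSpace N} : sympJ N v = u ↔ v = -sympJ N u := by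
  constructor
  · rintro rfl
    rw [sympJ_sympJ, neg_neg]
  · rintro rfl
    rw [map_neg, sympJ_sympJ, neg_neg]

/-- The coefficient `-J S(t)` of the linear system `J w' = S(t) w` in normal form. -/
noncomputable def sympField {N : ℕ} (S : ℝ → PhaseSpace N →L[ℝ] PhaseSpace N) (t : ℝ) :
    PhaseSpace N →L[ℝ] PhaseSpace N :=
  -(sympJ N).comp (S t)

theorem sympField_apply {N : ℕ} (S : ℝ → PhaseSpace N →L[ℝ] PhaseSpace N) (t : ℝ)
    (w : PhaseSpace N) : sympField S t w = -sympJ N (S t w) := rfl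

theorem linear_system_iff {N : ℕ} {S : ℝ → PhaseSpace N →L[ℝ] PhaseSpace N}
    {w : ℝ → PhaseSpace N} {t : ℝ} :
    (∃ v, HasDerivAt w v t ∧ sympJ N v = S t (w t)) ↔ HasDerivAt w (sympField S t (w t)) t := by
  constructor
  · rintro ⟨v, hv, e⟩
    rw [sympField_apply, ← sympJ_eq_iff.1 e]
    exact hv
  · intro h
    exact ⟨_, h, sympJ_eq_iff.2 (sympField_apply S t _)⟩

/-! ### Monodromy and periodic solutions -/

section Monodromy

variable {N : ℕ} {S : ℝ → PhaseSpace N →L[ℝ] PhaseSpace N} {T : ℝ}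

theorem exists_bound_of_continuous_periodic {E : Type*} [NormedAddCommGroup E] {g : ℝ → E}
    (hg : Continuous g) (hT : 0 < T) (hp : Function.Periodic g T) : ∃ C, ∀ t, ‖g t‖ ≤ C := by
  obtain ⟨C, hC⟩ := (hp.isBounded_of_continuous hT.ne' hg).exists_norm_le
  exact ⟨C, fun t => hC _ (mem_range_self t)⟩

theorem continuous_sympField (hS : Continuous S) : Continuous (sympField S) :=
  (continuous_const.clm_comp hS).neg

theorem periodic_sympField (hp : Function.Periodic S T) : Function.Periodic (sympField S) T :=
  fun t => by simp only [sympField, hp t]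

theorem mem_periodicSolutions_iff {w : ℝ → PhaseSpace N} :
    w ∈ periodicSolutions S T ↔
      (∀ t, HasDerivAt w (sympField S t (w t)) t) ∧ Function.Periodic w T :=
  and_congr_left fun _ => forall_congr' fun _ => linear_system_iff

/-- A solution of a `T`-periodic linear system is `T`-periodic as soon as `w(T) = w(0)`. -/
theorem periodic_of_apply_eq (hS : Continuous S) (hT : 0 < T) (hp : Function.Periodic S T)
    {w : ℝ → PhaseSpace N} (hw : ∀ t, HasDerivAt w (sympField S t (w t)) t) (h : w T = w 0) :
    Function.Periodic w T := by
  obtain ⟨C, hC⟩ := exists_bound_of_continuous_periodic (continuous_sympField hS) hT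
    (periodic_sympField hp)
  have hw' : ∀ t, HasDerivAt (fun s => w (s + T)) (sympField S t (w (t + T))) t := fun t => by
    have := (hw (t + T)).comp_add_const t T
    rwa [periodic_sympField hp t] at this
  exact congrFun (linear_ode_unique hC hw' hw (t₀ := 0) (by simpa using h))

/-- The fundamental solution itself solves a linear equation, in the space of operators; its
coefficient is left composition with `sympField S t`. -/
theorem exists_isMonodromy (hS : Continuous S) (hT : 0 < T) (hp : Function.Periodic S T) :
    ∃ P, IsMonodromy S T P := by
  obtain ⟨C, hC⟩ := exists_bound_of_continuous_periodic (continuous_sympField hS) hT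
    (periodic_sympField hp)
  obtain ⟨W, hW0, hW⟩ := exists_hasDerivAt_linear
    (F := PhaseSpace N →L[ℝ] PhaseSpace N)
    (A := fun t => ContinuousLinearMap.compL ℝ (PhaseSpace N) (PhaseSpace N) (PhaseSpace N)
      (sympField S t))
    ((ContinuousLinearMap.continuous _).comp (continuous_sympField hS))
    (C := ‖ContinuousLinearMap.compL ℝ (PhaseSpace N) (PhaseSpace N) (PhaseSpace N)‖ * C)
    (fun t => (ContinuousLinearMap.le_opNorm _ _).trans (by gcongr; exact hC t))
    (ContinuousLinearMap.id ℝ (PhaseSpace N))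
  refine ⟨W T, W, hW0, fun t => ⟨_, hW t, ?_⟩, rfl⟩
  ext1 v
  exact sympJ_eq_iff.2 rfl

/-- The solutions of the linear system are `t ↦ W(t) w(0)`, with `W` the fundamental solution. -/
theorem PeriodicNondeg.IsMonodromy.apply (hS : Continuous S) (hT : 0 < T)
    (hp : Function.Periodic S T) {P : PhaseSpace N →L[ℝ] PhaseSpace N} (hP : IsMonodromy S T P) :
    (∀ w : ℝ → PhaseSpace N, (∀ t, HasDerivAt w (sympField S t (w t)) t) → w T = P (w 0)) ∧
    ∀ x : PhaseSpace N, ∃ w : ℝ → PhaseSpace N,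
      (∀ t, HasDerivAt w (sympField S t (w t)) t) ∧ w 0 = x := by
  obtain ⟨C, hC⟩ := exists_bound_of_continuous_periodic (continuous_sympField hS) hT
    (periodic_sympField hp)
  obtain ⟨W, hW0, hW, rfl⟩ := hP
  have hsol : ∀ x t, HasDerivAt (fun s => W s x) (sympField S t (W t x)) t := by
    intro x t
    obtain ⟨W', hW', e⟩ := hW t
    refine linear_system_iff.1 ⟨W' x, by simpa using hW'.clm_apply (hasDerivAt_const t x), ?_⟩
    exact congrArg (fun B : PhaseSpace N →L[ℝ] PhaseSpace N => B x) e
  refine ⟨fun w hw => ?_, fun x => ⟨fun t => W t x, hsol x, by simp [hW0]⟩⟩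
  exact congrFun (linear_ode_unique hC hw (hsol (w 0)) (t₀ := 0) (by simp [hW0])) T

/-- Evaluation at time `0` identifies the `T`-periodic solutions with the kernel of `I - P`. -/
theorem PeriodicNondeg.IsMonodromy.rank_periodicSolutions (hS : Continuous S) (hT : 0 < T)
    (hp : Function.Periodic S T) {P : PhaseSpace N →L[ℝ] PhaseSpace N} (hP : IsMonodromy S T P) :
    Module.rank ℝ (periodicSolutions S T) = Module.rank ℝ (LinearMap.ker
      (ContinuousLinearMap.id ℝ (PhaseSpace N) - P :
        PhaseSpace N →L[ℝ] PhaseSpace N).toLinearMap) := by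
  obtain ⟨C, hC⟩ := exists_bound_of_continuous_periodic (continuous_sympField hS) hT
    (periodic_sympField hp)
  obtain ⟨h1, h2⟩ := PeriodicNondeg.IsMonodromy.apply hS hT hp hP
  let ev : periodicSolutions S T →ₗ[ℝ] PhaseSpace N :=
    (LinearMap.proj (0 : ℝ)).comp (periodicSolutions S T).subtype
  have hinj : Function.Injective ev := by
    intro w u h
    exact Subtype.ext (linear_ode_unique hC (mem_periodicSolutions_iff.1 w.2).1
      (mem_periodicSolutions_iff.1 u.2).1 (t₀ := 0) h)
  have hr : LinearMap.range ev = LinearMap.ker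
      (ContinuousLinearMap.id ℝ (PhaseSpace N) - P :
        PhaseSpace N →L[ℝ] PhaseSpace N).toLinearMap := by
    ext x
    simp only [LinearMap.mem_range, LinearMap.mem_ker]
    constructor
    · rintro ⟨w, rfl⟩
      have e := h1 w.1 (mem_periodicSolutions_iff.1 w.2).1
      have e' : w.1 T = w.1 0 := by simpa using w.2.2 0
      change w.1 0 - P (w.1 0) = 0
      rw [← e, e', sub_self]
    · intro hx
      obtain ⟨w, hw, rfl⟩ := h2 x
      have e' : w 0 - P (w 0) = 0 := hx
      exact ⟨⟨w, mem_periodicSolutions_iff.2 ⟨hw, periodic_of_apply_eq hS hT hp hw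
        ((h1 w hw).trans (sub_eq_zero.1 e').symm)⟩⟩, rfl⟩
  rw [← hr]
  exact (LinearEquiv.ofInjective ev hinj).rank_eq

/-- The dimension on the right is a cardinal, as the solutions form a subspace of an
infinite-dimensional function space. The kernel of `I - P` is finite-dimensional, so passing to
`finrank` loses nothing. -/
theorem exists_isMonodromy_finrank_iff (hS : Continuous S) (hT : 0 < T)
    (hp : Function.Periodic S T) (k : ℕ) :
    (∃ P, IsMonodromy S T P ∧ Module.finrank ℝ (LinearMap.ker
      (ContinuousLinearMap.id ℝ (PhaseSpace N) - P :
        PhaseSpace N →L[ℝ] PhaseSpace N).toLinearMap)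
        = k) ↔ Module.rank ℝ (periodicSolutions S T) = k := by
  constructor
  · rintro ⟨P, hP, h⟩
    rw [PeriodicNondeg.IsMonodromy.rank_periodicSolutions hS hT hp hP, ← Module.finrank_eq_rank, h]
  · intro h
    obtain ⟨P, hP⟩ := exists_isMonodromy hS hT hp
    refine ⟨P, hP, ?_⟩
    rw [PeriodicNondeg.IsMonodromy.rank_periodicSolutions hS hT hp hP,
      ← Module.finrank_eq_rank] at h
    exact_mod_cast h

end Monodromy

/-! ### Regularity of the Hessian along an orbit, and the first equivalence -/

theorem contDiffOn_gradient {E : Type*} [NormedAddCommGroup E] [InnerProductSpace ℝ E]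
    [CompleteSpace E] {H : E → ℝ} {Ω : Set E} (hΩ : IsOpen Ω)
    (hH : ContDiffOn ℝ 2 H Ω) : ContDiffOn ℝ 1 (gradient H) Ω :=
  (InnerProductSpace.toDual ℝ E).symm.contDiff.comp_contDiffOn
    (hH.fderiv_of_isOpen hΩ (by norm_num))

theorem continuousOn_hess {E : Type*} [NormedAddCommGroup E] [InnerProductSpace ℝ E]
    [CompleteSpace E] {H : E → ℝ} {Ω : Set E} (hΩ : IsOpen Ω)
    (hH : ContDiffOn ℝ 2 H Ω) : ContinuousOn (hess H) Ω :=
  (contDiffOn_gradient hΩ hH).continuousOn_fderiv_of_isOpen hΩ le_rfl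

section Solutions

variable {N : ℕ} {H : PhaseSpace N → ℝ} {Ω : Set (PhaseSpace N)} {T : ℝ}
  {z : ℝ → PhaseSpace N}

namespace PeriodicNondeg.IsPeriodicSolution

theorem continuous (hz : IsPeriodicSolution H Ω T z) : Continuous z :=
  continuous_iff_continuousAt.2 fun t => by
    obtain ⟨v, hv, -⟩ := hz.solves t
    exact hv.continuousAt

theorem continuous_hess (hΩ : IsOpen Ω) (hH : ContDiffOn ℝ 2 H Ω)
    (hz : IsPeriodicSolution H Ω T z) : Continuous fun t => hess H (z t) :=
  (continuousOn_hess hΩ hH).comp_continuous hz.continuous hz.mem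

theorem periodic_hess (hz : IsPeriodicSolution H Ω T z) :
    Function.Periodic (fun t => hess H (z t)) T := fun t => by simp only [hz.periodic t]

end PeriodicNondeg.IsPeriodicSolution

theorem monodromyCondition_iff {k : ℕ} {M : Set (PhaseSpace N)} (hT : 0 < T) (hΩ : IsOpen Ω)
    (hH : ContDiffOn ℝ 2 H Ω) :
    MonodromyCondition H Ω T k M ↔ LinearizedCondition H Ω T k M :=
  forall_congr' fun _ => forall_congr' fun hz => forall_congr' fun _ =>
    exists_isMonodromy_finrank_iff (hz.continuous_hess hΩ hH) hT hz.periodic_hess k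

end Solutions

/-! ### Fourier analysis of periodic loops -/

section Loops

theorem Function.Periodic.continuous_lift {T : ℝ} {E : Type*} [TopologicalSpace E] {g : ℝ → E}
    (hp : Function.Periodic g T) (hg : Continuous g) :
    Continuous (hp.lift : AddCircle T → E) :=
  continuous_quot_lift _ hg

variable {N : ℕ} {T : ℝ} [Fact (0 < T)]

theorem intervalIntegral_eq_haar (F : AddCircle T → ℝ) :
    ∫ t in (0 : ℝ)..T, F (t : AddCircle T) = T * ∫ t, F t ∂AddCircle.haarAddCircle := by
  have hT : 0 < T := Fact.out
  have h := AddCircle.intervalIntegral_preimage T 0 F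
  rw [zero_add] at h
  rw [h, AddCircle.integral_haarAddCircle, smul_eq_mul, mul_inv_cancel_left₀ hT.ne']

/-- The class in `L²` of a continuous periodic function. -/
noncomputable def toLoop {g : ℝ → PhaseSpace N} (hg : Continuous g)
    (hp : Function.Periodic g T) : LoopL2 N T :=
  ContinuousMap.toLp (E := PhaseSpace N) 2 (AddCircle.haarAddCircle (T := T)) ℝ
    ⟨hp.lift, hp.continuous_lift hg⟩

theorem coeFn_toLoop {g : ℝ → PhaseSpace N} (hg : Continuous g) (hp : Function.Periodic g T) :
    ∀ᵐ t ∂AddCircle.haarAddCircle (T := T), toLoop hg hp t = hp.lift t :=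
  ContinuousMap.coeFn_toLp (𝕜 := ℝ) _ _

theorem memLp_component (z : LoopL2 N T) (i : Fin N ⊕ Fin N) :
    MemLp (fun t : AddCircle T => ((z t i : ℝ) : ℂ)) 2 AddCircle.haarAddCircle :=
  ((EuclideanSpace.proj i : PhaseSpace N →L[ℝ] ℝ).comp_memLp' (Lp.memLp z)).ofReal

/-- The components of a loop, as complex valued functions. -/
noncomputable def component (z : LoopL2 N T) (i : Fin N ⊕ Fin N) :
    Lp ℂ 2 (AddCircle.haarAddCircle (T := T)) := (memLp_component z i).toLp _

theorem fourierCoeff_component (z : LoopL2 N T) (i : Fin N ⊕ Fin N) (k : ℤ) :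
    fourierCoeff (component z i) k = coeff z k i :=
  congrFun (fourierCoeff_congr_ae (MemLp.coeFn_toLp (memLp_component z i))) k

theorem coeff_toLoop {g : ℝ → PhaseSpace N} (hg : Continuous g)
    (hp : Function.Periodic g T) (k : ℤ) (i : Fin N ⊕ Fin N) :
    coeff (toLoop hg hp) k i =
      fourierCoeffOn (Fact.out : 0 < T) (fun t => ((g t i : ℝ) : ℂ)) k := by
  have h : coeff (toLoop hg hp) k i
      = fourierCoeff (fun t : AddCircle T => ((hp.lift t i : ℝ) : ℂ)) k := by
    refine congrFun (fourierCoeff_congr_ae ?_) k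
    filter_upwards [coeFn_toLoop hg hp] with t ht
    rw [ht]
  rw [h, fourierCoeff_eq_intervalIntegral _ _ 0, fourierCoeffOn_eq_integral]
  simp [Function.Periodic.lift_coe]

/-- Parseval for the Fourier basis of complex `L²`, applied to two real components; mixed indices
are allowed. -/
theorem hasSum_coeff_mul (z u : LoopL2 N T) (i j : Fin N ⊕ Fin N) :
    HasSum (fun k => coeff z k i * star (coeff u k j))
      ((∫ t, z t i * u t j ∂AddCircle.haarAddCircle : ℝ) : ℂ) := by
  have h := (fourierBasis (T := T)).hasSum_inner_mul_inner (component u j) (component z i)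
  have e1 : ∀ (v : LoopL2 N T) i k,
      inner ℂ (fourierBasis (T := T) k) (component v i) = coeff v k i := by
    intro v i k
    rw [← HilbertBasis.repr_apply_apply, fourierBasis_repr, fourierCoeff_component]
  have e2 : inner ℂ (component u j) (component z i)
      = ((∫ t, z t i * u t j ∂AddCircle.haarAddCircle : ℝ) : ℂ) := by
    rw [MeasureTheory.L2.inner_def, ← integral_complex_ofReal]
    refine integral_congr_ae ?_
    filter_upwards [MemLp.coeFn_toLp (memLp_component z i),
      MemLp.coeFn_toLp (memLp_component u j)] with t h1 h2
    rw [component, component, h1, h2]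
    simp
  rw [e2] at h
  refine Eq.subst (motive := fun F => HasSum F _) (funext fun k => ?_) h
  rw [e1, ← inner_conj_symm, e1, mul_comm]
  rfl

theorem integrable_component_mul (z u : LoopL2 N T) (i j : Fin N ⊕ Fin N) :
    Integrable (fun t => z t i * u t j) AddCircle.haarAddCircle :=
  MemLp.integrable_mul ((EuclideanSpace.proj i : PhaseSpace N →L[ℝ] ℝ).comp_memLp' (Lp.memLp z))
    ((EuclideanSpace.proj j : PhaseSpace N →L[ℝ] ℝ).comp_memLp' (Lp.memLp u))

/-- Parseval's identity. -/
theorem hasSum_coeff_dotProduct (z u : LoopL2 N T) :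
    HasSum (fun k => coeff z k ⬝ᵥ star (coeff u k))
      ((∫ t, inner ℝ (z t) (u t) ∂AddCircle.haarAddCircle : ℝ) : ℂ) := by
  have h := hasSum_sum (s := Finset.univ) fun i _ => hasSum_coeff_mul z u i i
  rw [← Complex.ofReal_sum, ← integral_finsetSum _
    fun i _ => integrable_component_mul z u i i] at h
  simpa [dotProduct, PiLp.inner_apply, mul_comm] using h

theorem summable_sq_coeff (z : LoopL2 N T) (i : Fin N ⊕ Fin N) :
    Summable fun k => ‖coeff z k i‖ ^ 2 := by
  have h := (hasSum_sq_fourierCoeff (component z i)).summable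
  simpa only [fourierCoeff_component] using h

theorem ext_coeff {z u : LoopL2 N T} (h : ∀ k i, coeff z k i = coeff u k i) : z = u := by
  have hc : ∀ i, component z i = component u i := fun i => by
    apply (fourierBasis (T := T)).repr.injective
    ext k
    rw [fourierBasis_repr, fourierBasis_repr, fourierCoeff_component, fourierCoeff_component, h]
  apply Lp.ext
  have hi : ∀ i, ∀ᵐ t ∂AddCircle.haarAddCircle (T := T), z t i = u t i := fun i => by
    filter_upwards [MemLp.coeFn_toLp (memLp_component z i),
      MemLp.coeFn_toLp (memLp_component u i)] with t h1 h2
    have h3 : component z i t = component u i t := by rw [hc]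
    rw [component, component, h1, h2] at h3
    exact_mod_cast h3
  filter_upwards [ae_all_iff.2 hi] with t ht
  ext i
  exact ht i

/-- Integration by parts, with boundary terms cancelling by periodicity. The index `k = 0` is
separate because the general formula divides by `k`; there it says that a derivative has mean zero.
-/
theorem coeff_deriv {w v : ℝ → PhaseSpace N} (hw : ∀ t, HasDerivAt w (v t) t)
    (hv : Continuous v) (pw : Function.Periodic w T) (pv : Function.Periodic v T)
    (cw : Continuous w) (k : ℤ) (i : Fin N ⊕ Fin N) :
    T * coeff (toLoop hv pv) k i = 2 * Real.pi * Complex.I * k * coeff (toLoop cw pw) k i := by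
  have hT : 0 < T := Fact.out
  rw [coeff_toLoop, coeff_toLoop]
  have hg : ∀ t, HasDerivAt (fun t => ((w t i : ℝ) : ℂ)) ((v t i : ℝ) : ℂ) t := fun t =>
    ((EuclideanSpace.proj i : PhaseSpace N →L[ℝ] ℝ).hasFDerivAt.comp_hasDerivAt t
      (hw t)).ofReal_comp
  have hg' : Continuous fun t => ((v t i : ℝ) : ℂ) := by fun_prop
  have hp : ((w T i : ℝ) : ℂ) = ((w 0 i : ℝ) : ℂ) := by
    have := pw 0
    rw [zero_add] at this
    rw [this]
  have hTc : (T : ℂ) ≠ 0 := by exact_mod_cast hT.ne'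
  by_cases hk : k = 0
  · subst hk
    rw [fourierCoeffOn_eq_integral]
    have : ∫ t in (0 : ℝ)..T, ((v t i : ℝ) : ℂ) = 0 := by
      rw [intervalIntegral.integral_eq_sub_of_hasDerivAt (fun t _ => hg t)
        (hg'.intervalIntegrable _ _), hp, sub_self]
    simp [this]
  · have hkc : (k : ℂ) ≠ 0 := by exact_mod_cast hk
    rw [fourierCoeffOn_of_hasDerivAt hT hk (fun t _ => hg t) (hg'.intervalIntegrable _ _), hp]
    have hpi : (Real.pi : ℂ) ≠ 0 := by exact_mod_cast Real.pi_ne_zero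
    field_simp
    push_cast
    ring

/-- For integers `|k| ≤ (2πk)²`, so the `H^{1/2}` sum is dominated by `T²` times the sum of the
squared coefficients of the derivative. -/
theorem toLoop_mem_HHalf {w v : ℝ → PhaseSpace N} (hw : ∀ t, HasDerivAt w (v t) t)
    (hv : Continuous v) (pw : Function.Periodic w T) (pv : Function.Periodic v T)
    (cw : Continuous w) : toLoop cw pw ∈ HHalf N T := by
  have hT : 0 < T := Fact.out
  have hs : Summable fun k => T ^ 2 * ∑ i, ‖coeff (toLoop hv pv) k i‖ ^ 2 :=
    (summable_sum fun i _ => summable_sq_coeff (toLoop hv pv) i).mul_left _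
  refine Summable.of_nonneg_of_le (fun k => by positivity) (fun k => ?_) hs
  rw [Finset.mul_sum, Finset.mul_sum]
  refine Finset.sum_le_sum fun i _ => ?_
  have h := congrArg norm (coeff_deriv hw hv pw pv cw k i)
  have e : ‖2 * (Real.pi : ℂ) * Complex.I * k‖ = 2 * Real.pi * |(k : ℝ)| := by
    simp [abs_of_pos Real.pi_pos]
  rw [norm_mul, norm_mul, e, Complex.norm_real, Real.norm_eq_abs, abs_of_pos hT] at h
  rw [← mul_pow, h, mul_pow]
  refine mul_le_mul_of_nonneg_right ?_ (by positivity)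
  have h1 : |(k : ℝ)| ≤ |(k : ℝ)| ^ 2 := by
    rcases eq_or_ne k 0 with rfl | hk
    · simp
    · have : (1 : ℝ) ≤ |(k : ℝ)| := by exact_mod_cast Int.one_le_abs hk
      nlinarith
  have h2 : (1 : ℝ) ≤ (2 * Real.pi) ^ 2 := by nlinarith [Real.pi_gt_three]
  rw [mul_pow]
  nlinarith [sq_nonneg |(k : ℝ)|]

theorem coeff_comp_sympJ {z u : LoopL2 N T}
    (h : ∀ᵐ t ∂AddCircle.haarAddCircle (T := T), u t = sympJ N (z t)) (k : ℤ) :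
    coeff u k = (Matrix.J (Fin N) ℂ).mulVec (coeff z k) := by
  ext i
  rcases i with i | i
  · have e : coeff u k (Sum.inl i) =
        fourierCoeff (fun t : AddCircle T => (-1 : ℂ) * ((z t (Sum.inr i) : ℝ) : ℂ)) k := by
      refine congrFun (fourierCoeff_congr_ae ?_) k
      filter_upwards [h] with t ht
      rw [ht, sympJ_inl]
      simp
    rw [e, fourierCoeff.const_mul, mulVec_J_inl]
    simp [coeff]
  · rw [mulVec_J_inr]
    refine congrFun (fourierCoeff_congr_ae ?_) k
    filter_upwards [h] with t ht
    rw [ht, sympJ_inr]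

/-- The factor `2πik` is absorbed into the coefficient of `w`, giving those of `w'`, and Parseval
applies. Only `w` has to be `C¹`, which allows `u` to range over all of `H^{1/2}_T` in the kernel
condition. -/
theorem loopForm_eq_integral_left {w v : ℝ → PhaseSpace N} (hw : ∀ t, HasDerivAt w (v t) t)
    (hv : Continuous v) (pw : Function.Periodic w T) (pv : Function.Periodic v T)
    (cw : Continuous w) (u : HHalf N T) :
    loopForm ⟨toLoop cw pw, toLoop_mem_HHalf hw hv pw pv cw⟩ u =
      T * ∫ t : AddCircle T, inner ℝ (sympJ N (pv.lift t)) (u.1 t) ∂AddCircle.haarAddCircle := by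
  have hJ : Continuous fun t => sympJ N (v t) := (sympJ N).continuous.comp hv
  have pJ : Function.Periodic (fun t => sympJ N (v t)) T := fun t => by simp only [pv t]
  have hlift : ∀ t : AddCircle T, pJ.lift t = sympJ N (pv.lift t) := fun t => by
    induction t using QuotientAddGroup.induction_on with
    | H s => rfl
  have hc : ∀ k, coeff (toLoop hJ pJ) k = (Matrix.J (Fin N) ℂ).mulVec (coeff (toLoop hv pv) k) :=
    coeff_comp_sympJ (by
      filter_upwards [coeFn_toLoop hJ pJ, coeFn_toLoop hv pv] with t h1 h2
      rw [h1, h2, hlift])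
  have hd : ∀ k : ℤ, (2 * Real.pi * Complex.I * k) • coeff (toLoop cw pw) k
      = (T : ℂ) • coeff (toLoop hv pv) k := fun k => by
    ext i
    exact (coeff_deriv hw hv pw pv cw k i).symm
  have h := Complex.hasSum_re ((hasSum_coeff_dotProduct (toLoop hJ pJ) u.1).mul_left (T : ℂ))
  rw [loopForm]
  refine (Eq.subst (motive := fun F => HasSum F _) (funext fun k => ?_) h).tsum_eq.trans ?_
  · rw [hc, ← smul_eq_mul, ← smul_eq_mul, ← smul_dotProduct, ← smul_dotProduct,
      ← Matrix.mulVec_smul, ← Matrix.mulVec_smul, ← hd]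
  · rw [← Complex.ofReal_mul, Complex.ofReal_re]
    congr 1
    refine integral_congr_ae ?_
    filter_upwards [coeFn_toLoop hJ pJ] with t h1
    rw [h1, hlift]

/-- Two signs cancel: `J` is antisymmetric and conjugation reverses `i`. Symmetry lets a smooth test
loop be moved into the first slot. -/
theorem loopForm_symm (w u : HHalf N T) : loopForm w u = loopForm u w := by
  refine tsum_congr fun k => ?_
  have h : (Matrix.J (Fin N) ℂ).mulVec (coeff u.1 k) ⬝ᵥ star (coeff w.1 k) =
      -star ((Matrix.J (Fin N) ℂ).mulVec (coeff w.1 k) ⬝ᵥ star (coeff u.1 k)) := by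
    simp only [dotProduct, Fintype.sum_sum_type, mulVec_J_inl, mulVec_J_inr, Pi.star_apply,
      star_add, star_sum, star_mul', star_neg, star_star]
    rw [neg_add, ← Finset.sum_neg_distrib, ← Finset.sum_neg_distrib, add_comm]
    congr 1 <;> exact Finset.sum_congr rfl fun i _ => by ring
  rw [h]
  simp [Complex.mul_re]

end Loops

/-! ### The kernel of the second differential -/

section Kernel

theorem continuous_fourier_coe {T : ℝ} (k : ℤ) :
    Continuous fun t : ℝ => fourier k (t : AddCircle T) :=
  (fourier k).continuous.comp (AddCircle.continuous_mk' T)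

theorem continuous_of_mem_periodicSolutions {N : ℕ} {T : ℝ}
    {S : ℝ → PhaseSpace N →L[ℝ] PhaseSpace N} (w : periodicSolutions S T) : Continuous w.1 :=
  continuous_iff_continuousAt.2 fun t => ((mem_periodicSolutions_iff.1 w.2).1 t).continuousAt

variable {N : ℕ} {T : ℝ} [Fact (0 < T)]

theorem integrable_fourier_mul (z : LoopL2 N T) (i : Fin N ⊕ Fin N) (k : ℤ) :
    Integrable (fun t => fourier (-k) t • ((z t i : ℝ) : ℂ)) (AddCircle.haarAddCircle (T := T)) :=
  (integrable_comp z i).fourier_smul _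

theorem integral_re_fourier_mul (z : LoopL2 N T) (b : ℂ) (k : ℤ) (i : Fin N ⊕ Fin N) :
    ∫ t, (b * fourier k t).re * z t i ∂AddCircle.haarAddCircle (T := T)
      = (b * coeff z (-k) i).re := by
  have h : Integrable (fun t => b * (fourier (- -k) t • ((z t i : ℝ) : ℂ)))
      (AddCircle.haarAddCircle (T := T)) := (integrable_fourier_mul z i (-k)).const_mul b
  rw [coeff, fourierCoeff, ← integral_const_mul]
  have := integral_re h
  simp only [RCLike.re_eq_complex_re] at this
  rw [← this]
  refine integral_congr_ae (Eventually.of_forall fun t => ?_)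
  simp only [neg_neg, smul_eq_mul]
  rw [← mul_assoc, Complex.re_mul_ofReal]

/-- This is the weak form of `J w' = g` read off at frequency `k`. The loops are real, so the test
loops are `Re(a e_{-k})` times a basis vector, and varying the complex number `a` recovers the full
complex identity from real parts. -/
theorem coeff_of_kernel {w : HHalf N T} {g : LoopL2 N T}
    (h : ∀ u : HHalf N T, loopForm w u =
      T * ∫ t, inner ℝ (g t) (u.1 t) ∂AddCircle.haarAddCircle) (k : ℤ) (i : Fin N ⊕ Fin N) :
    2 * Real.pi * Complex.I * k * (Matrix.J (Fin N) ℂ).mulVec (coeff w.1 k) i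
      = T * coeff g k i := by
  have hT : 0 < T := Fact.out
  have hTc : (T : ℂ) ≠ 0 := by exact_mod_cast hT.ne'
  have key : ∀ a : ℂ, (a * (2 * Real.pi * Complex.I * k *
      (Matrix.J (Fin N) ℂ).mulVec (coeff w.1 k) i - T * coeff g k i)).re = 0 := by
    intro a
    let e : ℝ → ℂ := fun t => fourier (-k) (t : AddCircle T)
    have he : ∀ t, HasDerivAt e (2 * Real.pi * Complex.I * (-k : ℤ) / T * e t) t :=
      hasDerivAt_fourier T (-k)
    have ce : Continuous e := continuous_fourier_coe (-k)
    -- The amplitude of the derivative of `a * e t`.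
    let b : ℂ := a * (2 * Real.pi * Complex.I * (-k : ℤ) / T)
    let E : PhaseSpace N := EuclideanSpace.single i 1
    let u : ℝ → PhaseSpace N := fun t => (a * e t).re • E
    let v : ℝ → PhaseSpace N := fun t => (b * e t).re • E
    have cu : Continuous u := by fun_prop
    have cv : Continuous v := by fun_prop
    have pe : Function.Periodic e T := fun t => by simp only [e, AddCircle.coe_add_period]
    have pu : Function.Periodic u T := fun t => by simp only [u, pe t]
    have pv : Function.Periodic v T := fun t => by simp only [v, pe t]
    have hu : ∀ t, HasDerivAt u (v t) t := fun t => by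
      have h1 := (he t).const_mul a
      have h2 : HasDerivAt (fun t => (a * e t).re)
          ((a * (2 * Real.pi * Complex.I * (-k : ℤ) / T * e t)).re) t :=
        Complex.reCLM.hasFDerivAt.comp_hasDerivAt t h1
      have h3 := h2.smul_const E
      simpa only [v, b, mul_assoc] using h3
    have lu : ∀ t : AddCircle T, pu.lift t = (a * fourier (-k) t).re • E := fun t => by
      induction t using QuotientAddGroup.induction_on with
      | H s => rfl
    have lv : ∀ t : AddCircle T, pv.lift t = (b * fourier (-k) t).re • E := fun t => by
      induction t using QuotientAddGroup.induction_on with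
      | H s => rfl
    have hU := h ⟨toLoop cu pu, toLoop_mem_HHalf hu cv pu pv cu⟩
    rw [loopForm_symm, loopForm_eq_integral_left hu cv pu pv cu] at hU
    have hm : MemLp (fun t => sympJ N (w.1 t)) 2 (AddCircle.haarAddCircle (T := T)) :=
      (sympJ N).comp_memLp' (Lp.memLp w.1)
    have hj := coeff_comp_sympJ (z := w.1) (u := hm.toLp) hm.coeFn_toLp k
    have i1 : ∫ t : AddCircle T, inner ℝ (sympJ N (pv.lift t)) (w.1 t) ∂AddCircle.haarAddCircle
        = -(b * (Matrix.J (Fin N) ℂ).mulVec (coeff w.1 k) i).re := by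
      rw [← hj]
      have := integral_re_fourier_mul hm.toLp b (-k) i
      rw [neg_neg] at this
      rw [← this, ← integral_neg]
      refine integral_congr_ae ?_
      filter_upwards [hm.coeFn_toLp] with t ht
      have hE : ∀ y : PhaseSpace N, inner ℝ (sympJ N E) y = -(sympJ N y) i := by
        intro y
        rw [PiLp.inner_apply, Fintype.sum_sum_type]
        rcases i with i | i <;>
          simp [sympJ_inl, sympJ_inr, E]
      rw [ht, lv, map_smul, real_inner_smul_left, hE]
      ring
    have i2 : ∫ t : AddCircle T, inner ℝ (g t) (toLoop cu pu t) ∂AddCircle.haarAddCircle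
        = (a * coeff g k i).re := by
      have := integral_re_fourier_mul g a (-k) i
      rw [neg_neg] at this
      rw [← this]
      refine integral_congr_ae ?_
      filter_upwards [coeFn_toLoop cu pu] with t ht
      rw [ht, lu, real_inner_smul_right]
      simp [E, PiLp.inner_apply]
    rw [i1, i2] at hU
    have hb : (T : ℂ) * b = -(a * (2 * Real.pi * Complex.I * k)) := by
      simp only [b]
      field_simp
      push_cast
      ring
    have h1 : (T : ℝ) * (b * (Matrix.J (Fin N) ℂ).mulVec (coeff w.1 k) i).re =
        -(a * (2 * Real.pi * Complex.I * k * (Matrix.J (Fin N) ℂ).mulVec (coeff w.1 k) i)).re := by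
      rw [← Complex.re_ofReal_mul, ← mul_assoc, hb, neg_mul, Complex.neg_re]
      congr 2
      ring
    have h2 : (T : ℝ) * (a * coeff g k i).re = (a * (T * coeff g k i)).re := by
      rw [← Complex.re_ofReal_mul]
      congr 1
      ring
    rw [mul_sub, Complex.sub_re]
    linarith
  set d := 2 * Real.pi * Complex.I * k *
      (Matrix.J (Fin N) ℂ).mulVec (coeff w.1 k) i - T * coeff g k i with hd
  -- With `a` the conjugate of `d`, the real part of `a * d` is the squared modulus of `d`.
  have h0 := key (star d)
  rw [Complex.star_def, ← Complex.normSq_eq_conj_mul_self, Complex.ofReal_re,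
    Complex.normSq_eq_zero] at h0
  exact sub_eq_zero.1 h0

theorem coeff_const (c : PhaseSpace N) {p : Function.Periodic (fun _ : ℝ => c) T} (k : ℤ)
    (i : Fin N ⊕ Fin N) :
    coeff (toLoop continuous_const p) k i = if k = 0 then ((c i : ℝ) : ℂ) else 0 := by
  have hT : 0 < T := Fact.out
  have hTc : (T : ℂ) ≠ 0 := by exact_mod_cast hT.ne'
  rw [coeff_toLoop]
  split_ifs with hk
  · subst hk
    rw [fourierCoeffOn_eq_integral]
    simp [hTc]
  · rw [fourierCoeffOn_of_hasDerivAt (f' := fun _ => 0) hT hk (fun t _ => hasDerivAt_const t _)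
      (by simp)]
    simp [fourierCoeffOn_eq_integral]

theorem coeff_zero_eq_integral (z : LoopL2 N T) (i : Fin N ⊕ Fin N) :
    coeff z 0 i = ((∫ t, z t i ∂AddCircle.haarAddCircle : ℝ) : ℂ) := by
  rw [coeff, fourierCoeff, ← integral_complex_ofReal]
  simp

theorem coeff_sub (z w : LoopL2 N T) (k : ℤ) (i : Fin N ⊕ Fin N) :
    coeff (z - w) k i = coeff z k i - coeff w k i := by
  have h : z - w = z + (-1 : ℝ) • w := by simp [sub_eq_add_neg]
  rw [h, coeff_add, coeff_smul]
  push_cast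
  ring

/-- A loop whose Fourier coefficients are absolutely summable has a continuous representative. -/
theorem exists_continuous_of_summable {w : LoopL2 N T}
    (h : ∀ i, Summable fun k => coeff w k i) :
    ∃ c : AddCircle T → PhaseSpace N, Continuous c ∧
      ∀ᵐ t ∂AddCircle.haarAddCircle (T := T), w t = c t := by
  have hi : ∀ i, ∃ c : C(AddCircle T, ℂ),
      ∀ᵐ t ∂AddCircle.haarAddCircle (T := T), ((w t i : ℝ) : ℂ) = c t := by
    intro i
    have hs : Summable fun k => coeff w k i • (fourier k : C(AddCircle T, ℂ)) := by
      refine Summable.of_norm ?_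
      simpa [norm_smul, fourier_norm] using (h i).norm
    refine ⟨∑' k, coeff w k i • (fourier k : C(AddCircle T, ℂ)), ?_⟩
    have h1 : HasSum (fun k => coeff w k i • fourierLp (T := T) 2 k)
        (ContinuousMap.toLp 2 AddCircle.haarAddCircle ℂ
          (∑' k, coeff w k i • (fourier k : C(AddCircle T, ℂ)))) := by
      have := (ContinuousMap.toLp (E := ℂ) 2 (AddCircle.haarAddCircle (T := T)) ℂ).hasSum hs.hasSum
      simpa only [map_smul] using this
    have h2 := hasSum_fourier_series_L2 (component w i)
    simp only [fourierCoeff_component] at h2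
    have h3 := h2.unique h1
    filter_upwards [MemLp.coeFn_toLp (memLp_component w i),
      ContinuousMap.coeFn_toLp (E := ℂ) (p := 2) (𝕜 := ℂ) (AddCircle.haarAddCircle (T := T))
        (∑' k, coeff w k i • (fourier k : C(AddCircle T, ℂ)))] with t e1 e2
    rw [← e1, ← e2, ← h3, component]
  choose c hc using hi
  refine ⟨fun t => WithLp.toLp 2 fun i => (c i t).re, by fun_prop, ?_⟩
  filter_upwards [ae_all_iff.2 hc] with t ht
  ext i
  simp [← ht i]

/-- Regularity: a weak `L²` solution of a linear periodic system is a classical one. -/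
theorem exists_classical_solution {A : ℝ → PhaseSpace N →L[ℝ] PhaseSpace N} (hA : Continuous A)
    (pA : Function.Periodic A T) {w q : LoopL2 N T}
    (hq : ∀ᵐ t ∂AddCircle.haarAddCircle (T := T), q t = pA.lift t (w t))
    (h : ∀ k i, 2 * Real.pi * Complex.I * k * coeff w k i = T * coeff q k i) :
    ∃ (x : ℝ → PhaseSpace N) (hx : Continuous x) (px : Function.Periodic x T),
      (∀ t, HasDerivAt x (A t (x t)) t) ∧ toLoop hx px = w := by
  have hT : 0 < T := Fact.out
  have hTc : (T : ℂ) ≠ 0 := by exact_mod_cast hT.ne'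
  have hsum : ∀ i, Summable fun k => coeff w k i := by
    intro i
    -- For `k ≠ 0` the coefficient of `w` is at most `T |k|⁻¹ ‖q̂_k‖`, and the product is bounded by
    -- the sum of squares. The index `0` is the only exception, which a cofinite bound permits.
    have h1 : Summable fun k : ℤ => T * (1 / (k : ℝ) ^ 2 + ‖coeff q k i‖ ^ 2) :=
      ((Real.summable_one_div_int_pow.2 (by norm_num)).add (summable_sq_coeff q i)).mul_left _
    refine Summable.of_norm_bounded_eventually h1 ?_
    rw [Filter.eventually_cofinite]
    refine (Set.finite_singleton (0 : ℤ)).subset fun k hk => ?_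
    by_contra hk0
    apply hk
    have hkp : (0 : ℝ) < |(k : ℝ)| := abs_pos.2 (by exact_mod_cast hk0)
    have e : ‖2 * (Real.pi : ℂ) * Complex.I * k‖ = 2 * Real.pi * |(k : ℝ)| := by
      simp [abs_of_pos Real.pi_pos]
    have h2 := congrArg norm (h k i)
    rw [norm_mul, e, norm_mul, Complex.norm_real, Real.norm_eq_abs, abs_of_pos hT] at h2
    have h3 : |(k : ℝ)| * ‖coeff w k i‖ ≤ T * ‖coeff q k i‖ := by
      rw [← h2]
      have := mul_nonneg hkp.le (norm_nonneg (coeff w k i))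
      nlinarith [Real.pi_gt_three]
    have h4 : ‖coeff w k i‖ ≤ T * (|(k : ℝ)|⁻¹ * ‖coeff q k i‖) := by
      rw [← le_div_iff₀' hkp] at h3
      refine h3.trans (le_of_eq ?_)
      field_simp
    refine h4.trans (mul_le_mul_of_nonneg_left ?_ hT.le)
    rw [one_div, ← sq_abs (k : ℝ), ← inv_pow]
    nlinarith [sq_nonneg (|(k : ℝ)|⁻¹ - ‖coeff q k i‖), sq_nonneg (|(k : ℝ)|⁻¹),
      sq_nonneg ‖coeff q k i‖]
  obtain ⟨c, cc, hc⟩ := exists_continuous_of_summable hsum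
  let v : ℝ → PhaseSpace N := fun t => A t (c (t : AddCircle T))
  have cv : Continuous v := hA.clm_apply (cc.comp (AddCircle.continuous_mk' T))
  have pv : Function.Periodic v T := fun t => by simp [v, pA t]
  have hqv : q = toLoop cv pv := by
    apply Lp.ext
    filter_upwards [hq, hc, coeFn_toLoop cv pv] with t h1 h2 h3
    rw [h1, h2, h3]
    induction t using QuotientAddGroup.induction_on with
    | H s => rfl
  -- The equation at `k = 0` says that the right-hand side has mean zero; this is what makes its
  -- primitive periodic.
  have hmean : ∫ t in (0 : ℝ)..T, v t = 0 := by
    ext i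
    have h0 : coeff q 0 i = 0 := by
      have := h 0 i
      simpa [hTc] using this.symm
    rw [hqv, coeff_toLoop, fourierCoeffOn_eq_integral] at h0
    have h1 : ∫ t in (0 : ℝ)..T, ((v t i : ℝ) : ℂ) = 0 := by
      simpa [hT.ne'] using h0
    rw [intervalIntegral.integral_ofReal] at h1
    have h2 := (EuclideanSpace.proj i : PhaseSpace N →L[ℝ] ℝ).intervalIntegral_comp_comm
      (cv.intervalIntegrable (μ := volume) 0 T)
    simp only [EuclideanSpace.coe_proj] at h2
    rw [PiLp.zero_apply, ← h2]
    exact_mod_cast h1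
  let P : ℝ → PhaseSpace N := fun t => ∫ s in (0 : ℝ)..t, v s
  have hP : ∀ t, HasDerivAt P (v t) t := fun t =>
    intervalIntegral.integral_hasDerivAt_right (cv.intervalIntegrable _ _)
      (cv.stronglyMeasurableAtFilter _ _) cv.continuousAt
  have cP : Continuous P := continuous_iff_continuousAt.2 fun t => (hP t).continuousAt
  have pP : Function.Periodic P T := fun t => by
    have h1 : P t + ∫ s in t..(t + T), v s = P (t + T) :=
      intervalIntegral.integral_add_adjacent_intervals (cv.intervalIntegrable _ _)
        (cv.intervalIntegrable _ _)
    rw [pv.intervalIntegral_add_eq t 0, zero_add, hmean, add_zero] at h1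
    exact h1.symm
  -- `w` and the primitive have the same coefficients at every nonzero frequency, so their
  -- difference is the constant `m`.
  let d : LoopL2 N T := w - toLoop cP pP
  let m : PhaseSpace N := WithLp.toLp 2 fun i => ∫ t, d t i ∂AddCircle.haarAddCircle
  have pm : Function.Periodic (fun _ : ℝ => m) T := fun _ => rfl
  have hd : d = toLoop continuous_const pm := by
    refine ext_coeff fun k i => ?_
    rw [coeff_const]
    split_ifs with hk
    · rw [hk, coeff_zero_eq_integral]
    · have h1 := coeff_deriv hP cv pP pv cP k i
      rw [← hqv, ← h k i] at h1
      have hk' : 2 * (Real.pi : ℂ) * Complex.I * k ≠ 0 := by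
        have : (k : ℂ) ≠ 0 := by exact_mod_cast hk
        have : (Real.pi : ℂ) ≠ 0 := by exact_mod_cast Real.pi_ne_zero
        simp [*]
      rw [coeff_sub, mul_left_cancel₀ hk' h1, sub_self]
  let x : ℝ → PhaseSpace N := fun t => P t + m
  have cx : Continuous x := cP.add continuous_const
  have px : Function.Periodic x T := fun t => by simp only [x, pP t]
  have hxw : toLoop cx px = w := by
    have e : w = toLoop continuous_const pm + toLoop cP pP := by rw [← hd, sub_add_cancel]
    rw [e]
    apply Lp.ext
    filter_upwards [coeFn_toLoop cx px, coeFn_toLoop cP pP, coeFn_toLoop continuous_const pm,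
      Lp.coeFn_add (toLoop continuous_const pm) (toLoop cP pP)] with t h1 h2 h3 h4
    rw [h1, h4, Pi.add_apply, h2, h3, add_comm]
    induction t using QuotientAddGroup.induction_on with
    | H s => rfl
  -- Continuous functions equal almost everywhere for Haar measure are equal everywhere, so the
  -- derivative of `x` at each point involves `x` itself.
  have hxc : (px.lift : AddCircle T → PhaseSpace N) = c := by
    refine ((px.continuous_lift cx).ae_eq_iff_eq AddCircle.haarAddCircle cc).1 ?_
    filter_upwards [coeFn_toLoop cx px, hc] with t h1 h2
    rw [← h1, hxw, h2]
  refine ⟨x, cx, px, fun t => ?_, hxw⟩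
  have e : x t = c (t : AddCircle T) := by rw [← hxc, Function.Periodic.lift_coe]
  rw [e]
  exact (hP t).add_const m

/-- Multiplication by a continuous periodic, hence bounded, operator function preserves `L²`. -/
theorem exists_loop_apply {A : ℝ → PhaseSpace N →L[ℝ] PhaseSpace N} (hA : Continuous A)
    (pA : Function.Periodic A T) (w : LoopL2 N T) :
    ∃ q : LoopL2 N T, ∀ᵐ t ∂AddCircle.haarAddCircle (T := T), q t = pA.lift t (w t) := by
  have hT : 0 < T := Fact.out
  obtain ⟨C, hC⟩ := exists_bound_of_continuous_periodic hA hT pA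
  have hC' : ∀ t : AddCircle T, ‖pA.lift t‖ ≤ C := fun t => by
    induction t using QuotientAddGroup.induction_on with
    | H s => exact hC s
  have hm : MemLp (fun t => pA.lift t (w t)) 2 (AddCircle.haarAddCircle (T := T)) := by
    refine (Lp.memLp w).of_le_mul (c := C) ?_ (Eventually.of_forall fun t => ?_)
    · exact isBoundedBilinearMap_apply.continuous.comp_aestronglyMeasurable
        ((pA.continuous_lift hA).aestronglyMeasurable.prodMk (Lp.memLp w).1)
    · exact ((pA.lift t).le_opNorm _).trans (by gcongr; exact hC' t)
  exact ⟨hm.toLp, hm.coeFn_toLp⟩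

variable {H : PhaseSpace N → ℝ} {z : ℝ → PhaseSpace N}

theorem d2Action_eq (pS : Function.Periodic (fun t => hess H (z t)) T) (w u : HHalf N T) :
    d2Action H z w u = loopForm w u -
      T * ∫ t, inner ℝ (pS.lift t (w.1 t)) (u.1 t) ∂AddCircle.haarAddCircle := by
  rw [d2Action, ← intervalIntegral_eq_haar]
  rfl

/-- Embedding of the periodic solutions of the linearized system into `H^{1/2}_T`. -/
noncomputable def solutionLoop {S : ℝ → PhaseSpace N →L[ℝ] PhaseSpace N} (hS : Continuous S)
    (pS : Function.Periodic S T) : periodicSolutions S T →ₗ[ℝ] HHalf N T where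
  toFun w := ⟨toLoop (continuous_of_mem_periodicSolutions w) w.2.2,
    toLoop_mem_HHalf (mem_periodicSolutions_iff.1 w.2).1
      ((continuous_sympField hS).clm_apply (continuous_of_mem_periodicSolutions w)) w.2.2
      (fun t => by simp only [periodic_sympField pS t, w.2.2 t])
      (continuous_of_mem_periodicSolutions w)⟩
  map_add' w u := by
    apply Subtype.ext
    change ContinuousMap.toLp _ _ _ _ = ContinuousMap.toLp _ _ _ _ + ContinuousMap.toLp _ _ _ _
    rw [← map_add]
    congr 1
    ext1 t
    induction t using QuotientAddGroup.induction_on with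
    | H s => rfl
  map_smul' c w := by
    apply Subtype.ext
    change ContinuousMap.toLp _ _ _ _ = c • ContinuousMap.toLp _ _ _ _
    rw [← map_smul]
    congr 1
    ext1 t
    induction t using QuotientAddGroup.induction_on with
    | H s => rfl

theorem coeFn_solutionLoop {S : ℝ → PhaseSpace N →L[ℝ] PhaseSpace N} (hS : Continuous S)
    (pS : Function.Periodic S T) (w : periodicSolutions S T) :
    ∀ᵐ t ∂AddCircle.haarAddCircle (T := T), (solutionLoop hS pS w).1 t = w.2.2.lift t :=
  coeFn_toLoop (continuous_of_mem_periodicSolutions w) _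

theorem toLoop_injective {x y : ℝ → PhaseSpace N} {cx : Continuous x} {cy : Continuous y}
    {px : Function.Periodic x T} {py : Function.Periodic y T}
    (h : toLoop cx px = toLoop cy py) : x = y := by
  have e : (px.lift : AddCircle T → PhaseSpace N) = py.lift := by
    refine ((px.continuous_lift cx).ae_eq_iff_eq AddCircle.haarAddCircle
      (py.continuous_lift cy)).1 ?_
    filter_upwards [coeFn_toLoop cx px, coeFn_toLoop cy py] with t h1 h2
    rw [← h1, ← h2, h]
  funext t
  exact congrFun e (t : AddCircle T)

/-- A kernel element is a weak solution of the linearized system, hence classical by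
`exists_classical_solution`. Conversely, for a classical solution the form `loopForm` is an honest
integral and cancels the Hessian term against every `u`. -/
theorem d2Action_kernel_iff (hS : Continuous fun t => hess H (z t))
    (pS : Function.Periodic (fun t => hess H (z t)) T) (w : HHalf N T) :
    (∀ u, d2Action H z w u = 0) ↔ w ∈ LinearMap.range (solutionLoop hS pS) := by
  constructor
  · intro h
    obtain ⟨g, hg⟩ := exists_loop_apply hS pS w.1
    have hk := coeff_of_kernel (w := w) (g := g) fun u => by
      rw [sub_eq_zero.1 ((d2Action_eq pS w u).symm.trans (h u))]
      congr 1
      refine integral_congr_ae ?_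
      filter_upwards [hg] with t ht
      rw [ht]
    have pA := periodic_sympField pS
    obtain ⟨q, hq⟩ := exists_loop_apply (continuous_sympField hS) pA w.1
    have hJq : ∀ᵐ t ∂AddCircle.haarAddCircle (T := T), g t = sympJ N (q t) := by
      filter_upwards [hg, hq] with t h1 h2
      rw [h1, h2]
      induction t using QuotientAddGroup.induction_on with
      | H s => exact (sympJ_eq_iff.2 rfl).symm
    -- Both sides of `hk` carry a factor `J`, which only swaps the two blocks up to sign; reading
    -- off the opposite block strips it.
    have hk' : ∀ k i, 2 * Real.pi * Complex.I * k * coeff w.1 k i = T * coeff q k i := by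
      intro k i
      rcases i with i | i
      · have := hk k (Sum.inr i)
        rwa [coeff_comp_sympJ hJq, mulVec_J_inr, mulVec_J_inr] at this
      · have := hk k (Sum.inl i)
        rw [coeff_comp_sympJ hJq, mulVec_J_inl, mulVec_J_inl, mul_neg, mul_neg] at this
        exact neg_injective this
    obtain ⟨x, cx, px, hx, e⟩ := exists_classical_solution (continuous_sympField hS) pA hq hk'
    exact ⟨⟨x, mem_periodicSolutions_iff.2 ⟨hx, px⟩⟩, Subtype.ext e⟩
  · rintro ⟨x, rfl⟩ u
    have hx := mem_periodicSolutions_iff.1 x.2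
    have cx := continuous_of_mem_periodicSolutions x
    have pv : Function.Periodic (fun t => sympField (fun t => hess H (z t)) t (x.1 t)) T :=
      fun t => by simp only [periodic_sympField pS t, hx.2 t]
    rw [d2Action_eq pS, sub_eq_zero]
    refine (loopForm_eq_integral_left hx.1 ((continuous_sympField hS).clm_apply cx) hx.2 pv cx
      u).trans ?_
    congr 1
    refine integral_congr_ae ?_
    filter_upwards [coeFn_solutionLoop hS pS x] with t ht
    rw [ht]
    congr 1
    induction t using QuotientAddGroup.induction_on with
    | H s => exact sympJ_eq_iff.2 rfl

theorem kernelHasDim_iff (hS : Continuous fun t => hess H (z t))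
    (pS : Function.Periodic (fun t => hess H (z t)) T) (k : ℕ) :
    KernelHasDim (d2Action (T := T) H z) k ↔
      Module.rank ℝ (periodicSolutions (fun t => hess H (z t)) T) = k := by
  have hinj : Function.Injective (solutionLoop hS pS) := fun x y h =>
    Subtype.ext (toLoop_injective (cx := continuous_of_mem_periodicSolutions x)
      (cy := continuous_of_mem_periodicSolutions y) (Subtype.ext_iff.1 h))
  rw [(LinearEquiv.ofInjective _ hinj).rank_eq]
  constructor
  · rintro ⟨K, hK, hr⟩
    have e : K = LinearMap.range (solutionLoop hS pS) :=
      Submodule.ext fun w => (hK w).trans (d2Action_kernel_iff hS pS w)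
    rw [← e, hr]
  · exact fun hr => ⟨_, fun w => (d2Action_kernel_iff hS pS w).symm, hr⟩

theorem actionCondition_iff {k : ℕ} {Ω M : Set (PhaseSpace N)} (hΩ : IsOpen Ω)
    (hH : ContDiffOn ℝ 2 H Ω) :
    ActionCondition H Ω T k M ↔ LinearizedCondition H Ω T k M :=
  forall_congr' fun _ => forall_congr' fun hz => forall_congr' fun _ =>
    kernelHasDim_iff (hz.continuous_hess hΩ hH) hz.periodic_hess k

theorem nondegeneracy_tfae {k : ℕ} {Ω M : Set (PhaseSpace N)} (hΩ : IsOpen Ω)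
    (hH : ContDiffOn ℝ 2 H Ω) :
    List.TFAE [MonodromyCondition H Ω T k M, LinearizedCondition H Ω T k M,
      ActionCondition H Ω T k M] := by
  tfae_have 1 ↔ 2 := monodromyCondition_iff Fact.out hΩ hH
  tfae_have 3 ↔ 2 := actionCondition_iff hΩ hH
  tfae_finish

end Kernel

/-! ### The radial profile, its inverse and the kinetic energy -/

/-- The domain `[0, a)` of the radial profile. -/
def profileDomain (a : EReal) : Set ℝ := {r : ℝ | 0 ≤ r ∧ (r : EReal) < a}

/-- The interval `(0, a)`. -/
def profileInterior (a : EReal) : Set ℝ := {r : ℝ | 0 < r ∧ (r : EReal) < a}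

/-- The inverse `f⁻¹ : [0, b) → [0, a)` of the radial profile. -/
noncomputable def profileInv (a : EReal) (f : ℝ → ℝ) : ℝ → ℝ :=
  Function.invFunOn f {r : ℝ | 0 ≤ r ∧ (r : EReal) < a}

theorem isOpen_profileInterior (a : EReal) : IsOpen (profileInterior a) :=
  (isOpen_lt continuous_const continuous_id).inter
    (isOpen_lt continuous_coe_real_ereal continuous_const)

theorem profileInterior_subset (a : EReal) : profileInterior a ⊆ profileDomain a :=
  fun _ h => ⟨h.1.le, h.2⟩

theorem ordConnected_profileDomain (a : EReal) : (profileDomain a).OrdConnected :=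
  ⟨fun _ hx _ hy _ hs => ⟨hx.1.trans hs.1, (EReal.coe_le_coe_iff.2 hs.2).trans_lt hy.2⟩⟩

namespace PeriodicNondeg.IsRadialProfile

variable {a b : EReal} {f : ℝ → ℝ}

theorem strictMonoOn (hf : IsRadialProfile a b f) : StrictMonoOn f (profileDomain a) := by
  refine strictMonoOn_of_deriv_pos (ordConnected_profileDomain a).convex hf.continuousOn
    fun s hs => ?_
  have h0 : s ∈ interior (Ici (0 : ℝ)) := interior_mono (fun r hr => hr.1) hs
  rw [interior_Ici] at h0
  exact hf.deriv_pos s h0 (interior_subset hs).2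

theorem zero_mem (hf : IsRadialProfile a b f) : (0 : ℝ) ∈ profileDomain a :=
  ⟨le_rfl, by simpa using hf.a_pos⟩

theorem pos_of_pos (hf : IsRadialProfile a b f) {s : ℝ} (hs : s ∈ profileInterior a) : 0 < f s := by
  have := hf.strictMonoOn hf.zero_mem (profileInterior_subset a hs) hs.1
  rwa [hf.map_zero] at this

/-- Any left neighbourhood of `a` in the extended reals contains a nonnegative real below `a`;
finite and infinite `a` need no distinction. -/
theorem exists_gt (hf : IsRadialProfile a b f) {y : ℝ} (hy : (y : EReal) < b) :
    ∃ s ∈ profileDomain a, y < f s := by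
  have h1 := hf.tendsto.eventually (lt_mem_nhds hy)
  rw [eventually_comap] at h1
  have h2 : ∀ᶠ r in 𝓝[<] a, r ∈ Ioo 0 a := Ioo_mem_nhdsLT hf.a_pos
  obtain ⟨l, hl, h3⟩ := (mem_nhdsLT_iff_exists_Ioo_subset' hf.a_pos).1 (h1.and h2)
  obtain ⟨s, hs1, hs2⟩ := EReal.lt_iff_exists_real_btwn.1 hl
  obtain ⟨h4, h5⟩ := h3 ⟨hs1, hs2⟩
  refine ⟨s, ⟨?_, h5.2⟩, ?_⟩
  · exact_mod_cast h5.1.le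
  · exact_mod_cast h4 s rfl

theorem surjOn (hf : IsRadialProfile a b f) : SurjOn f (profileDomain a) (profileDomain b) := by
  rintro y ⟨hy0, hyb⟩
  obtain ⟨s, hs, hys⟩ := hf.exists_gt hyb
  have hsub : Icc 0 s ⊆ profileDomain a :=
    (ordConnected_profileDomain a).out hf.zero_mem hs
  obtain ⟨r, hr, rfl⟩ := intermediate_value_Icc hs.1 (hf.continuousOn.mono hsub)
    ⟨by rwa [hf.map_zero], hys.le⟩
  exact ⟨r, hsub hr, rfl⟩

theorem apply_inv (hf : IsRadialProfile a b f) {y : ℝ} (hy : y ∈ profileDomain b) :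
    f (profileInv a f y) = y :=
  Function.invFunOn_eq (hf.surjOn hy)

theorem inv_mem (hf : IsRadialProfile a b f) {y : ℝ} (hy : y ∈ profileDomain b) :
    profileInv a f y ∈ profileDomain a :=
  Function.invFunOn_mem (hf.surjOn hy)

theorem inv_apply (hf : IsRadialProfile a b f) {s : ℝ} (hs : s ∈ profileDomain a) :
    profileInv a f (f s) = s :=
  hf.strictMonoOn.injOn (hf.inv_mem (hf.mapsTo s hs.1 hs.2)) hs
    (hf.apply_inv (hf.mapsTo s hs.1 hs.2))

theorem inv_pos (hf : IsRadialProfile a b f) {y : ℝ} (hy : y ∈ profileInterior b) :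
    profileInv a f y ∈ profileInterior a := by
  have h := hf.inv_mem (profileInterior_subset b hy)
  refine ⟨h.1.lt_of_ne fun h0 => ?_, h.2⟩
  have := hf.apply_inv (profileInterior_subset b hy)
  rw [← h0, hf.map_zero] at this
  exact hy.1.ne this

theorem monotoneOn_inv (hf : IsRadialProfile a b f) :
    MonotoneOn (profileInv a f) (profileDomain b) := by
  intro y hy y' hy' h
  rw [← hf.strictMonoOn.le_iff_le (hf.inv_mem hy) (hf.inv_mem hy'), hf.apply_inv hy,
    hf.apply_inv hy']
  exact h

/-- The inverse function theorem gives a `C¹` local inverse where `f' > 0`, and the global inverse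
coincides with it nearby. The origin is excluded because `f` need not be `C¹` there. -/
theorem contDiffOn_inv (hf : IsRadialProfile a b f) :
    ContDiffOn ℝ 1 (profileInv a f) (profileInterior b) := by
  intro y hy
  refine ContDiffAt.contDiffWithinAt ?_
  have hs := hf.inv_pos hy
  have hnb := (isOpen_profileInterior a).mem_nhds hs
  have hc : ContDiffAt ℝ 1 f (profileInv a f y) := hf.contDiffOn.contDiffAt hnb
  have hp := (hf.deriv_pos _ hs.1 hs.2).ne'
  have hd' := ((hc.hasStrictDerivAt one_ne_zero).hasStrictFDerivAt_equiv hp).hasFDerivAt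
  have hl := hc.to_localInverse hd' one_ne_zero
  have hu := (hc.hasStrictFDerivAt' hd' one_ne_zero).localInverse_unique
    (g := profileInv a f) (by
      filter_upwards [hnb] with s h using hf.inv_apply (profileInterior_subset a h))
  rw [hf.apply_inv (profileInterior_subset b hy)] at hl hu
  exact hl.congr_of_eventuallyEq hu

theorem hasDerivAt_kineticG (hf : IsRadialProfile a b f) {s : ℝ} (hs : s ∈ profileInterior b) :
    HasDerivAt (kineticG a f) (profileInv a f s) s := by
  have hnb := (isOpen_profileInterior b).mem_nhds hs
  have hc : ContinuousOn (profileInv a f) (profileInterior b) := hf.contDiffOn_inv.continuousOn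
  have h0 : (0 : ℝ) ∈ profileDomain b := ⟨le_rfl, by simpa using hf.b_pos⟩
  refine intervalIntegral.integral_hasDerivAt_right ?_
    (hc.stronglyMeasurableAtFilter (isOpen_profileInterior b) s hs) (hc.continuousAt hnb)
  -- Monotonicity gives integrability up to the endpoint `0`, where differentiability of the inverse
  -- is not available.
  refine MonotoneOn.intervalIntegrable (hf.monotoneOn_inv.mono ?_)
  rw [uIcc_of_le hs.1.le]
  exact (ordConnected_profileDomain b).out h0 (profileInterior_subset b hs)

theorem contDiffOn_kineticG (hf : IsRadialProfile a b f) :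
    ContDiffOn ℝ 2 (kineticG a f) (profileInterior b) := by
  have ho := isOpen_profileInterior b
  have h : ContDiffOn ℝ (1 + 1) (kineticG a f) (profileInterior b) := by
    rw [contDiffOn_succ_iff_deriv_of_isOpen ho]
    refine ⟨fun s hs => (hf.hasDerivAt_kineticG hs).differentiableAt.differentiableWithinAt,
      by simp, hf.contDiffOn_inv.congr fun s hs => (hf.hasDerivAt_kineticG hs).deriv⟩
  exact h.of_le (by norm_num)

end PeriodicNondeg.IsRadialProfile

/-! ### Rotations, angular momentum and the symplectic structure -/

section PlaneGeometry

/-- The rotation by a right angle. -/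
noncomputable def quarterTurn : Plane →L[ℝ] Plane :=
  LinearMap.toContinuousLinearMap
    { toFun := fun x => !₂[-x 1, x 0]
      map_add' := fun x y => by ext i; fin_cases i <;> simp [add_comm]
      map_smul' := fun c x => by ext i; fin_cases i <;> simp }

theorem quarterTurn_zero (x : Plane) : quarterTurn x 0 = -x 1 := rfl

theorem quarterTurn_one (x : Plane) : quarterTurn x 1 = x 0 := rfl

theorem rot_eq (ϕ : ℝ) (x : Plane) :
    rot ϕ x = Real.cos ϕ • x + Real.sin ϕ • quarterTurn x := by
  ext i
  fin_cases i
  · simp [rot, quarterTurn_zero, sub_eq_add_neg]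
  · simp [rot, quarterTurn_one, add_comm]

theorem norm_rot (ϕ : ℝ) (x : Plane) : ‖rot ϕ x‖ = ‖x‖ := by
  rw [EuclideanSpace.norm_eq, EuclideanSpace.norm_eq]
  congr 1
  simp only [Fin.sum_univ_two, rot, Real.norm_eq_abs, sq_abs]
  simp only [Matrix.cons_val_zero, Matrix.cons_val_one]
  linear_combination (x 0 ^ 2 + x 1 ^ 2) * Real.sin_sq_add_cos_sq ϕ

/-- The position, as a linear map. -/
noncomputable def posL : PhaseSpace 2 →L[ℝ] Plane :=
  LinearMap.toContinuousLinearMap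
    { toFun := pos, map_add' := fun _ _ => rfl, map_smul' := fun _ _ => rfl }

/-- The momentum, as a linear map. -/
noncomputable def momL : PhaseSpace 2 →L[ℝ] Plane :=
  LinearMap.toContinuousLinearMap
    { toFun := mom, map_add' := fun _ _ => rfl, map_smul' := fun _ _ => rfl }

/-- The point `(x, p)`, as a linear map. -/
noncomputable def pairL : Plane × Plane →L[ℝ] PhaseSpace 2 :=
  LinearMap.toContinuousLinearMap
    { toFun := fun q => pair q.1 q.2
      map_add' := fun _ _ => by ext i; rcases i with i | i <;> rfl
      map_smul' := fun _ _ => by ext i; rcases i with i | i <;> rfl }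

theorem posL_apply (z : PhaseSpace 2) : posL z = pos z := rfl

theorem momL_apply (z : PhaseSpace 2) : momL z = mom z := rfl

theorem pos_pair (x p : Plane) : pos (pair x p) = x := rfl

theorem mom_pair (x p : Plane) : mom (pair x p) = p := rfl

theorem phase_ext {z w : PhaseSpace 2} (h1 : pos z = pos w) (h2 : mom z = mom w) : z = w := by
  ext i
  rcases i with i | i
  · exact congrArg (fun x : Plane => x i) h1
  · exact congrArg (fun x : Plane => x i) h2

theorem continuous_pos : Continuous pos := posL.continuous

theorem continuous_mom : Continuous mom := momL.continuous

theorem inner_phase (z w : PhaseSpace 2) :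
    inner ℝ z w = inner ℝ (pos z) (pos w) + inner ℝ (mom z) (mom w) := by
  simp only [PiLp.inner_apply, Fintype.sum_sum_type]
  rfl

theorem pos_sympJ (z : PhaseSpace 2) : pos (sympJ 2 z) = -mom z := by
  ext i
  exact sympJ_inl z i

theorem mom_sympJ (z : PhaseSpace 2) : mom (sympJ 2 z) = pos z := by
  ext i
  exact sympJ_inr z i

/-- The generator of the diagonal rotations of the phase space. -/
noncomputable def rotGen : PhaseSpace 2 →L[ℝ] PhaseSpace 2 :=
  pairL.comp ((quarterTurn.comp posL).prod (quarterTurn.comp momL))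

theorem pos_rotGen (z : PhaseSpace 2) : pos (rotGen z) = quarterTurn (pos z) := rfl

theorem mom_rotGen (z : PhaseSpace 2) : mom (rotGen z) = quarterTurn (mom z) := rfl

theorem rotGen_rotGen (z : PhaseSpace 2) : rotGen (rotGen z) = -z := by
  refine phase_ext ?_ ?_ <;> ext i <;> fin_cases i <;> rfl

theorem sympJ_rotGen (z : PhaseSpace 2) : sympJ 2 (rotGen z) = rotGen (sympJ 2 z) := by
  refine phase_ext ?_ ?_
  · rw [pos_sympJ, mom_rotGen, pos_rotGen, pos_sympJ, map_neg]
  · rw [mom_sympJ, pos_rotGen, mom_rotGen, mom_sympJ]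

/-- The diagonal action of the rotations on the phase space. -/
noncomputable def rotPhase (ϕ : ℝ) (z : PhaseSpace 2) : PhaseSpace 2 :=
  Real.cos ϕ • z + Real.sin ϕ • rotGen z

theorem pos_rotPhase (ϕ : ℝ) (z : PhaseSpace 2) : pos (rotPhase ϕ z) = rot ϕ (pos z) := by
  rw [rot_eq]
  rfl

theorem mom_rotPhase (ϕ : ℝ) (z : PhaseSpace 2) : mom (rotPhase ϕ z) = rot ϕ (mom z) := by
  rw [rot_eq]
  rfl

theorem sympJ_rotPhase (ϕ : ℝ) (z : PhaseSpace 2) :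
    sympJ 2 (rotPhase ϕ z) = rotPhase ϕ (sympJ 2 z) := by
  simp only [rotPhase, map_add, map_smul, sympJ_rotGen]

theorem rotPhase_smul (ϕ c : ℝ) (z : PhaseSpace 2) :
    rotPhase ϕ (c • z) = c • rotPhase ϕ z := by
  simp only [rotPhase, map_smul, smul_add, smul_comm c]

theorem rotPhase_neg (ϕ : ℝ) (z : PhaseSpace 2) : rotPhase ϕ (-z) = -rotPhase ϕ z := by
  simpa using rotPhase_smul ϕ (-1) z

theorem rotGen_rotPhase (ϕ : ℝ) (z : PhaseSpace 2) :
    rotGen (rotPhase ϕ z) = rotPhase ϕ (rotGen z) := by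
  simp only [rotPhase, map_add, map_smul]

theorem hasDerivAt_rotPhase (ϕ : ℝ) (z : PhaseSpace 2) :
    HasDerivAt (fun s => rotPhase s z) (rotGen (rotPhase ϕ z)) ϕ := by
  have h := ((Real.hasDerivAt_cos ϕ).smul_const z).add
    ((Real.hasDerivAt_sin ϕ).smul_const (rotGen z))
  refine h.congr_deriv ?_
  simp only [rotPhase, map_add, map_smul, rotGen_rotGen, neg_smul, smul_neg]
  rw [add_comm]

theorem rotPhase_zero (z : PhaseSpace 2) : rotPhase 0 z = z := by simp [rotPhase]

theorem rotPhase_add (ϕ ψ : ℝ) (z : PhaseSpace 2) :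
    rotPhase (ϕ + ψ) z = rotPhase ϕ (rotPhase ψ z) := by
  simp only [rotPhase, Real.cos_add, Real.sin_add, map_add, map_smul, rotGen_rotGen]
  module

theorem periodic_rotPhase (z : PhaseSpace 2) :
    Function.Periodic (fun ϕ => rotPhase ϕ z) (2 * Real.pi) := fun ϕ => by
  simp [rotPhase]

theorem hasDerivAt_rotPhase_comp {c : ℝ → PhaseSpace 2} {v : PhaseSpace 2} {t : ℝ}
    (h : HasDerivAt c v t) (ϕ : ℝ) :
    HasDerivAt (fun s => rotPhase ϕ (c s)) (rotPhase ϕ v) t :=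
  (h.const_smul (Real.cos ϕ)).add
    ((rotGen.hasFDerivAt.comp_hasDerivAt t h).const_smul (Real.sin ϕ))

theorem angMom_eq_inner (z : PhaseSpace 2) :
    angMom z = inner ℝ (quarterTurn (pos z)) (mom z) := by
  rw [PiLp.inner_apply, Fin.sum_univ_two, quarterTurn_zero, quarterTurn_one, angMom]
  simp
  ring

/-- In other words, the rotation generator is the Hamiltonian field of the angular momentum. -/
theorem hasGradientAt_angMom (z : PhaseSpace 2) :
    HasGradientAt angMom (sympJ 2 (rotGen z)) z := by
  have h := (((quarterTurn.comp posL).hasFDerivAt (x := z)).inner ℝ (momL.hasFDerivAt (x := z)))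
  have e : angMom = fun z => inner ℝ ((quarterTurn.comp posL) z) (momL z) :=
    funext angMom_eq_inner
  rw [hasGradientAt_iff_hasFDerivAt, e]
  refine h.congr_fderiv ?_
  ext w
  rw [InnerProductSpace.toDual_apply_apply, inner_phase, pos_sympJ, mom_sympJ, pos_rotGen,
    mom_rotGen]
  simp only [fderivInnerCLM_apply, ContinuousLinearMap.comp_apply, ContinuousLinearMap.prod_apply,
    posL_apply, momL_apply]
  simp only [PiLp.inner_apply, Fin.sum_univ_two, quarterTurn_zero, quarterTurn_one,
    PiLp.neg_apply]
  simp
  ring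

theorem contDiff_angMom : ContDiff ℝ 2 angMom := by
  have e : angMom = fun z => inner ℝ ((quarterTurn.comp posL) z) (momL z) :=
    funext angMom_eq_inner
  rw [e]
  exact (quarterTurn.comp posL).contDiff.inner ℝ momL.contDiff

theorem angMom_rotPhase (ϕ : ℝ) (z : PhaseSpace 2) : angMom (rotPhase ϕ z) = angMom z := by
  rw [angMom, angMom, pos_rotPhase, mom_rotPhase]
  simp only [rot, PiLp.toLp_apply, Matrix.cons_val_zero, Matrix.cons_val_one]
  linear_combination (pos z 0 * mom z 1 - pos z 1 * mom z 0) * Real.sin_sq_add_cos_sq ϕ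

theorem hasFDerivAt_norm {E : Type*} [NormedAddCommGroup E] [InnerProductSpace ℝ E] {x : E}
    (hx : x ≠ 0) : HasFDerivAt (fun y : E => ‖y‖) (‖x‖⁻¹ • innerSL ℝ x) x := by
  have h1 := (hasStrictFDerivAt_norm_sq x).hasFDerivAt
  have h2 := h1.sqrt (by simpa using hx)
  have e : (fun y : E => ‖y‖) = fun y => √(‖y‖ ^ 2) :=
    funext fun y => (Real.sqrt_sq (norm_nonneg y)).symm
  rw [e]
  refine h2.congr_fderiv ?_
  ext y
  simp [Real.sqrt_sq]
  ring

end PlaneGeometry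

/-! ### The central Hamiltonian: gradient and rotation invariance -/

section CentralHamiltonian

variable {a b : EReal} {f V : ℝ → ℝ}

theorem isOpen_centralRegular (b : EReal) : IsOpen (centralRegular b) := by
  refine IsOpen.inter (IsOpen.inter ?_ ?_) ?_
  · exact isOpen_ne_fun continuous_pos continuous_const
  · exact isOpen_lt (continuous_coe_real_ereal.comp continuous_mom.norm) continuous_const
  · exact isOpen_ne_fun continuous_mom continuous_const

theorem norm_mom_mem {z : PhaseSpace 2} (hz : z ∈ centralRegular b) :
    ‖mom z‖ ∈ profileInterior b := ⟨norm_pos_iff.2 hz.2, hz.1.2⟩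

theorem contDiffOn_centralHam (hf : IsRadialProfile a b f) (hV : ContDiffOn ℝ 2 V (Ioi 0)) :
    ContDiffOn ℝ 2 (centralHam a f V) (centralRegular b) := by
  have h1 : ContDiffOn ℝ 2 (fun z => ‖mom z‖) (centralRegular b) := fun z hz =>
    (momL.contDiff.contDiffAt.norm ℝ hz.2).contDiffWithinAt
  have h2 : ContDiffOn ℝ 2 (fun z => ‖pos z‖) (centralRegular b) := fun z hz =>
    (posL.contDiff.contDiffAt.norm ℝ hz.1.1).contDiffWithinAt
  exact (hf.contDiffOn_kineticG.comp h1 fun z hz => norm_mom_mem hz).sub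
    (hV.comp h2 fun z hz => norm_pos_iff.2 hz.1.1)

/-- The gradient of the Hamiltonian of the central force problem. -/
noncomputable def centralGrad (a : EReal) (f V : ℝ → ℝ) (z : PhaseSpace 2) : PhaseSpace 2 :=
  pair (-((deriv V ‖pos z‖ / ‖pos z‖) • pos z)) ((profileInv a f ‖mom z‖ / ‖mom z‖) • mom z)

theorem hasGradientAt_centralHam (hf : IsRadialProfile a b f) (hV : ContDiffOn ℝ 2 V (Ioi 0))
    {z : PhaseSpace 2} (hz : z ∈ centralRegular b) :
    HasGradientAt (centralHam a f V) (centralGrad a f V z) z := by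
  have hx : 0 < ‖pos z‖ := norm_pos_iff.2 hz.1.1
  have hV' : HasDerivAt V (deriv V ‖pos z‖) ‖pos z‖ :=
    ((hV.contDiffAt (Ioi_mem_nhds hx)).differentiableAt (by norm_num)).hasDerivAt
  have h1 : HasFDerivAt (fun z => ‖mom z‖) _ z :=
    (hasFDerivAt_norm hz.2).comp z (momL.hasFDerivAt (x := z))
  have h2 : HasFDerivAt (fun z => ‖pos z‖) _ z :=
    (hasFDerivAt_norm hz.1.1).comp z (posL.hasFDerivAt (x := z))
  have h := ((hf.hasDerivAt_kineticG (norm_mom_mem hz)).comp_hasFDerivAt z h1).sub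
    (hV'.comp_hasFDerivAt z h2)
  rw [hasGradientAt_iff_hasFDerivAt]
  refine HasFDerivAt.congr_fderiv (f := centralHam a f V) h ?_
  ext w
  rw [InnerProductSpace.toDual_apply_apply, inner_phase, centralGrad, pos_pair, mom_pair,
    inner_neg_left, real_inner_smul_left, real_inner_smul_left]
  simp [posL_apply, momL_apply]
  ring

theorem gradient_centralHam (hf : IsRadialProfile a b f) (hV : ContDiffOn ℝ 2 V (Ioi 0))
    {z : PhaseSpace 2} (hz : z ∈ centralRegular b) :
    gradient (centralHam a f V) z = centralGrad a f V z :=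
  (hasGradientAt_centralHam hf hV hz).gradient

theorem rot_smul (ϕ c : ℝ) (x : Plane) : rot ϕ (c • x) = c • rot ϕ x := by
  simp only [rot_eq, map_smul, smul_add, smul_comm c]

theorem centralGrad_rotPhase (ϕ : ℝ) (z : PhaseSpace 2) :
    centralGrad a f V (rotPhase ϕ z) = rotPhase ϕ (centralGrad a f V z) := by
  refine phase_ext ?_ ?_
  · rw [pos_rotPhase, centralGrad, centralGrad, pos_pair, pos_pair, pos_rotPhase, norm_rot,
      ← neg_smul, ← neg_smul, rot_smul]
  · rw [mom_rotPhase, centralGrad, centralGrad, mom_pair, mom_pair, mom_rotPhase, norm_rot,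
      rot_smul]

theorem centralHam_rotPhase (ϕ : ℝ) (z : PhaseSpace 2) :
    centralHam a f V (rotPhase ϕ z) = centralHam a f V z := by
  rw [centralHam, centralHam, pos_rotPhase, mom_rotPhase, norm_rot, norm_rot]

theorem rotPhase_mem {ϕ : ℝ} {z : PhaseSpace 2} (hz : z ∈ centralRegular b) :
    rotPhase ϕ z ∈ centralRegular b := by
  refine ⟨⟨?_, ?_⟩, ?_⟩
  · rw [pos_rotPhase, ← norm_pos_iff, norm_rot, norm_pos_iff]
    exact hz.1.1
  · rw [mom_rotPhase, norm_rot]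
    exact hz.1.2
  · rw [mom_rotPhase, ← norm_pos_iff, norm_rot, norm_pos_iff]
    exact hz.2

end CentralHamiltonian

/-! ### Uniqueness and conservation of energy for Hamiltonian systems -/

section Flow

variable {N : ℕ} {H : PhaseSpace N → ℝ} {Ω : Set (PhaseSpace N)}

/-- The Hamiltonian vector field `-J ∇H`. -/
noncomputable def hamField (H : PhaseSpace N → ℝ) (z : PhaseSpace N) : PhaseSpace N :=
  -sympJ N (gradient H z)

theorem hamiltonian_system_iff {z : ℝ → PhaseSpace N} {t : ℝ} :
    (∃ v, HasDerivAt z v t ∧ sympJ N v = gradient H (z t)) ↔ HasDerivAt z (hamField H (z t)) t := by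
  constructor
  · rintro ⟨v, hv, e⟩
    rwa [hamField, ← sympJ_eq_iff.1 e]
  · exact fun h => ⟨_, h, sympJ_eq_iff.2 rfl⟩

theorem contDiffOn_hamField (hΩ : IsOpen Ω) (hH : ContDiffOn ℝ 2 H Ω) :
    ContDiffOn ℝ 1 (hamField H) Ω :=
  ((sympJ N).contDiff.comp_contDiffOn (contDiffOn_gradient hΩ hH)).neg

theorem fderiv_hamField (hΩ : IsOpen Ω) (hH : ContDiffOn ℝ 2 H Ω) {z : PhaseSpace N}
    (hz : z ∈ Ω) (w : PhaseSpace N) :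
    fderiv ℝ (hamField H) z w = -sympJ N (hess H z w) := by
  have hd : HasFDerivAt (gradient H) (hess H z) z :=
    (((contDiffOn_gradient hΩ hH).contDiffAt (hΩ.mem_nhds hz)).differentiableAt
      (by norm_num)).hasFDerivAt
  have h : HasFDerivAt (hamField H) (-(sympJ N).comp (hess H z)) z :=
    ((sympJ N).hasFDerivAt.comp z hd).neg
  rw [h.fderiv]
  rfl

/-- Two global solutions with a common point agree, as soon as one of them stays in the region
where the Hamiltonian is of class `C²`. -/
theorem hamiltonian_unique (hΩ : IsOpen Ω) (hH : ContDiffOn ℝ 2 H Ω) {z y : ℝ → PhaseSpace N}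
    (hzΩ : ∀ t, z t ∈ Ω) (hz : ∀ t, HasDerivAt z (hamField H (z t)) t)
    (hy : ∀ t, HasDerivAt y (hamField H (y t)) t) {t₀ : ℝ} (h : z t₀ = y t₀) : z = y := by
  have cz : Continuous z := continuous_iff_continuousAt.2 fun t => (hz t).continuousAt
  have cy : Continuous y := continuous_iff_continuousAt.2 fun t => (hy t).continuousAt
  have hcl : IsClosed {t | z t = y t} := isClosed_eq cz cy
  -- The coincidence set is clopen. Near a common point the field is Lipschitz, and continuity
  -- brings `y` into that region even though `y` is not assumed to stay in `Ω`.
  have hop : IsOpen {t | z t = y t} := by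
    rw [isOpen_iff_mem_nhds]
    intro t ht
    obtain ⟨K, s, hs, hK⟩ := ((contDiffOn_hamField hΩ hH).contDiffAt
      (hΩ.mem_nhds (hzΩ t))).exists_lipschitzOnWith
    have hs' : s ∈ 𝓝 (y t) := by
      have : z t = y t := ht
      rwa [← this]
    exact ODE_solution_unique_of_eventually (v := fun _ => hamField H) (s := fun _ => s)
      (K := K) (Eventually.of_forall fun _ => hK)
      ((cz.continuousAt.eventually_mem hs).mono fun r hr => ⟨hz r, hr⟩)
      ((cy.continuousAt.eventually_mem hs').mono fun r hr => ⟨hy r, hr⟩) ht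
  have := IsClopen.eq_univ ⟨hcl, hop⟩ ⟨t₀, h⟩
  funext t
  exact eq_univ_iff_forall.1 this t

/-- The field is `-J ∇H`, and `J` is antisymmetric, so it is orthogonal to the gradient. -/
theorem hamiltonian_const (hΩ : IsOpen Ω) (hH : ContDiffOn ℝ 2 H Ω) {z : ℝ → PhaseSpace N}
    (hzΩ : ∀ t, z t ∈ Ω) (hz : ∀ t, HasDerivAt z (hamField H (z t)) t) (t s : ℝ) :
    H (z t) = H (z s) := by
  have hd : ∀ t, HasDerivAt (fun t => H (z t)) 0 t := fun t => by
    have h1 : HasGradientAt H (gradient H (z t)) (z t) :=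
      (((hH.contDiffAt (hΩ.mem_nhds (hzΩ t))).differentiableAt (by norm_num)).hasGradientAt)
    have h2 := h1.hasFDerivAt.comp_hasDerivAt t (hz t)
    refine h2.congr_deriv ?_
    rw [InnerProductSpace.toDual_apply_apply, hamField]
    simp only [PiLp.inner_apply, Fintype.sum_sum_type, PiLp.neg_apply, sympJ_inl, sympJ_inr]
    simp [mul_comm]
  exact is_const_of_deriv_eq_zero (fun t => (hd t).differentiableAt) (fun t => (hd t).deriv) t s

end Flow

/-! ### Immersions into level sets of submersions -/

section Level

variable {E X : Type*} [NormedAddCommGroup E] [NormedSpace ℝ E] [FiniteDimensional ℝ E]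
  [NormedAddCommGroup X] [NormedSpace ℝ X] [FiniteDimensional ℝ X] {m : ℕ}

/-- A level set of a submersion is locally covered by an immersion into it of the right
dimension. -/
theorem eventually_mem_range_of_level {G : E → EuclideanSpace ℝ (Fin m)}
    {G' : E →L[ℝ] EuclideanSpace ℝ (Fin m)} {F : X → E} {F' : X →L[ℝ] E}
    (hdim : Module.finrank ℝ X + m = Module.finrank ℝ E)
    (hF : HasStrictFDerivAt F F' 0) (hinj : Function.Injective F')
    (hG : HasStrictFDerivAt G G' (F 0)) (hsurj : Function.Surjective G')
    (hc : ∀ s, G (F s) = G (F 0)) :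
    ∀ᶠ y in 𝓝 (F 0), G y = G (F 0) → y ∈ range F := by
  have hGF : ∀ s, G' (F' s) = 0 := by
    have h1 : HasFDerivAt (fun s => G (F s)) (G'.comp F') 0 :=
      hG.hasFDerivAt.comp 0 hF.hasFDerivAt
    have h2 : HasFDerivAt (fun s => G (F s)) (0 : X →L[ℝ] EuclideanSpace ℝ (Fin m)) 0 := by
      rw [funext hc]
      exact hasFDerivAt_const _ _
    exact fun s => congrArg (fun L : X →L[ℝ] EuclideanSpace ℝ (Fin m) => L s) (h1.unique h2)
  -- One inclusion differentiates the constancy of `G ∘ F`; equality then follows from the dimension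
  -- count.
  have hker : LinearMap.range F'.toLinearMap = LinearMap.ker G'.toLinearMap := by
    refine Submodule.eq_of_le_of_finrank_eq ?_ ?_
    · rintro _ ⟨s, rfl⟩
      exact hGF s
    · have h1 := G'.toLinearMap.finrank_range_add_finrank_ker
      have h2 : Module.finrank ℝ (LinearMap.range G'.toLinearMap) = m := by
        rw [LinearMap.range_eq_top.2 hsurj, finrank_top, finrank_euclideanSpace_fin]
      rw [LinearMap.finrank_range_of_inj hinj]
      omega
  obtain ⟨p, hp⟩ := F'.toLinearMap.exists_leftInverse_of_injective (LinearMap.ker_eq_bot.2 hinj)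
  -- A linear left inverse of `F'` supplies the coordinates along the level set: `(G, π)` is a local
  -- diffeomorphism of `E`, and `π ∘ F` one of `X`.
  let π : E →L[ℝ] X := LinearMap.toContinuousLinearMap p
  have hπ : ∀ s, π (F' s) = s := fun s => congrArg (fun L : X →ₗ[ℝ] X => L s) hp
  let Φ' : E →L[ℝ] EuclideanSpace ℝ (Fin m) × X := G'.prod π
  have hΦinj : Function.Injective Φ'.toLinearMap := by
    rw [← LinearMap.ker_eq_bot, LinearMap.ker_eq_bot']
    intro v hv
    have h1 : G' v = 0 := congrArg Prod.fst hv
    have h2 : π v = 0 := congrArg Prod.snd hv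
    obtain ⟨s, rfl⟩ : v ∈ LinearMap.range F'.toLinearMap := hker ▸ h1
    have h3 : s = 0 := (hπ s).symm.trans h2
    simp [h3]
  let e : E ≃L[ℝ] EuclideanSpace ℝ (Fin m) × X :=
    (Φ'.toLinearMap.linearEquivOfInjective hΦinj (by
      rw [Module.finrank_prod, finrank_euclideanSpace_fin]; omega)).toContinuousLinearEquiv
  have hΦ : HasStrictFDerivAt (fun y => (G y, π y))
      (e : E →L[ℝ] EuclideanSpace ℝ (Fin m) × X) (F 0) :=
    hG.prodMk π.hasStrictFDerivAt
  have hloc := hΦ.eventually_left_inverse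
  have hπF : HasStrictFDerivAt (fun s => π (F s))
      ((ContinuousLinearEquiv.refl ℝ X : X ≃L[ℝ] X) : X →L[ℝ] X) 0 := by
    have h1 : HasStrictFDerivAt (fun s => π (F s)) (π.comp F') 0 :=
      π.hasStrictFDerivAt.comp 0 hF
    have h2 : π.comp F' = ((ContinuousLinearEquiv.refl ℝ X : X ≃L[ℝ] X) : X →L[ℝ] X) := by
      ext s
      exact hπ s
    rwa [h2] at h1
  -- Parameters `s` for which `F s` is recovered by the local inverse already fill a neighbourhood
  -- under `π ∘ F`. A nearby level point `y` shares both coordinates with some such `F s`, hence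
  -- equals it.
  have himg : (fun s => π (F s)) '' (F ⁻¹' {y | hΦ.localInverse _ _ _ (G y, π y) = y})
      ∈ 𝓝 (π (F 0)) := by
    rw [← hπF.map_nhds_eq_of_equiv]
    exact image_mem_map (hF.continuousAt hloc)
  filter_upwards [hloc, π.continuous.continuousAt himg] with y hy hy' hGy
  obtain ⟨s, hs, hsy⟩ := hy'
  refine ⟨s, ?_⟩
  have hs' : hΦ.localInverse _ _ _ (G (F s), π (F s)) = F s := hs
  have hsy' : π (F s) = π y := hsy
  rw [← hs', hc s, ← hGy, hsy', hy]

/-- The set `M` need not be a whole level set: the immersions into `M` force every nearby point of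
the level to lie in `M`. -/
theorem isEmbeddedSubmanifold_of_level {G : E → EuclideanSpace ℝ (Fin m)} {M U₀ : Set E}
    {k : ℕ} (hk : Module.finrank ℝ X = k)
    (hdim : Module.finrank ℝ X + m = Module.finrank ℝ E) (hU₀ : IsOpen U₀) (hM : M ⊆ U₀)
    (hG : ContDiffOn ℝ 1 G U₀) {c : EuclideanSpace ℝ (Fin m)} (hc : ∀ z ∈ M, G z = c)
    (hsurj : ∀ z ∈ M, Function.Surjective (fderiv ℝ G z))
    (hF : ∀ z ∈ M, ∃ (F : X → E) (F' : X →L[ℝ] E), HasStrictFDerivAt F F' 0 ∧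
      Function.Injective F' ∧ F 0 = z ∧ range F ⊆ M) :
    IsEmbeddedSubmanifold k M := by
  subst hk
  refine ⟨m, hdim, fun z hz => ?_⟩
  obtain ⟨F, F', hFd, hinj, rfl, hFM⟩ := hF z hz
  have hFc : ∀ s, G (F s) = G (F 0) := fun s => by
    rw [hc _ (hFM (mem_range_self s)), hc _ hz]
  have hGd : HasStrictFDerivAt G (fderiv ℝ G (F 0)) (F 0) :=
    (hG.contDiffAt (hU₀.mem_nhds (hM hz))).hasStrictFDerivAt (by norm_num)
  have hev := (eventually_mem_range_of_level hdim hFd hinj hGd (hsurj _ hz) hFc).and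
    (hU₀.mem_nhds (hM hz))
  obtain ⟨U, hU, hUo, hzU⟩ := mem_nhds_iff.1 hev
  have hlevel : ∀ y ∈ U, G y - c = 0 → y ∈ M := fun y hy h =>
    hFM ((hU hy).1 (by rw [sub_eq_zero.1 h, hc _ hz]))
  refine ⟨U, fun y => G y - c, hUo, hzU, (hG.mono fun y hy => (hU hy).2).sub contDiffOn_const,
    fun y hy h => ?_, ?_⟩
  · rw [fderiv_sub_const]
    exact hsurj y (hlevel y hy h)
  · ext y
    exact ⟨fun h => ⟨h.2, sub_eq_zero.2 (hc y h.1)⟩, fun h => ⟨hlevel y h.1 h.2, h.1⟩⟩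

end Level

/-! ### Solutions of the central force problem in phase space -/

section CentralSolution

variable {a b : EReal} {f V : ℝ → ℝ} {x : ℝ → Plane}

theorem PeriodicNondeg.IsRadialProfile.norm_phiMap (hf : IsRadialProfile a b f) {v : Plane}
    (hv : (‖v‖ : EReal) < a) : ‖phiMap f v‖ = f ‖v‖ := by
  rcases eq_or_ne v 0 with rfl | h0
  · simp [phiMap, hf.map_zero]
  · have h1 : 0 < ‖v‖ := norm_pos_iff.2 h0
    have h2 := (hf.mapsTo ‖v‖ h1.le hv).1
    rw [phiMap, norm_smul, norm_div, norm_norm, Real.norm_of_nonneg h2]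
    field_simp

theorem PeriodicNondeg.IsRadialProfile.phiMap_inverse (hf : IsRadialProfile a b f) {v : Plane}
    (hv : (‖v‖ : EReal) < a) (hv0 : v ≠ 0) :
    (profileInv a f ‖phiMap f v‖ / ‖phiMap f v‖) • phiMap f v = v := by
  have h1 : 0 < ‖v‖ := norm_pos_iff.2 hv0
  have h2 := (hf.pos_of_pos (s := ‖v‖) ⟨h1, hv⟩).ne'
  rw [hf.norm_phiMap hv, hf.inv_apply (s := ‖v‖) ⟨h1.le, hv⟩, phiMap, smul_smul]
  have : ‖v‖ / f ‖v‖ * (f ‖v‖ / ‖v‖) = 1 := by field_simp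
  rw [this, one_smul]

theorem phiMap_rot (ϕ : ℝ) (v : Plane) : phiMap f (rot ϕ v) = rot ϕ (phiMap f v) := by
  rw [phiMap, phiMap, norm_rot, rot_smul]

/-- The lift `(x, φ(x'))` of a curve to the phase space. -/
noncomputable def centralLift (f : ℝ → ℝ) (x : ℝ → Plane) (t : ℝ) : PhaseSpace 2 :=
  pair (x t) (phiMap f (deriv x t))

theorem inner_quarterTurn_self (x : Plane) : inner ℝ (quarterTurn x) x = 0 := by
  rw [PiLp.inner_apply, Fin.sum_univ_two, quarterTurn_zero, quarterTurn_one]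
  simp
  ring

theorem hasDerivAt_centralLift (hx : IsCentralSolution a f V x) (t : ℝ) :
    HasDerivAt (centralLift f x)
      (pair (deriv x t) ((deriv V ‖x t‖ / ‖x t‖) • x t)) t := by
  obtain ⟨-, hd, -, hp⟩ := hx t
  exact pairL.hasFDerivAt.comp_hasDerivAt t (hd.hasDerivAt.prodMk hp)

/-- Both terms of the derivative pair the quarter turn of a vector with a multiple of that vector:
the force is parallel to `x`, the momentum to `x'`. -/
theorem angMom_centralLift_const (hx : IsCentralSolution a f V x) (t s : ℝ) :
    angMom (centralLift f x t) = angMom (centralLift f x s) := by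
  have hd : ∀ t, HasDerivAt (fun t => angMom (centralLift f x t)) 0 t := fun t => by
    obtain ⟨-, hd, -, hp⟩ := hx t
    have h := (quarterTurn.hasFDerivAt.comp_hasDerivAt t hd.hasDerivAt).inner ℝ hp
    have e : (fun t => angMom (centralLift f x t)) =
        fun t => inner ℝ (quarterTurn (x t)) (phiMap f (deriv x t)) :=
      funext fun t => angMom_eq_inner _
    rw [e]
    refine HasDerivAt.congr_deriv h ?_
    rw [Function.comp_apply, phiMap, real_inner_smul_right, real_inner_smul_right,
      inner_quarterTurn_self, inner_quarterTurn_self]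
    simp
  exact is_const_of_deriv_eq_zero (fun t => (hd t).differentiableAt) (fun t => (hd t).deriv) t s

/-- Where `x' ≠ 0` the momentum is a positive multiple of it, so vanishing angular momentum makes
`x'` parallel to `x`. Then `x/|x|` has zero derivative. -/
theorem isRectilinear_of_angMom_eq_zero (hf : IsRadialProfile a b f)
    (hx : IsCentralSolution a f V x) (h : ∀ t, angMom (centralLift f x t) = 0) :
    IsRectilinear x := by
  have hd : ∀ t, HasDerivAt (fun t => ‖x t‖⁻¹ • x t) 0 t := fun t => by
    obtain ⟨hx0, hxd, hxa, -⟩ := hx t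
    have hn : 0 < ‖x t‖ := norm_pos_iff.2 hx0
    have hw : x t 0 * deriv x t 1 = x t 1 * deriv x t 0 := by
      have h1 := h t
      rw [angMom_eq_inner, centralLift, pos_pair, mom_pair, phiMap, real_inner_smul_right,
        mul_eq_zero] at h1
      rcases h1 with h1 | h1
      · have hv : deriv x t = 0 := by
          by_contra hv
          have hv' : 0 < ‖deriv x t‖ := norm_pos_iff.2 hv
          exact (div_pos (hf.pos_of_pos ⟨hv', hxa⟩) hv').ne' h1
        simp [hv]
      · rw [PiLp.inner_apply, Fin.sum_univ_two, quarterTurn_zero, quarterTurn_one] at h1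
        simp only [RCLike.inner_apply, conj_trivial] at h1
        linarith
    have h2 := (((hasFDerivAt_norm hx0).comp_hasDerivAt t hxd.hasDerivAt).inv hn.ne').smul
      hxd.hasDerivAt
    refine HasDerivAt.congr_deriv h2 ?_
    have hsq : ‖x t‖ ^ 2 = x t 0 ^ 2 + x t 1 ^ 2 := by
      rw [EuclideanSpace.real_norm_sq_eq, Fin.sum_univ_two]
    have hi : inner ℝ (x t) (deriv x t) = x t 0 * deriv x t 0 + x t 1 * deriv x t 1 := by
      rw [PiLp.inner_apply, Fin.sum_univ_two]
      simp [mul_comm]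
    have hkey : ‖x t‖ ^ 2 • deriv x t = (inner ℝ (x t) (deriv x t) : ℝ) • x t := by
      rw [hsq, hi]
      ext i
      fin_cases i <;> simp
      · linear_combination (-x t 1) * hw
      · linear_combination (x t 0) * hw
    have hv : deriv x t = ((inner ℝ (x t) (deriv x t) : ℝ) / ‖x t‖ ^ 2) • x t := by
      rw [div_eq_inv_mul, mul_smul, ← hkey, smul_smul, inv_mul_cancel₀ (by positivity), one_smul]
    have hcoef : ((‖x t‖⁻¹ • innerSL ℝ (x t) : Plane →L[ℝ] ℝ) (deriv x t))
        = (inner ℝ (x t) (deriv x t) : ℝ) / ‖x t‖ := by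
      simp [div_eq_inv_mul]
    simp only [Function.comp_apply, hcoef]
    set c : ℝ := inner ℝ (x t) (deriv x t)
    rw [hv, smul_smul, ← add_smul]
    have : ‖x t‖⁻¹ * (c / ‖x t‖ ^ 2) + -(c / ‖x t‖) / ‖x t‖ ^ 2 = 0 := by
      field_simp
      ring
    simp [this]
  exact ⟨_, fun t => is_const_of_deriv_eq_zero (fun t => (hd t).differentiableAt)
    (fun t => (hd t).deriv) t 0⟩

theorem angMom_centralLift_ne_zero (hf : IsRadialProfile a b f)
    (hx : IsCentralSolution a f V x) (hr : ¬ IsRectilinear x) (t : ℝ) :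
    angMom (centralLift f x t) ≠ 0 := fun h =>
  hr (isRectilinear_of_angMom_eq_zero hf hx fun s => by rw [angMom_centralLift_const hx s t, h])

/-- The nonzero angular momentum keeps the momentum away from `0`, where the kinetic energy may fail
to be `C²`. -/
theorem centralLift_mem (hf : IsRadialProfile a b f) (hx : IsCentralSolution a f V x)
    (hr : ¬ IsRectilinear x) (t : ℝ) : centralLift f x t ∈ centralRegular b := by
  obtain ⟨hx0, -, hxa, -⟩ := hx t
  refine ⟨⟨hx0, ?_⟩, fun h => ?_⟩
  · rw [centralLift, mom_pair, hf.norm_phiMap hxa]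
    exact (hf.mapsTo _ (norm_nonneg _) hxa).2
  · apply angMom_centralLift_ne_zero hf hx hr t
    rw [angMom_eq_inner, h, inner_zero_right]

theorem hasDerivAt_centralLift_hamField (hf : IsRadialProfile a b f)
    (hV : ContDiffOn ℝ 2 V (Ioi 0)) (hx : IsCentralSolution a f V x)
    (hr : ¬ IsRectilinear x) (t : ℝ) :
    HasDerivAt (centralLift f x) (hamField (centralHam a f V) (centralLift f x t)) t := by
  have hm := centralLift_mem hf hx hr t
  refine (hasDerivAt_centralLift hx t).congr_deriv ?_
  have hv : deriv x t ≠ 0 := fun h => hm.2 (by simp [centralLift, mom_pair, phiMap, h])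
  rw [hamField, gradient_centralHam hf hV hm]
  refine phase_ext ?_ ?_
  · have : ∀ z : PhaseSpace 2, pos (-z) = -pos z := fun z => rfl
    rw [this, pos_sympJ, neg_neg, centralGrad, mom_pair, pos_pair, centralLift, mom_pair,
      hf.phiMap_inverse (hx t).2.2.1 hv]
  · have : ∀ z : PhaseSpace 2, mom (-z) = -mom z := fun z => rfl
    rw [this, mom_sympJ, centralGrad, mom_pair, pos_pair, neg_neg, centralLift, pos_pair]

end CentralSolution

/-! ### The torus generated by a non-circular orbit -/

section RegularOrbit

variable {a b : EReal} {f V : ℝ → ℝ} {z : ℝ → PhaseSpace 2}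

/-- A global solution of the central force problem with `p ≠ 0`, along which `|x|` is not
constant. -/
structure IsRegularOrbit (a b : EReal) (f V : ℝ → ℝ) (z : ℝ → PhaseSpace 2) : Prop where
  mem : ∀ t, z t ∈ centralRegular b
  hasDerivAt : ∀ t, HasDerivAt z (hamField (centralHam a f V) (z t)) t
  not_circular : ¬ ∃ R, ∀ t, ‖pos (z t)‖ = R

theorem hamField_rotPhase (hf : IsRadialProfile a b f) (hV : ContDiffOn ℝ 2 V (Ioi 0))
    {w : PhaseSpace 2} (hw : w ∈ centralRegular b) (ϕ : ℝ) :
    hamField (centralHam a f V) (rotPhase ϕ w) = rotPhase ϕ (hamField (centralHam a f V) w) := by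
  rw [hamField, hamField, gradient_centralHam hf hV hw, gradient_centralHam hf hV (rotPhase_mem hw),
    centralGrad_rotPhase, sympJ_rotPhase, rotPhase_neg]

theorem IsRegularOrbit.rotPhase_translate (hf : IsRadialProfile a b f)
    (hV : ContDiffOn ℝ 2 V (Ioi 0)) (hz : IsRegularOrbit a b f V z) (ϕ θ : ℝ) :
    IsRegularOrbit a b f V fun t => rotPhase ϕ (z (t - θ)) := by
  refine ⟨fun t => rotPhase_mem (hz.mem _), fun t => ?_, ?_⟩
  · rw [hamField_rotPhase hf hV (hz.mem _)]
    exact hasDerivAt_rotPhase_comp ((hz.hasDerivAt (t - θ)).comp_sub_const t θ) ϕ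
  · rintro ⟨R, hR⟩
    refine hz.not_circular ⟨R, fun t => ?_⟩
    have := hR (t + θ)
    rwa [add_sub_cancel_right, pos_rotPhase, norm_rot] at this

/-- Along a noncircular orbit the Hamiltonian field is not a multiple of the generator of the
rotations. -/
theorem IsRegularOrbit.hamField_ne (hf : IsRadialProfile a b f) (hV : ContDiffOn ℝ 2 V (Ioi 0))
    (hz : IsRegularOrbit a b f V z) (t c : ℝ) :
    hamField (centralHam a f V) (z t) ≠ c • rotGen (z t) := by
  intro h
  -- If the field equals `c` times the generator at one point, equivariance propagates this along
  -- the whole rotation orbit, so uniform rotation at speed `c` solves the system.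
  have hrot : ∀ s, HasDerivAt (fun s => rotPhase (c * (s - t)) (z t))
      (hamField (centralHam a f V) (rotPhase (c * (s - t)) (z t))) s := fun s => by
    have h1 : HasDerivAt (fun s => c * (s - t)) c s := by
      simpa using ((hasDerivAt_id s).sub_const t).const_mul c
    have h2 := (hasDerivAt_rotPhase (c * (s - t)) (z t)).scomp s h1
    rw [hamField_rotPhase hf hV (hz.mem t), h, rotPhase_smul, ← rotGen_rotPhase]
    exact h2
  have e := hamiltonian_unique (isOpen_centralRegular b) (contDiffOn_centralHam hf hV) hz.mem
    hz.hasDerivAt hrot (t₀ := t) (by simp [rotPhase_zero])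
  refine hz.not_circular ⟨‖pos (z t)‖, fun s => ?_⟩
  rw [e]
  simp only [sub_self, mul_zero, rotPhase_zero, pos_rotPhase, norm_rot]

theorem rotGen_ne_zero {w : PhaseSpace 2} (hw : w ∈ centralRegular b) : rotGen w ≠ 0 := fun h =>
  hw.1.1 (by
    have h1 : rotGen (rotGen w) = 0 := by rw [h, map_zero]
    rw [rotGen_rotGen, neg_eq_zero] at h1
    rw [h1]
    rfl)

theorem IsRegularOrbit.independent (hf : IsRadialProfile a b f) (hV : ContDiffOn ℝ 2 V (Ioi 0))
    (hz : IsRegularOrbit a b f V z) (t : ℝ) {α β : ℝ}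
    (h : α • hamField (centralHam a f V) (z t) + β • rotGen (z t) = 0) : α = 0 ∧ β = 0 := by
  have hα : α = 0 := by
    by_contra hα
    apply hz.hamField_ne hf hV t (-(α⁻¹ * β))
    rw [neg_smul, mul_smul, ← smul_neg, eq_inv_smul_iff₀ hα]
    exact eq_neg_of_add_eq_zero_left h
  refine ⟨hα, ?_⟩
  rw [hα, zero_smul, zero_add, smul_eq_zero] at h
  exact h.resolve_right (rotGen_ne_zero (hz.mem t))

/-- The energy-momentum map. -/
noncomputable def energyMomentum (a : EReal) (f V : ℝ → ℝ) (z : PhaseSpace 2) : Plane :=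
  !₂[centralHam a f V z, angMom z]

theorem contDiffOn_energyMomentum (hf : IsRadialProfile a b f) (hV : ContDiffOn ℝ 2 V (Ioi 0)) :
    ContDiffOn ℝ 2 (energyMomentum a f V) (centralRegular b) := by
  rw [contDiffOn_euclidean]
  intro i
  fin_cases i
  · exact contDiffOn_centralHam hf hV
  · exact contDiff_angMom.contDiffOn

/-- A vector orthogonal to the range gives a linear relation between the gradients of energy and
angular momentum. Applying `-J` turns it into a relation between the Hamiltonian field and the
rotation generator, which are independent. -/
theorem surjective_fderiv_energyMomentum (hf : IsRadialProfile a b f)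
    (hV : ContDiffOn ℝ 2 V (Ioi 0)) (hz : IsRegularOrbit a b f V z) (t : ℝ) :
    Function.Surjective (fderiv ℝ (energyMomentum a f V) (z t)) := by
  have hd : DifferentiableAt ℝ (energyMomentum a f V) (z t) :=
    ((contDiffOn_energyMomentum hf hV).contDiffAt
      ((isOpen_centralRegular b).mem_nhds (hz.mem t))).differentiableAt (by norm_num)
  have h0 : ∀ w, fderiv ℝ (energyMomentum a f V) (z t) w 0
      = inner ℝ (gradient (centralHam a f V) (z t)) w := fun w => by
    have h1 := (EuclideanSpace.proj (0 : Fin 2) : Plane →L[ℝ] ℝ).hasFDerivAt.comp (z t)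
      hd.hasFDerivAt
    have h2 := (hasGradientAt_centralHam hf hV (hz.mem t)).hasFDerivAt
    rw [gradient_centralHam hf hV (hz.mem t), ← InnerProductSpace.toDual_apply_apply,
      h2.unique h1]
    rfl
  have h1 : ∀ w, fderiv ℝ (energyMomentum a f V) (z t) w 1
      = inner ℝ (sympJ 2 (rotGen (z t))) w := fun w => by
    have h1 := (EuclideanSpace.proj (1 : Fin 2) : Plane →L[ℝ] ℝ).hasFDerivAt.comp (z t)
      hd.hasFDerivAt
    have h2 := (hasGradientAt_angMom (z t)).hasFDerivAt
    rw [← InnerProductSpace.toDual_apply_apply, h2.unique h1]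
    rfl
  have hr : LinearMap.range (fderiv ℝ (energyMomentum a f V) (z t)).toLinearMap = ⊤ := by
    rw [← Submodule.orthogonal_eq_bot_iff, Submodule.eq_bot_iff]
    intro c hc
    rw [Submodule.mem_orthogonal] at hc
    have h2 : ∀ w, inner ℝ (c 0 • gradient (centralHam a f V) (z t)
        + c 1 • sympJ 2 (rotGen (z t))) w = 0 := fun w => by
      have h3 := hc _ ⟨w, rfl⟩
      rw [PiLp.inner_apply, Fin.sum_univ_two] at h3
      change inner ℝ (fderiv ℝ (energyMomentum a f V) (z t) w 0) (c 0) +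
        inner ℝ (fderiv ℝ (energyMomentum a f V) (z t) w 1) (c 1) = 0 at h3
      rw [h0, h1] at h3
      rw [inner_add_left, real_inner_smul_left, real_inner_smul_left]
      simpa using h3
    have h4 : c 0 • gradient (centralHam a f V) (z t) + c 1 • sympJ 2 (rotGen (z t)) = 0 :=
      inner_self_eq_zero.1 (h2 _)
    have h5 := congrArg (fun w => -sympJ 2 w) h4
    simp only [map_add, map_smul, sympJ_sympJ, map_zero, neg_add, ← smul_neg, neg_neg,
      neg_zero] at h5
    obtain ⟨h6, h7⟩ := hz.independent hf hV t h5
    ext i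
    fin_cases i
    · exact h6
    · exact h7
  exact LinearMap.range_eq_top.1 hr

/-- The set of the initial data of the rotations and translations of an orbit. -/
def orbitTorus (z : ℝ → PhaseSpace 2) : Set (PhaseSpace 2) :=
  range fun q : ℝ × ℝ => rotPhase q.1 (z (-q.2))

theorem continuous_rotPhase_orbit {z : ℝ → PhaseSpace 2} (hz : Continuous z) :
    Continuous fun q : ℝ × ℝ => rotPhase q.1 (z (-q.2)) := by
  unfold rotPhase
  have := rotGen.continuous
  fun_prop

/-- Periodicity in the angle and in time reduces the parameters to a compact rectangle. -/
theorem isCompact_orbitTorus {T : ℝ} (hT : 0 < T) {z : ℝ → PhaseSpace 2} (hz : Continuous z)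
    (hp : Function.Periodic z T) : IsCompact (orbitTorus z) := by
  have e : orbitTorus z = (fun q : ℝ × ℝ => rotPhase q.1 (z (-q.2))) ''
      (Icc 0 (2 * Real.pi) ×ˢ Icc 0 T) := by
    refine Subset.antisymm ?_ (image_subset_range _ _)
    rintro _ ⟨⟨ϕ, θ⟩, rfl⟩
    obtain ⟨ϕ', h1, h2⟩ := (periodic_rotPhase (z (-θ))).exists_mem_Ico₀ Real.two_pi_pos ϕ
    have hp' : Function.Periodic (fun θ => z (-θ)) T := fun θ => by
      have := hp (-(θ + T))
      simp only [neg_add_rev, neg_add_cancel_comm] at this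
      simpa using this.symm
    obtain ⟨θ', h3, h4⟩ := hp'.exists_mem_Ico₀ hT θ
    refine ⟨(ϕ', θ'), ⟨Ico_subset_Icc_self h1, Ico_subset_Icc_self h3⟩, ?_⟩
    simp only at h2 h4 ⊢
    rw [← h4, h2]
  rw [e]
  exact (isCompact_Icc.prod isCompact_Icc).image (continuous_rotPhase_orbit hz)

theorem IsRegularOrbit.continuous (hz : IsRegularOrbit a b f V z) : Continuous z :=
  continuous_iff_continuousAt.2 fun t => (hz.hasDerivAt t).continuousAt

theorem IsRegularOrbit.energyMomentum_eq (hf : IsRadialProfile a b f)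
    (hV : ContDiffOn ℝ 2 V (Ioi 0)) (hz : IsRegularOrbit a b f V z)
    (hL : ∀ t s, angMom (z t) = angMom (z s)) {w : PhaseSpace 2} (hw : w ∈ orbitTorus z) :
    energyMomentum a f V w = energyMomentum a f V (z 0) := by
  obtain ⟨⟨ϕ, θ⟩, rfl⟩ := hw
  simp only [energyMomentum, centralHam_rotPhase, angMom_rotPhase]
  rw [hL _ 0, hamiltonian_const (isOpen_centralRegular b) (contDiffOn_centralHam hf hV) hz.mem
    hz.hasDerivAt _ 0]

theorem IsRegularOrbit.contDiff (hf : IsRadialProfile a b f) (hV : ContDiffOn ℝ 2 V (Ioi 0))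
    (hz : IsRegularOrbit a b f V z) : ContDiff ℝ 1 z := by
  rw [contDiff_one_iff_deriv]
  refine ⟨fun t => (hz.hasDerivAt t).differentiableAt, ?_⟩
  rw [funext fun t => (hz.hasDerivAt t).deriv]
  exact (contDiffOn_hamField (isOpen_centralRegular b)
    (contDiffOn_centralHam hf hV)).continuousOn.comp_continuous hz.continuous hz.mem

/-- The torus of the rotations and translations of an orbit is a surface. -/
theorem IsRegularOrbit.isEmbeddedSubmanifold (hf : IsRadialProfile a b f)
    (hV : ContDiffOn ℝ 2 V (Ioi 0)) (hz : IsRegularOrbit a b f V z)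
    (hL : ∀ t s, angMom (z t) = angMom (z s)) : IsEmbeddedSubmanifold 2 (orbitTorus z) := by
  refine isEmbeddedSubmanifold_of_level (X := ℝ × ℝ) (m := 2) (U₀ := centralRegular b)
    (G := energyMomentum a f V) (k := 2) (by simp) (by simp) (isOpen_centralRegular b) ?_
    ((contDiffOn_energyMomentum hf hV).of_le (by norm_num))
    (fun w hw => hz.energyMomentum_eq hf hV hL hw) ?_ ?_
  · rintro _ ⟨⟨ϕ, θ⟩, rfl⟩
    exact rotPhase_mem (hz.mem _)
  · rintro _ ⟨⟨ϕ, θ⟩, rfl⟩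
    have := surjective_fderiv_energyMomentum hf hV (hz.rotPhase_translate hf hV ϕ θ) 0
    simpa using this
  · rintro _ ⟨⟨ϕ, θ⟩, rfl⟩
    have hy := hz.rotPhase_translate hf hV ϕ θ
    set y : ℝ → PhaseSpace 2 := fun t => rotPhase ϕ (z (t - θ)) with hydef
    have hc := hy.contDiff hf hV
    have hFc : ContDiff ℝ 1 fun q : ℝ × ℝ => rotPhase q.1 (y (-q.2)) := by
      unfold rotPhase
      have h1 : ContDiff ℝ 1 fun q : ℝ × ℝ => y (-q.2) := hc.comp contDiff_snd.neg
      exact ((Real.contDiff_cos.comp contDiff_fst).smul h1).add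
        ((Real.contDiff_sin.comp contDiff_fst).smul (rotGen.contDiff.comp h1))
    have hs := hFc.contDiffAt.hasStrictFDerivAt (x := (0 : ℝ × ℝ)) (by norm_num)
    refine ⟨fun q => rotPhase q.1 (y (-q.2)), _, hs, ?_, ?_, ?_⟩
    -- The two partial derivatives are the rotation generator and minus the Hamiltonian field, so
    -- their independence is the immersion property.
    · have hval : ∀ q : ℝ × ℝ, fderiv ℝ (fun q : ℝ × ℝ => rotPhase q.1 (y (-q.2))) 0 q =
          (-q.2) • hamField (centralHam a f V) (y 0) + q.1 • rotGen (y 0) := by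
        intro q
        have e1 : fderiv ℝ (fun q : ℝ × ℝ => rotPhase q.1 (y (-q.2))) 0 (1, 0) =
            rotGen (y 0) := by
          have h1 : HasDerivAt (fun s : ℝ => ((s, 0) : ℝ × ℝ)) (1, 0) 0 :=
            (hasDerivAt_id 0).prodMk (hasDerivAt_const _ _)
          have h2 := hs.hasFDerivAt.comp_hasDerivAt_of_eq 0 h1 rfl
          have h3 := hasDerivAt_rotPhase 0 (y 0)
          rw [rotPhase_zero] at h3
          refine h2.unique ?_
          simpa [Function.comp_def] using h3
        have e2 : fderiv ℝ (fun q : ℝ × ℝ => rotPhase q.1 (y (-q.2))) 0 (0, 1) =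
            -hamField (centralHam a f V) (y 0) := by
          have h1 : HasDerivAt (fun s : ℝ => ((0, s) : ℝ × ℝ)) (0, 1) 0 :=
            (hasDerivAt_const _ _).prodMk (hasDerivAt_id 0)
          have h2 := hs.hasFDerivAt.comp_hasDerivAt_of_eq 0 h1 rfl
          have h3 : HasDerivAt (fun s : ℝ => y (-s)) (-hamField (centralHam a f V) (y 0)) 0 := by
            have := (hy.hasDerivAt (-0)).scomp 0 (hasDerivAt_neg (0 : ℝ))
            simpa [Function.comp_def] using this
          refine h2.unique ?_
          simpa [Function.comp_def, rotPhase_zero] using h3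
        have e3 : q = q.1 • ((1, 0) : ℝ × ℝ) + q.2 • ((0, 1) : ℝ × ℝ) := by
          ext <;> simp
        conv_lhs => rw [e3]
        rw [map_add, map_smul, map_smul, e1, e2, smul_neg, neg_smul, add_comm]
      rw [injective_iff_map_eq_zero]
      intro q hq
      rw [hval] at hq
      obtain ⟨h1, h2⟩ := hy.independent hf hV 0 hq
      exact Prod.ext h2 (neg_eq_zero.1 h1)
    · simp [hydef, rotPhase_zero]
    · rintro _ ⟨q, rfl⟩
      refine ⟨(q.1 + ϕ, q.2 + θ), ?_⟩
      simp only [hydef]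
      rw [rotPhase_add, neg_add, sub_eq_add_neg]

end RegularOrbit

/-! ### Differentiating families of solutions -/

section Variation

variable {N : ℕ} {H : PhaseSpace N → ℝ} {Ω : Set (PhaseSpace N)}

/-- The derivative of a `C¹` family of solutions with respect to the parameter solves the
linearized equation. -/
theorem hasDerivAt_variation (hΩ : IsOpen Ω) (hH : ContDiffOn ℝ 2 H Ω)
    {Z W : ℝ → ℝ → PhaseSpace N} {S : Set ℝ} (hS : IsOpen S) (h0 : (0 : ℝ) ∈ S)
    (hZ : ∀ s ∈ S, ∀ t, HasDerivAt (Z s) (hamField H (Z s t)) t)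
    (hW : ∀ s ∈ S, ∀ t, HasDerivAt (fun s => Z s t) (W s t) s)
    (cZ : ContinuousOn (fun q : ℝ × ℝ => Z q.1 q.2) (S ×ˢ univ))
    (cW : ContinuousOn (fun q : ℝ × ℝ => W q.1 q.2) (S ×ˢ univ))
    (hZΩ : ∀ t, Z 0 t ∈ Ω) (t : ℝ) :
    HasDerivAt (W 0) (sympField (fun t => hess H (Z 0 t)) t (W 0 t)) t := by
  have hX := contDiffOn_hamField hΩ hH
  have hXd : ∀ z ∈ Ω, HasFDerivAt (hamField H) (fderiv ℝ (hamField H) z) z := fun z hz =>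
    ((hX.contDiffAt (hΩ.mem_nhds hz)).differentiableAt (by norm_num)).hasFDerivAt
  have hXc : ContinuousOn (fderiv ℝ (hamField H)) Ω :=
    hX.continuousOn_fderiv_of_isOpen hΩ le_rfl
  let R : ℝ → ℝ → PhaseSpace N := fun s τ => fderiv ℝ (hamField H) (Z s τ) (W s τ)
  have slice : ∀ {s : ℝ}, s ∈ S → ∀ {g : ℝ → ℝ → PhaseSpace N},
      ContinuousOn (fun q : ℝ × ℝ => g q.1 q.2) (S ×ˢ univ) → Continuous (g s) := by
    intro s hs g hg
    exact hg.comp_continuous (f := fun τ => (s, τ)) (by fun_prop) fun τ => ⟨hs, trivial⟩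
  have cR0 : Continuous (R 0) :=
    (hXc.comp_continuous (slice h0 cZ) hZΩ).clm_apply (slice h0 cW)
  -- The family is only `C¹` in the parameter, so mixed derivatives cannot be interchanged directly.
  -- The integral equation is differentiated under the integral sign instead.
  have key : ∀ t, W 0 t = W 0 0 + ∫ τ in (0 : ℝ)..t, R 0 τ := by
    intro t
    have hO : IsOpen {q : ℝ × ℝ | q ∈ S ×ˢ (univ : Set ℝ) ∧ Z q.1 q.2 ∈ Ω} :=
      cZ.isOpen_inter_preimage (hS.prod isOpen_univ) hΩ
    -- Only the orbit at parameter `0` is known to stay in `Ω`; compactness of the time interval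
    -- extends this to all small parameters.
    obtain ⟨u, v, hu, -, h0u, htv, huv⟩ := generalized_tube_lemma
      (s := {(0 : ℝ)}) isCompact_singleton (t := uIcc 0 t) isCompact_uIcc hO (by
        rintro ⟨s, τ⟩ ⟨hs, -⟩
        rw [mem_singleton_iff] at hs
        simp only at hs
        subst hs
        exact ⟨⟨h0, trivial⟩, hZΩ τ⟩)
    obtain ⟨δ, hδ, hδu⟩ := Metric.nhds_basis_closedBall.mem_iff.1
      (hu.mem_nhds (h0u rfl))
    have hin : ∀ s ∈ Metric.closedBall (0 : ℝ) δ, ∀ τ ∈ uIcc 0 t, s ∈ S ∧ Z s τ ∈ Ω := by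
      intro s hs τ hτ
      have h := huv (mk_mem_prod (hδu hs) (htv hτ))
      exact ⟨h.1.1, h.2⟩
    have hcR : ContinuousOn (fun q : ℝ × ℝ => R q.1 q.2)
        (Metric.closedBall (0 : ℝ) δ ×ˢ uIcc 0 t) := by
      have hsub : Metric.closedBall (0 : ℝ) δ ×ˢ uIcc 0 t ⊆ S ×ˢ univ :=
        fun q hq => ⟨(hin _ hq.1 _ hq.2).1, trivial⟩
      exact (hXc.comp (cZ.mono hsub) fun q hq => (hin _ hq.1 _ hq.2).2).clm_apply (cW.mono hsub)
    obtain ⟨C, hC⟩ := ((isCompact_closedBall (0 : ℝ) δ).prod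
      (isCompact_uIcc (a := (0 : ℝ)) (b := t))).exists_bound_of_continuousOn hcR
    have hsubI : uIoc 0 t ⊆ uIcc 0 t := uIoc_subset_uIcc
    have hcont : ∀ s ∈ Metric.closedBall (0 : ℝ) δ,
        ContinuousOn (fun τ => hamField H (Z s τ)) (uIcc 0 t) := by
      intro s hs τ hτ
      obtain ⟨h1, h2⟩ := hin s hs τ hτ
      exact ((hX.contDiffAt (hΩ.mem_nhds h2)).continuousAt.comp
        (slice h1 cZ).continuousAt).continuousWithinAt
    have hball : Metric.closedBall (0 : ℝ) δ ∈ 𝓝 (0 : ℝ) := Metric.closedBall_mem_nhds _ hδ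
    have hint := intervalIntegral.hasDerivAt_integral_of_dominated_loc_of_deriv_le
      (μ := volume) (F := fun s τ => hamField H (Z s τ)) (F' := R) (x₀ := (0 : ℝ))
      (s := Metric.closedBall (0 : ℝ) δ) (bound := fun _ => C) (a := 0) (b := t) hball
      (by
        filter_upwards [hball] with s hs
        exact ((hcont s hs).mono hsubI).aestronglyMeasurable measurableSet_uIoc)
      ((hcont 0 (Metric.mem_closedBall_self hδ.le)).intervalIntegrable)
      cR0.aestronglyMeasurable
      (Eventually.of_forall fun τ hτ s hs => hC (s, τ) ⟨hs, hsubI hτ⟩)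
      intervalIntegrable_const
      (Eventually.of_forall fun τ hτ s hs => by
        obtain ⟨h1, h2⟩ := hin s hs τ (hsubI hτ)
        exact HasFDerivAt.comp_hasDerivAt (l := hamField H) (f := fun s => Z s τ) s (hXd _ h2)
          (hW s h1 τ))
    have hsum := (hW 0 h0 0).add hint.2
    have heq : (fun s => Z s t) =ᶠ[𝓝 0]
        ((fun s => Z s 0) + fun s => ∫ τ in (0 : ℝ)..t, hamField H (Z s τ)) := by
      filter_upwards [hball, hS.mem_nhds h0] with s hs hsS
      rw [Pi.add_apply, intervalIntegral.integral_eq_sub_of_hasDerivAt (fun τ _ => hZ s hsS τ)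
        ((hcont s hs).intervalIntegrable)]
      abel
    exact (hW 0 h0 t).unique (hsum.congr_of_eventuallyEq heq)
  have hd : HasDerivAt (fun t => W 0 0 + ∫ τ in (0 : ℝ)..t, R 0 τ) (R 0 t) t :=
    (intervalIntegral.integral_hasDerivAt_right (cR0.intervalIntegrable _ _)
      (cR0.stronglyMeasurableAtFilter _ _) cR0.continuousAt).const_add _
  rw [← funext key] at hd
  refine hd.congr_deriv ?_
  rw [sympField_apply]
  exact fderiv_hamField hΩ hH (hZΩ t) _

end Variation

/-! ### The linearized system in action-angle coordinates -/

section ActionAngle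

variable {H L : PhaseSpace 2 → ℝ} {W Ω : Set (PhaseSpace 2)} {z₀ : PhaseSpace 2}
  {T : ℝ} {z : ℝ → PhaseSpace 2}

namespace PeriodicNondeg.ActionAngle

variable (c : ActionAngle H L W z₀)

/-- The variation, at the orbit through `Ψ(I, ϕ)`, in the direction of `(X, Y)`. -/
noncomputable def variation (I ϕ X Y : Plane) (t : ℝ) : PhaseSpace 2 :=
  fderiv ℝ c.Ψ (I, ϕ + t • gradient c.K I) (X, Y + t • hess c.K I X)

theorem hasFDerivAt_Ψ {I : Plane} (hI : I ∈ c.D) (ϕ : Plane) :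
    HasFDerivAt c.Ψ (fderiv ℝ c.Ψ (I, ϕ)) (I, ϕ) :=
  ((c.Ψ_contDiffOn.contDiffAt ((c.isOpen_D.prod isOpen_univ).mem_nhds
    ⟨hI, trivial⟩)).differentiableAt (by norm_num)).hasFDerivAt

theorem hasDerivAt_orbit {I : Plane} (hI : I ∈ c.D) (ϕ : Plane) (t : ℝ) :
    HasDerivAt (fun s : ℝ => c.Ψ (I, ϕ + s • gradient c.K I))
      (hamField H (c.Ψ (I, ϕ + t • gradient c.K I))) t :=
  hamiltonian_system_iff.1 (c.canonical I hI ϕ t)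

/-- The variation is the derivative at `s = 0` of the orbits through `Ψ(I + sX, ϕ + sY)`. Moving `I`
also changes the frequency `∇K(I)`, which produces the term growing linearly in `t`. -/
theorem hasDerivAt_variation (hΩ : IsOpen Ω) (hH : ContDiffOn ℝ 2 H Ω) {I : Plane}
    (hI : I ∈ c.D) (ϕ X Y : Plane) (hmem : ∀ t : ℝ, c.Ψ (I, ϕ + t • gradient c.K I) ∈ Ω) (t : ℝ) :
    HasDerivAt (c.variation I ϕ X Y)
      (sympField (fun t => hess H (c.Ψ (I, ϕ + t • gradient c.K I))) t
        (c.variation I ϕ X Y t)) t := by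
  have hKc := contDiffOn_gradient c.isOpen_D c.K_contDiffOn
  have hline : Continuous fun s : ℝ => I + s • X := by fun_prop
  let S : Set ℝ := {s | I + s • X ∈ c.D}
  have hS : IsOpen S := c.isOpen_D.preimage hline
  have cI : ContinuousOn (fun q : ℝ × ℝ => I + q.1 • X) (S ×ˢ univ) := by fun_prop
  have mI : MapsTo (fun q : ℝ × ℝ => I + q.1 • X) (S ×ˢ univ) c.D := fun q hq => hq.1
  have cg : ContinuousOn (fun q : ℝ × ℝ => gradient c.K (I + q.1 • X)) (S ×ˢ univ) :=
    hKc.continuousOn.comp cI mI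
  have ch : ContinuousOn (fun q : ℝ × ℝ => hess c.K (I + q.1 • X)) (S ×ˢ univ) :=
    (continuousOn_hess c.isOpen_D c.K_contDiffOn).comp cI mI
  have cp : ContinuousOn (fun q : ℝ × ℝ =>
      (I + q.1 • X, (ϕ + q.1 • Y) + q.2 • gradient c.K (I + q.1 • X))) (S ×ˢ univ) := by
    fun_prop
  have mp : MapsTo (fun q : ℝ × ℝ =>
      (I + q.1 • X, (ϕ + q.1 • Y) + q.2 • gradient c.K (I + q.1 • X))) (S ×ˢ univ)
      (c.D ×ˢ univ) := fun q hq => ⟨hq.1, trivial⟩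
  have cD : ContinuousOn (fderiv ℝ c.Ψ) (c.D ×ˢ univ) :=
    c.Ψ_contDiffOn.continuousOn_fderiv_of_isOpen (c.isOpen_D.prod isOpen_univ) le_rfl
  have h := _root_.hasDerivAt_variation hΩ hH (S := S)
    (Z := fun s t => c.Ψ (I + s • X, (ϕ + s • Y) + t • gradient c.K (I + s • X)))
    (W := fun s t => fderiv ℝ c.Ψ (I + s • X, (ϕ + s • Y) + t • gradient c.K (I + s • X))
      (X, Y + t • hess c.K (I + s • X) X)) hS (by simpa [S] using hI)
    (fun s hs t => c.hasDerivAt_orbit hs _ t)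
    (fun s hs t => by
      have h1 : HasDerivAt (fun s : ℝ => I + s • X) X s := by
        simpa using ((hasDerivAt_id s).smul_const X).const_add I
      have h2 : HasDerivAt (fun s : ℝ => ϕ + s • Y) Y s := by
        simpa using ((hasDerivAt_id s).smul_const Y).const_add ϕ
      have h3 : HasFDerivAt (gradient c.K) (hess c.K (I + s • X)) (I + s • X) :=
        ((hKc.contDiffAt (c.isOpen_D.mem_nhds hs)).differentiableAt (by norm_num)).hasFDerivAt
      have h4 := h1.prodMk (h2.add ((h3.comp_hasDerivAt s h1).const_smul t))
      exact (c.hasFDerivAt_Ψ hs _).comp_hasDerivAt s h4)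
    (c.Ψ_contDiffOn.continuousOn.comp cp mp)
    ((cD.comp cp mp).clm_apply (by fun_prop))
    (by simpa using hmem) t
  unfold variation
  simpa using h

/-- After a period of the orbit, the angles have changed by multiples of `2π`, and the
derivative of `Ψ` is the same. -/
theorem fderiv_Ψ_eq_of_periodic {I : Plane} (hI : I ∈ c.D) {ϕ : Plane}
    (h : c.Ψ (I, ϕ + T • gradient c.K I) = c.Ψ (I, ϕ)) :
    fderiv ℝ c.Ψ (I, ϕ + T • gradient c.K I) = fderiv ℝ c.Ψ (I, ϕ) := by
  obtain ⟨-, m, hm⟩ := (c.Ψ_eq_iff I hI I hI _ _).1 h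
  -- The shift `T ∇K(I)`, with `I` frozen, is a fixed vector of `2πℤ²`; hence `Ψ` is invariant under
  -- it at every point over `D`, and so is its derivative.
  have hev : (fun q => c.Ψ (q + ((0 : Plane), T • gradient c.K I))) =ᶠ[𝓝 (I, ϕ)] c.Ψ := by
    filter_upwards [(c.isOpen_D.prod isOpen_univ).mem_nhds
      (show (I, ϕ) ∈ c.D ×ˢ univ from ⟨hI, trivial⟩)] with q hq
    have e : q + ((0 : Plane), T • gradient c.K I) = (q.1, q.2 + T • gradient c.K I) := by
      ext <;> simp
    rw [e]
    refine (c.Ψ_eq_iff q.1 hq.1 q.1 hq.1 _ _).2 ⟨rfl, m, fun i => ?_⟩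
    have h1 := hm i
    rw [PiLp.add_apply] at h1 ⊢
    linarith
  have h1 := hev.fderiv_eq (𝕜 := ℝ)
  rw [fderiv_comp_add_right] at h1
  rw [← h1]
  simp

/-- A solution starting on the torus `I` moves linearly in the angle coordinates. -/
theorem orbit_eq (hΩ : IsOpen Ω) (hH : ContDiffOn ℝ 2 H Ω) (hz : IsPeriodicSolution H Ω T z)
    {I ϕ : Plane} (hI : I ∈ c.D) (h0 : c.Ψ (I, ϕ) = z 0) :
    z = fun t => c.Ψ (I, ϕ + t • gradient c.K I) :=
  hamiltonian_unique hΩ hH hz.mem (fun t => hamiltonian_system_iff.1 (hz.solves t))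
    (c.hasDerivAt_orbit hI ϕ) (t₀ := 0) (by simp [h0])

/-- Since `DΨ` is invertible at the initial point, every linearized solution is a variation for a
unique `(X, Y)`. Over one period it changes by `DΨ(0, T ∇²K(I) X)`, so periodicity constrains `X`
alone. -/
theorem rank_periodicSolutions (hΩ : IsOpen Ω) (hH : ContDiffOn ℝ 2 H Ω) (hT : 0 < T)
    (hz : IsPeriodicSolution H Ω T z) {I ϕ : Plane} (hI : I ∈ c.D) (h0 : c.Ψ (I, ϕ) = z 0) :
    Module.rank ℝ (periodicSolutions (fun t => hess H (z t)) T) =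
      Module.rank ℝ (LinearMap.ker ((hess c.K I).toLinearMap.comp
        (LinearMap.fst ℝ Plane Plane))) := by
  have hzeq := c.orbit_eq hΩ hH hz hI h0
  have hzt : ∀ t, c.Ψ (I, ϕ + t • gradient c.K I) = z t := fun t => (congrFun hzeq t).symm
  have hS := hz.continuous_hess hΩ hH
  have pS := hz.periodic_hess
  obtain ⟨C, hC⟩ := exists_bound_of_continuous_periodic (continuous_sympField hS) hT
    (periodic_sympField pS)
  have hvar : ∀ X Y t, HasDerivAt (c.variation I ϕ X Y)
      (sympField (fun t => hess H (z t)) t (c.variation I ϕ X Y t)) t := by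
    intro X Y t
    have h := c.hasDerivAt_variation hΩ hH hI ϕ X Y (fun t => hzt t ▸ hz.mem t) t
    simpa only [hzt] using h
  have hper : fderiv ℝ c.Ψ (I, ϕ + T • gradient c.K I) = fderiv ℝ c.Ψ (I, ϕ) := by
    refine c.fderiv_Ψ_eq_of_periodic hI ?_
    have := hz.periodic 0
    rw [zero_add] at this
    rw [hzt, h0, this]
  have hv0 : ∀ X Y, c.variation I ϕ X Y 0 = fderiv ℝ c.Ψ (I, ϕ) (X, Y) := fun X Y => by
    simp [variation]
  have hbij := c.Ψ_immersion I hI ϕ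
  have hvT : ∀ X Y, c.variation I ϕ X Y T = c.variation I ϕ X Y 0 ↔ hess c.K I X = 0 := by
    intro X Y
    rw [hv0, variation, hper, hbij.1.eq_iff, Prod.mk.injEq]
    simp [hT.ne']
  let e : (Plane × Plane) ≃ₗ[ℝ] PhaseSpace 2 :=
    LinearEquiv.ofBijective (fderiv ℝ c.Ψ (I, ϕ)).toLinearMap hbij
  have he : ∀ q, e q = fderiv ℝ c.Ψ (I, ϕ) q := fun _ => rfl
  let ev : periodicSolutions (fun t => hess H (z t)) T →ₗ[ℝ] Plane × Plane :=
    e.symm.toLinearMap.comp ((LinearMap.proj (0 : ℝ)).comp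
      (periodicSolutions (fun t => hess H (z t)) T).subtype)
  have hev : ∀ w, e (ev w) = w.1 0 := fun w => e.apply_symm_apply _
  have hsol : ∀ w : periodicSolutions (fun t => hess H (z t)) T,
      w.1 = c.variation I ϕ (ev w).1 (ev w).2 := fun w =>
    linear_ode_unique hC (mem_periodicSolutions_iff.1 w.2).1 (hvar _ _) (t₀ := 0) (by
      rw [hv0, ← he, hev])
  have hinj : Function.Injective ev := fun w u h => Subtype.ext (by rw [hsol w, hsol u, h])
  have hr : LinearMap.range ev = LinearMap.ker ((hess c.K I).toLinearMap.comp
      (LinearMap.fst ℝ Plane Plane)) := by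
    ext q
    constructor
    · rintro ⟨w, rfl⟩
      have h1 : w.1 T = w.1 0 := by simpa using w.2.2 0
      rw [hsol w] at h1
      exact (hvT _ _).1 h1
    · intro hq
      have h1 : c.variation I ϕ q.1 q.2 T = c.variation I ϕ q.1 q.2 0 := (hvT _ _).2 hq
      refine ⟨⟨c.variation I ϕ q.1 q.2, mem_periodicSolutions_iff.2 ⟨hvar _ _,
        periodic_of_apply_eq hS hT pS (hvar _ _) h1⟩⟩, e.injective ?_⟩
      rw [hev, he]
      exact hv0 _ _
  rw [← hr]
  exact (LinearEquiv.ofInjective ev hinj).rank_eq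

end PeriodicNondeg.ActionAngle

/-- The kernel sits in a four-dimensional space and has dimension `4 - rank A`, which is `2` exactly
when `A` is onto. -/
theorem rank_ker_comp_fst_iff (A : Plane →L[ℝ] Plane) :
    Module.rank ℝ (LinearMap.ker (A.toLinearMap.comp (LinearMap.fst ℝ Plane Plane))) = (2 : ℕ) ↔
      A.det ≠ 0 := by
  have h1 := (A.toLinearMap.comp (LinearMap.fst ℝ Plane Plane)).finrank_range_add_finrank_ker
  rw [LinearMap.range_comp_of_range_eq_top _ Submodule.range_fst, Module.finrank_prod,
    finrank_euclideanSpace_fin] at h1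
  have h2 : A.det ≠ 0 ↔ LinearMap.range A.toLinearMap = ⊤ := by
    rw [← LinearMap.isUnit_iff_range_eq_top, LinearMap.isUnit_iff_isUnit_det, isUnit_iff_ne_zero]
  rw [h2, ← Module.finrank_eq_rank, Nat.cast_inj]
  constructor
  · intro h
    refine Submodule.eq_top_of_finrank_eq ?_
    rw [finrank_euclideanSpace_fin]
    omega
  · intro h
    rw [h, finrank_top, finrank_euclideanSpace_fin] at h1
    omega

end ActionAngle

/-! ### The orbit torus and the final equivalences -/

section Main

variable {a b : EReal} {f V : ℝ → ℝ} {x : ℝ → Plane} {T : ℝ}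

theorem initialData_rotTranslates (hx : IsCentralSolution a f V x) :
    initialData f '' rotTranslates x = orbitTorus (centralLift f x) := by
  have key : ∀ ϕ θ : ℝ, initialData f (fun t => rot ϕ (x (t - θ)))
      = rotPhase ϕ (centralLift f x (-θ)) := by
    intro ϕ θ
    have h1 : HasDerivAt (fun t => x (t - θ)) (deriv x (0 - θ)) 0 :=
      ((hx (0 - θ)).2.1.hasDerivAt).comp_sub_const 0 θ
    have h2 : HasDerivAt (fun t => rot ϕ (x (t - θ))) (rot ϕ (deriv x (0 - θ))) 0 := by
      simp only [rot_eq]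
      exact (h1.const_smul (Real.cos ϕ)).add
        ((quarterTurn.hasFDerivAt.comp_hasDerivAt 0 h1).const_smul (Real.sin ϕ))
    refine phase_ext ?_ ?_
    · rw [initialData, pos_pair, pos_rotPhase, centralLift, pos_pair, zero_sub]
    · rw [initialData, mom_pair, mom_rotPhase, centralLift, mom_pair, h2.deriv, phiMap_rot,
        zero_sub]
  ext w
  constructor
  · rintro ⟨_, ⟨ϕ, θ, rfl⟩, rfl⟩
    exact ⟨(ϕ, θ), (key ϕ θ).symm⟩
  · rintro ⟨⟨ϕ, θ⟩, rfl⟩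
    exact ⟨_, ⟨ϕ, θ, rfl⟩, key ϕ θ⟩

theorem periodic_centralLift (hp : Function.Periodic x T) :
    Function.Periodic (centralLift f x) T := fun t => by
  have h : (fun s => x (s + T)) = x := funext hp
  have h1 : deriv x (t + T) = deriv x t := by rw [← deriv_comp_add_const, h]
  rw [centralLift, centralLift, hp t, h1]

theorem isRegularOrbit_centralLift (hf : IsRadialProfile a b f) (hV : ContDiffOn ℝ 2 V (Ioi 0))
    (hx : IsCentralSolution a f V x) (hc : ¬ IsCircular x) (hr : ¬ IsRectilinear x) :
    IsRegularOrbit a b f V (centralLift f x) :=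
  ⟨centralLift_mem hf hx hr, hasDerivAt_centralLift_hamField hf hV hx hr, hc⟩

theorem isPeriodicManifold_orbitTorus (hT : 0 < T) (hf : IsRadialProfile a b f)
    (hV : ContDiffOn ℝ 2 V (Ioi 0)) {z : ℝ → PhaseSpace 2} (hz : IsRegularOrbit a b f V z)
    (hL : ∀ t s, angMom (z t) = angMom (z s)) (hp : Function.Periodic z T) :
    IsPeriodicManifold (centralHam a f V) (centralRegular b) T 2 (orbitTorus z) where
  subset := by
    rintro _ ⟨⟨ϕ, θ⟩, rfl⟩
    exact rotPhase_mem (hz.mem _)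
  isCompact := isCompact_orbitTorus hT hz.continuous hp
  isManifold := hz.isEmbeddedSubmanifold hf hV hL
  exists_solution := by
    rintro _ ⟨⟨ϕ, θ⟩, rfl⟩
    have hy := hz.rotPhase_translate hf hV ϕ θ
    refine ⟨fun t => rotPhase ϕ (z (t - θ)), ⟨hy.mem, fun t =>
      hamiltonian_system_iff.2 (hy.hasDerivAt t), fun t => ?_⟩, by simp, ?_⟩
    · have := hp (t - θ)
      rw [← this, sub_add_eq_add_sub]
    -- A constant solution would in particular have constant radius.
    · by_contra! h
      exact hy.not_circular ⟨_, fun t => by rw [h t]⟩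

/-- The dimension of the periodic solutions depends on the orbit only through its action, and all
orbits of the torus share the action `I`. One determinant therefore decides the condition on the
whole torus. -/
theorem linearizedCondition_iff_det (hT : 0 < T) (hf : IsRadialProfile a b f)
    (hV : ContDiffOn ℝ 2 V (Ioi 0)) {z : ℝ → PhaseSpace 2} (hz : IsRegularOrbit a b f V z)
    (hL : ∀ t s, angMom (z t) = angMom (z s)) (hp : Function.Periodic z T)
    (c : ActionAngle (centralHam a f V) angMom (centralPhase b) (z 0)) {I : Plane}
    (hI : I ∈ c.D) (hη : c.η I = !₂[centralHam a f V (z 0), angMom (z 0)]) :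
    LinearizedCondition (centralHam a f V) (centralRegular b) T 2 (orbitTorus z) ↔
      (hess c.K I).det ≠ 0 := by
  have hΩ := isOpen_centralRegular b
  have hH := contDiffOn_centralHam (b := b) hf hV
  have h0 : z 0 ∈ orbitTorus z := ⟨(0, 0), by simp [rotPhase_zero]⟩
  have hval : ∀ w ∈ orbitTorus z, centralHam a f V w = centralHam a f V (z 0) ∧
      angMom w = angMom (z 0) := fun w hw => by
    have h := hz.energyMomentum_eq hf hV hL hw
    exact ⟨congrArg (fun v : Plane => v 0) h, congrArg (fun v : Plane => v 1) h⟩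
  have hconn : IsPreconnected (orbitTorus z) :=
    isPreconnected_range (continuous_rotPhase_orbit hz.continuous)
  -- The torus is connected, contains `z 0` and lies in the common level set, hence in the component
  -- covered by the chart.
  have hMU : orbitTorus z ⊆ c.U := by
    refine (hconn.subset_connectedComponentIn h0 fun w hw => ?_).trans c.component_subset
    refine ⟨?_, hval w hw⟩
    obtain ⟨⟨ϕ, θ⟩, rfl⟩ := hw
    exact (rotPhase_mem (hz.mem _)).1
  have hcoord : ∀ w ∈ orbitTorus z, ∃ ϕ, c.Ψ (I, ϕ) = w := by
    intro w hw
    have hwU := hMU hw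
    rw [← c.Ψ_image] at hwU
    obtain ⟨⟨I', ϕ⟩, ⟨hI', -⟩, rfl⟩ := hwU
    have hlev : c.Ψ (I', ϕ) ∈ c.Ψ '' ({I'} ×ˢ univ) := ⟨(I', ϕ), ⟨rfl, trivial⟩, rfl⟩
    rw [c.level I' hI'] at hlev
    obtain ⟨⟨h1, h2⟩, -⟩ := hlev
    obtain ⟨h3, h4⟩ := hval _ hw
    -- Energy and angular momentum are constant on the torus, and `η` is injective, so the actions
    -- agree.
    have e : c.η I' = c.η I := by
      rw [hη]
      ext i
      fin_cases i
      · exact h1.symm.trans h3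
      · exact h2.symm.trans h4
    exact ⟨ϕ, by rw [← c.η_bijOn.injOn hI' hI e]⟩
  have hpt : ∀ y, IsPeriodicSolution (centralHam a f V) (centralRegular b) T y →
      y 0 ∈ orbitTorus z →
      (Module.rank ℝ (periodicSolutions (fun t => hess (centralHam a f V) (y t)) T) = (2 : ℕ) ↔
        (hess c.K I).det ≠ 0) := by
    intro y hy hy0
    obtain ⟨ϕ, hϕ⟩ := hcoord _ hy0
    rw [c.rank_periodicSolutions hΩ hH hT hy hI hϕ, rank_ker_comp_fst_iff]
  constructor
  · intro h
    have hzs : IsPeriodicSolution (centralHam a f V) (centralRegular b) T z :=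
      ⟨hz.mem, fun t => hamiltonian_system_iff.2 (hz.hasDerivAt t), hp⟩
    exact (hpt z hzs h0).1 (h z hzs h0)
  · exact fun h y hy hy0 => (hpt y hy hy0).2 h

end Main

theorem proposition4p1 (T : ℝ) [Fact (0 < T)] :
    (∀ (N k : ℕ) (Ω : Set (PhaseSpace N)) (H : PhaseSpace N → ℝ) (M : Set (PhaseSpace N)),
      IsOpen Ω → ContDiffOn ℝ 2 H Ω → IsPeriodicManifold H Ω T k M →
      List.TFAE [
        MonodromyCondition H Ω T k M,
        LinearizedCondition H Ω T k M,
        ActionCondition H Ω T k M]) ∧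
    (∀ (a b : EReal) (f V : ℝ → ℝ) (x : ℝ → Plane),
      IsRadialProfile a b f → ContDiffOn ℝ 2 V (Set.Ioi 0) →
      IsCentralSolution a f V x → Function.Periodic x T → ¬ IsCircular x → ¬ IsRectilinear x →
      IsPeriodicManifold (centralHam a f V) (centralRegular b) T 2
        (initialData f '' rotTranslates x) ∧
      ∀ (c : ActionAngle (centralHam a f V) angMom (centralPhase b) (initialData f x)),
        ∀ I ∈ c.D, c.η I = !₂[centralHam a f V (initialData f x), angMom (initialData f x)] →
        List.TFAE [
          MonodromyCondition (centralHam a f V) (centralRegular b) T 2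
            (initialData f '' rotTranslates x),
          LinearizedCondition (centralHam a f V) (centralRegular b) T 2
            (initialData f '' rotTranslates x),
          ActionCondition (centralHam a f V) (centralRegular b) T 2
            (initialData f '' rotTranslates x),
          (hess c.K I).det ≠ 0]) := by
  have hT : 0 < T := Fact.out
  refine ⟨fun N k Ω H M hΩ hH _ => nondegeneracy_tfae hΩ hH, ?_⟩
  intro a b f V x hf hV hx hp hc hr
  have hz := isRegularOrbit_centralLift hf hV hx hc hr
  have hL := angMom_centralLift_const hx
  have hpz := periodic_centralLift (f := f) hp
  rw [initialData_rotTranslates hx]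
  refine ⟨isPeriodicManifold_orbitTorus hT hf hV hz hL hpz, fun c I hI hη => ?_⟩
  have hΩ := isOpen_centralRegular b
  have hH := contDiffOn_centralHam (b := b) hf hV
  have h4 := linearizedCondition_iff_det hT hf hV hz hL hpz c hI hη
  tfae_have 1 ↔ 2 := monodromyCondition_iff hT hΩ hH
  tfae_have 3 ↔ 2 := actionCondition_iff hΩ hH
  tfae_have 2 ↔ 4 := h4
  tfae_finish
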